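/- Let $W$ be a closed connected oriented surface of positive genus, given with a finite oriented triangulation (every closed oriented surface admits one), let $w\in W$ and $\pi=\pi_1(W,w)$. Let $\chi(W)$ be the Euler characteristic and let $[W]\in H_2(\pi;\mathbb{Z})$ denote the image of the fundamental class of $W$ under the canonical map $H_2(W;\mathbb{Z})\to H_2(\pi;\mathbb{Z})$. Let $p:\pi'\to\pi$ be a group epimorphism with finite kernel $\Phi$. Let $\mathrm{Irr}(\Phi)$ be the set of equivalence classes of irreducible complex representations $\rho:\Phi\to GL_n(\mathbb{C})$, $n=\dim\rho\ge 1$, where $\rho$ and $\rho'$ are equivalent if $\rho'=M^{-1}\rho M$ for some $M\in GL_n(\mathbb{C})$. For an irreducible $\rho$, let $\pi_\rho\subset\pi$ be the subgroup of all $\alpha$ such that $h\mapsto\rho(\tilde\alpha^{-1}h\tilde\alpha)$ is equivalent to $\rho$ for some $\tilde\alpha\in p^{-1}(\alpha)$. For each $\alpha\in\pi_\rho$ choose such an $\tilde\alpha$ and a matrix $M_\alpha\in GL_n(\mathbb{C})$ with $\rho(\tilde\alpha^{-1}h\tilde\alpha)=M_\alpha^{-1}\rho(h)M_\alpha$ for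 all $h\in\Phi$. The unique scalars $\zeta_{\alpha,\beta}\in\mathbb{C}^*$ with $$\zeta_{\alpha,\beta}\,M_\alpha M_\beta=M_{\alpha\beta}\,\rho\bigl(\widetilde{\alpha\beta}^{-1}\tilde\alpha\tilde\beta\bigr)$$ form a 2-cocycle on $\pi_\rho$; let $\zeta_\rho\in H^2(\pi_\rho;\mathbb{C}^*)$ be its cohomology class (trivial action on $\mathbb{C}^*$). It does not depend on the choices. If $\pi_\rho=\pi$, then $\zeta_\rho([W])\in\mathbb{C}^*$ is the value of $\zeta_\rho$ on $[W]$. Both $\pi_\rho$ and $\zeta_\rho$ depend only on the class of $\rho$. Then $\mathrm{Irr}(\Phi)$ and the set $S_*(p)$ of all homomorphisms $s:\pi\to\pi'$ with $p\circ s=\mathrm{id}_\pi$ are finite, and $$|S_*(p)|=|\Phi|\sum_{\rho\in\mathrm{Irr}(\Phi),\ \pi_\rho=\pi}\left(\frac{|\Phi|}{\dim\rho}\right)^{-\chi(W)}\zeta_\rho([W]).$$ -/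

import Mathlib

open CategoryTheory
open scoped Matrix

noncomputable section

/-! ### Irreducible representations -/

/-- A representation `ρ : Γ → GL_n(ℂ)` is irreducible: `n ≥ 1`, and the only subspaces of `ℂⁿ`
preserved by `Γ` are `0` and `ℂⁿ`. -/
def IsIrreducibleRep {Γ : Type*} [Group Γ] {n : ℕ} (ρ : Γ →* GL (Fin n) ℂ) : Prop :=
  0 < n ∧ ∀ U : Submodule ℂ (Fin n → ℂ),
    (∀ h : Γ, ∀ x ∈ U, (ρ h : Matrix (Fin n) (Fin n) ℂ) *ᵥ x ∈ U) → U = ⊥ ∨ U = ⊤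

/-- Two `n`-dimensional representations are equivalent: `ρ' h = M⁻¹ ρ(h) M` for a fixed
`M ∈ GL_n(ℂ)`. -/
def RepEquivalent {Γ : Type*} [Group Γ] {n : ℕ} (ρ ρ' : Γ →* GL (Fin n) ℂ) : Prop :=
  ∃ M : GL (Fin n) ℂ, ∀ h : Γ, ρ' h = M⁻¹ * ρ h * M

/-- Equivalence as a setoid on the `n`-dimensional irreducible representations. -/
def irrSetoid (Γ : Type*) [Group Γ] (n : ℕ) :
    Setoid {ρ : Γ →* GL (Fin n) ℂ // IsIrreducibleRep ρ} where
  r ρ ρ' := RepEquivalent ρ.1 ρ'.1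
  iseqv :=
    { refl := fun ρ => ⟨1, fun h => by simp⟩
      symm := by
        rintro ρ ρ' ⟨M, hM⟩
        exact ⟨M⁻¹, fun h => by rw [hM]; group⟩
      trans := by
        rintro ρ ρ' ρ'' ⟨M, hM⟩ ⟨M', hM'⟩
        exact ⟨M * M', fun h => by rw [hM', hM]; group⟩ }

/-- `Irr(Γ)`: equivalence classes of irreducible complex representations of `Γ`, sorted by
dimension (representations of different dimensions are never equivalent). -/
def Irr (Γ : Type*) [Group Γ] : Type _ := Σ n : ℕ, Quotient (irrSetoid Γ n)

/-- The dimension of (the representations in) a class. -/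
def Irr.dim {Γ : Type*} [Group Γ] (ρ : Irr Γ) : ℕ := ρ.1

/-- A representation in the class. -/
def Irr.rep {Γ : Type*} [Group Γ] (ρ : Irr Γ) : Γ →* GL (Fin ρ.dim) ℂ := (Quotient.out ρ.2).1

theorem Irr.rep_irreducible {Γ : Type*} [Group Γ] (ρ : Irr Γ) : IsIrreducibleRep ρ.rep :=
  (Quotient.out ρ.2).2

/-- Schur's lemma for matrices. -/
theorem schur_scalar {Γ : Type*} [Group Γ] {n : ℕ} {ρ : Γ →* GL (Fin n) ℂ}
    (hρ : IsIrreducibleRep ρ) (X : GL (Fin n) ℂ) (hX : ∀ h, X * ρ h = ρ h * X) :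
    ∃ z : ℂˣ, (X : Matrix (Fin n) (Fin n) ℂ) = (z : ℂ) • 1 := by
  have : Nonempty (Fin n) := ⟨⟨0, hρ.1⟩⟩
  have : Nontrivial (Fin n → ℂ) := inferInstance
  obtain ⟨c, hc⟩ := Module.End.exists_eigenvalue (Matrix.toLin' (X : Matrix (Fin n) (Fin n) ℂ))
  have hinv := hρ.2 (Module.End.eigenspace (Matrix.toLin' (X : Matrix (Fin n) (Fin n) ℂ)) c) (by
    intro h x hx
    rw [Module.End.mem_eigenspace_iff] at hx ⊢
    have h1 := congrArg (fun Y : GL (Fin n) ℂ => (Y : Matrix (Fin n) (Fin n) ℂ)) (hX h)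
    simp only [Units.val_mul] at h1
    rw [Matrix.toLin'_apply] at hx ⊢
    rw [Matrix.mulVec_mulVec, h1, ← Matrix.mulVec_mulVec, hx, Matrix.mulVec_smul])
  have htop := hinv.resolve_left hc
  have hXc : (X : Matrix (Fin n) (Fin n) ℂ) = c • 1 := by
    apply Matrix.toLin'.injective
    ext1 i
    ext1
    have : Pi.single i (1 : ℂ) ∈
        Module.End.eigenspace (Matrix.toLin' (X : Matrix (Fin n) (Fin n) ℂ)) c := by
      rw [htop]; trivial
    rw [Module.End.mem_eigenspace_iff] at this
    simp [this] 
  have hc0 : c ≠ 0 := by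
    rintro rfl
    have := X.ne_zero
    simp [hXc] at this
  exact ⟨Units.mk0 c hc0, by simpa using hXc⟩

/-! ### Stabilisers -/

section Zeta

/-- The conjugate `h ↦ ρ(a⁻¹ h a)` of a representation `ρ` of `Ker q` by `a ∈ G'`. -/
def conjRep {G' G : Type*} [Group G'] [Group G] (q : G' →* G) {n : ℕ}
    (ρ : q.ker →* GL (Fin n) ℂ) (a : G') : q.ker →* GL (Fin n) ℂ :=
  ρ.comp (MulAut.conjNormal a⁻¹ : MulAut q.ker).toMonoidHom

theorem conjRep_mul {G' G : Type*} [Group G'] [Group G] (q : G' →* G) {n : ℕ}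
    (ρ : q.ker →* GL (Fin n) ℂ) (a b : G') (h : q.ker) :
    conjRep q ρ (a * b) h = conjRep q ρ b (MulAut.conjNormal a⁻¹ h) := by
  simp [conjRep]

/-- `G_ρ`: the stabiliser of the class of `ρ` in `G`, that is the set of all `α ∈ G` such that
`h ↦ ρ(a⁻¹ h a)` is equivalent to `ρ` for some `a ∈ q⁻¹(α)`. -/
def repStabilizer {G' G : Type*} [Group G'] [Group G] (q : G' →* G) {n : ℕ}
    (ρ : q.ker →* GL (Fin n) ℂ) : Subgroup G where
  carrier := {α | ∃ a : G', q a = α ∧ RepEquivalent ρ (conjRep q ρ a)}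
  one_mem' := ⟨1, map_one q, 1, fun h => by simp [conjRep]⟩
  mul_mem' := by
    rintro α β ⟨a, rfl, M, hM⟩ ⟨b, rfl, M', hM'⟩
    refine ⟨a * b, map_mul q a b, M * M', fun h => ?_⟩
    have h1 := hM h
    rw [conjRep_mul, hM']
    simp only [conjRep, MonoidHom.comp_apply, MulEquiv.coe_toMonoidHom] at h1
    rw [h1]; group
  inv_mem' := by
    rintro α ⟨a, rfl, M, hM⟩
    refine ⟨a⁻¹, map_inv q a, M⁻¹, fun h => ?_⟩
    have h1 := hM (MulAut.conjNormal a h)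
    simp only [conjRep, MonoidHom.comp_apply, MulEquiv.coe_toMonoidHom, inv_inv] at h1 ⊢
    have h2 : (MulAut.conjNormal a⁻¹ : MulAut q.ker) (MulAut.conjNormal a h) = h := by
      ext; simp
    rw [h2] at h1
    rw [h1]; group

variable {G' G : Type*} [Group G'] [Group G] (q : G' →* G) {n : ℕ} (ρ : q.ker →* GL (Fin n) ℂ)

/-- The chosen lift `α̃ ∈ q⁻¹(α)`. -/
def zetaLift (α : repStabilizer q ρ) : G' := α.2.choose

theorem zetaLift_spec (α : repStabilizer q ρ) : q (zetaLift q ρ α) = α := α.2.choose_spec.1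

/-- The chosen matrix `M_α` with `ρ(α̃⁻¹ h α̃) = M_α⁻¹ ρ(h) M_α`. -/
def zetaMatrix (α : repStabilizer q ρ) : GL (Fin n) ℂ := α.2.choose_spec.2.choose

theorem zetaMatrix_spec (α : repStabilizer q ρ) (h : q.ker) :
    ρ (MulAut.conjNormal (zetaLift q ρ α)⁻¹ h) =
      (zetaMatrix q ρ α)⁻¹ * ρ h * zetaMatrix q ρ α :=
  α.2.choose_spec.2.choose_spec h

/-- The element `(αβ)~⁻¹ α̃ β̃` of `Ker q`. -/
def zetaKer (α β : repStabilizer q ρ) : q.ker :=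
  ⟨(zetaLift q ρ (α * β))⁻¹ * zetaLift q ρ α * zetaLift q ρ β, by
    simp [MonoidHom.mem_ker, zetaLift_spec, mul_assoc]⟩

theorem exists_zeta (hρ : IsIrreducibleRep ρ) (α β : repStabilizer q ρ) :
    ∃ z : ℂˣ, (z : ℂ) • ((zetaMatrix q ρ α * zetaMatrix q ρ β : GL (Fin n) ℂ) :
        Matrix (Fin n) (Fin n) ℂ) =
      ((zetaMatrix q ρ (α * β) * ρ (zetaKer q ρ α β) : GL (Fin n) ℂ) :
        Matrix (Fin n) (Fin n) ℂ) := by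
  set A := zetaMatrix q ρ α with hA
  set B := zetaMatrix q ρ β with hB
  set C := zetaMatrix q ρ (α * β) with hC
  set R := ρ (zetaKer q ρ α β) with hR
  obtain ⟨z, hz⟩ := schur_scalar hρ (C * R * (A * B)⁻¹) (by
    intro h
    have e1 : ρ (MulAut.conjNormal (zetaLift q ρ β)⁻¹ (MulAut.conjNormal (zetaLift q ρ α)⁻¹ h)) =
        B⁻¹ * (A⁻¹ * ρ h * A) * B := by rw [zetaMatrix_spec, zetaMatrix_spec]
    have e2 : MulAut.conjNormal (zetaLift q ρ β)⁻¹ (MulAut.conjNormal (zetaLift q ρ α)⁻¹ h) =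
        (zetaKer q ρ α β)⁻¹ * MulAut.conjNormal (zetaLift q ρ (α * β))⁻¹ h * zetaKer q ρ α β := by
      ext
      simp [zetaKer, mul_assoc]
    rw [e2, map_mul, map_mul, map_inv, zetaMatrix_spec, ← hC, ← hR] at e1
    have e3 : ρ h = C * R * (B⁻¹ * (A⁻¹ * ρ h * A) * B) * R⁻¹ * C⁻¹ := by rw [← e1]; group
    calc C * R * (A * B)⁻¹ * ρ h
        = (C * R * (B⁻¹ * (A⁻¹ * ρ h * A) * B) * R⁻¹ * C⁻¹) * (C * R * (A * B)⁻¹) := by group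
      _ = ρ h * (C * R * (A * B)⁻¹) := by rw [← e3])
  refine ⟨z, ?_⟩
  have : C * R = C * R * (A * B)⁻¹ * (A * B) := by group
  rw [this, Units.val_mul (C * R * (A * B)⁻¹), hz]
  simp

/-- The scalar `ζ_{α,β} ∈ ℂ*` determined by
`ζ_{α,β} M_α M_β = M_{αβ} ρ((αβ)~⁻¹ α̃ β̃)`. -/
def zetaScalar (hρ : IsIrreducibleRep ρ) (α β : repStabilizer q ρ) : ℂˣ :=
  (exists_zeta q ρ hρ α β).choose

theorem zetaScalar_spec (hρ : IsIrreducibleRep ρ) (α β : repStabilizer q ρ) :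
    (zetaScalar q ρ hρ α β : ℂ) • ((zetaMatrix q ρ α * zetaMatrix q ρ β : GL (Fin n) ℂ) :
        Matrix (Fin n) (Fin n) ℂ) =
      ((zetaMatrix q ρ (α * β) * ρ (zetaKer q ρ α β) : GL (Fin n) ℂ) :
        Matrix (Fin n) (Fin n) ℂ) :=
  (exists_zeta q ρ hρ α β).choose_spec

theorem zetaScalar_cocycle (hρ : IsIrreducibleRep ρ) (α β γ : repStabilizer q ρ) :
    zetaScalar q ρ hρ (α * β) γ * zetaScalar q ρ hρ α β =
      zetaScalar q ρ hρ β γ * zetaScalar q ρ hρ α (β * γ) := by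
  have s1 := zetaScalar_spec q ρ hρ α β
  have s2 := zetaScalar_spec q ρ hρ (α * β) γ
  have s3 := zetaScalar_spec q ρ hρ β γ
  have s4 := zetaScalar_spec q ρ hρ α (β * γ)
  rw [← mul_assoc] at s4
  have k : zetaKer q ρ (α * β) γ * MulAut.conjNormal (zetaLift q ρ γ)⁻¹ (zetaKer q ρ α β) =
      zetaKer q ρ α (β * γ) * zetaKer q ρ β γ := by
    ext
    simp [zetaKer, mul_assoc]
  have hk := congrArg ρ k
  rw [map_mul, map_mul, zetaMatrix_spec] at hk
  generalize zetaScalar q ρ hρ (α * β) γ = z2 at *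
  generalize zetaScalar q ρ hρ α β = z1 at *
  generalize zetaScalar q ρ hρ β γ = z3 at *
  generalize zetaScalar q ρ hρ α (β * γ) = z4 at *
  generalize zetaMatrix q ρ α = A at *
  generalize zetaMatrix q ρ β = B at *
  generalize zetaMatrix q ρ γ = C at *
  generalize zetaMatrix q ρ (α * β) = D at *
  generalize zetaMatrix q ρ (β * γ) = E at *
  generalize zetaMatrix q ρ (α * β * γ) = F at *
  generalize ρ (zetaKer q ρ α β) = R1 at *
  generalize ρ (zetaKer q ρ (α * β) γ) = R2 at *
  generalize ρ (zetaKer q ρ β γ) = R3 at *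
  have k' : F * R2 * C⁻¹ * R1 * C = F * (ρ (zetaKer q ρ α (β * γ)) * R3) := by
    rw [← hk]; group
  generalize ρ (zetaKer q ρ α (β * γ)) = R4 at *
  have hp : ∀ (z : ℂˣ) (X Y : GL (Fin n) ℂ),
      (z : ℂ) • (X : Matrix (Fin n) (Fin n) ℂ) = (Y : Matrix (Fin n) (Fin n) ℂ) ↔
        Units.map (algebraMap ℂ (Matrix (Fin n) (Fin n) ℂ)).toMonoidHom z * X = Y := by
    intro z X Y
    rw [Units.ext_iff]
    simp [Algebra.smul_def]
  rw [hp] at s1 s2 s3 s4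
  have hcen : ∀ (z : ℂˣ) (X : GL (Fin n) ℂ),
      X * Units.map (algebraMap ℂ (Matrix (Fin n) (Fin n) ℂ)).toMonoidHom z =
        Units.map (algebraMap ℂ (Matrix (Fin n) (Fin n) ℂ)).toMonoidHom z * X := by
    intro z X
    ext1
    simpa using (Algebra.commutes (z : ℂ) (X : Matrix (Fin n) (Fin n) ℂ)).symm
  set s := Units.map (algebraMap ℂ (Matrix (Fin n) (Fin n) ℂ)).toMonoidHom with hs
  have hinj : Function.Injective s := by
    have : Nonempty (Fin n) := ⟨⟨0, hρ.1⟩⟩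
    exact Units.map_injective (algebraMap ℂ (Matrix (Fin n) (Fin n) ℂ)).injective
  apply hinj
  rw [map_mul, map_mul]
  apply mul_right_cancel (b := A * B * C)
  calc s z2 * s z1 * (A * B * C) = s z2 * (s z1 * (A * B)) * C := by group
    _ = (s z2 * (D * C)) * C⁻¹ * R1 * C := by rw [s1]; group
    _ = F * R2 * C⁻¹ * R1 * C := by rw [s2]
    _ = F * R4 * R3 := by rw [k']; group
    _ = s z4 * (A * (E * R3)) := by rw [← s4]; group
    _ = s z4 * (A * s z3) * (B * C) := by rw [← s3]; group
    _ = s z3 * s z4 * (A * B * C) := by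
      rw [hcen, ← map_mul, mul_comm z3 z4, map_mul]; group

end Zeta

/-! ### Evaluation of `H²(G; ℂ*)` on `H_2(G; ℤ)` -/

/-- `H_2(G; ℤ)`. -/
abbrev IntegralH2 (G : Type) [Group G] : Type := groupHomology.H2 (Rep.trivial ℤ G ℤ)

/-- `H^2(G; ℂ*)`, where `G` acts trivially on `ℂ*`. -/
abbrev UnitsH2 (G : Type) [Group G] : Type :=
  groupCohomology.H2 (Rep.trivial ℤ G (Additive ℂˣ))

/-- `H_2(G; ℤ) → H_2(H; ℤ)` induced by a group homomorphism. -/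
def IntegralH2.map {G H : Type} [Group G] [Group H] (f : G →* H) (x : IntegralH2 G) :
    IntegralH2 H :=
  groupHomology.map (A := Rep.trivial ℤ G ℤ) (B := Rep.trivial ℤ H ℤ) f
    (𝟙 (Rep.trivial ℤ G ℤ)) 2 x

section Kronecker

variable {G : Type} [Group G]

/-- Evaluation of a 2-cochain with values in `ℂ*` on an integral 2-chain (bar complex):
`⟨f, ∑ n_i [a_i|b_i]⟩ = ∏ f(a_i, b_i)^{n_i}`, written additively. -/
def evalChain {G : Type} (f : G × G → Additive ℂˣ) : (G × G →₀ ℤ) →+ Additive ℂˣ :=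
  Finsupp.liftAddHom fun g => (zmultiplesHom (Additive ℂˣ)) (f g)

theorem evalChain_single {G : Type} (f : G × G → Additive ℂˣ) (g : G × G) (n : ℤ) :
    evalChain f (Finsupp.single g n) = n • f g := by
  simp [evalChain]

theorem evalChain_boundary (f : G × G → Additive ℂˣ)
    (hf : f ∈ groupCohomology.cocycles₂ (Rep.trivial ℤ G (Additive ℂˣ))) (c : G × G →₀ ℤ)
    (hc : c ∈ groupHomology.boundaries₂ (Rep.trivial ℤ G ℤ)) : evalChain f c = 0 := by
  obtain ⟨y, rfl⟩ := hc
  rw [groupCohomology.mem_cocycles₂_iff] at hf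
  induction y using Finsupp.induction_linear with
  | zero => simp
  | add y z hy hz => simpa [hy] using hz
  | single g n =>
    have h : f (g.1 * g.2.1, g.2.2) + f (g.1, g.2.1) =
        f (g.2.1, g.2.2) + f (g.1, g.2.1 * g.2.2) := hf g.1 g.2.1 g.2.2
    have h2 : groupHomology.d₃₂ (Rep.trivial ℤ G ℤ) (Finsupp.single g n) =
        (Finsupp.single (g.2.1, g.2.2) (n : ℤ) - Finsupp.single (g.1 * g.2.1, g.2.2) (n : ℤ) +
          Finsupp.single (g.1, g.2.1 * g.2.2) (n : ℤ) - Finsupp.single (g.1, g.2.1) (n : ℤ) :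
            G × G →₀ ℤ) := groupHomology.d₃₂_single (A := Rep.trivial ℤ G ℤ) g n
    have h3 : f (g.2.1, g.2.2) - f (g.1 * g.2.1, g.2.2) + f (g.1, g.2.1 * g.2.2) -
        f (g.1, g.2.1) = 0 := by
      rw [← eq_sub_iff_add_eq] at h
      rw [h]; abel
    refine (congrArg (evalChain f) h2).trans ?_
    rw [map_sub, map_add, map_sub, evalChain_single, evalChain_single, evalChain_single,
      evalChain_single, ← zsmul_sub, ← zsmul_add, ← zsmul_sub, h3, zsmul_zero]

theorem evalChain_coboundary (f : G × G → Additive ℂˣ)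
    (hf : f ∈ groupCohomology.coboundaries₂ (Rep.trivial ℤ G (Additive ℂˣ))) (c : G × G →₀ ℤ)
    (hc : c ∈ groupHomology.cycles₂ (Rep.trivial ℤ G ℤ)) : evalChain f c = 0 := by
  obtain ⟨y, rfl⟩ := hf
  have key : ∀ c : G × G →₀ ℤ,
      evalChain (groupCohomology.d₁₂ (Rep.trivial ℤ G (Additive ℂˣ)) y) c =
        Finsupp.liftAddHom (fun g => (zmultiplesHom (Additive ℂˣ)) (y g))
          (groupHomology.d₂₁ (Rep.trivial ℤ G ℤ) c) := by
    intro c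
    induction c using Finsupp.induction_linear with
    | zero => simp
    | add y z hy hz => rw [map_add, hy, hz, ← map_add, ← map_add]
    | single g n =>
      have h2 : groupHomology.d₂₁ (Rep.trivial ℤ G ℤ) (Finsupp.single g n) =
          (Finsupp.single g.2 (n : ℤ) - Finsupp.single (g.1 * g.2) (n : ℤ) +
            Finsupp.single g.1 (n : ℤ) : G →₀ ℤ) :=
        groupHomology.d₂₁_single (A := Rep.trivial ℤ G ℤ) g n
      rw [evalChain_single]
      refine Eq.trans ?_ (congrArg (Finsupp.liftAddHom
        (fun g => (zmultiplesHom (Additive ℂˣ)) (y g))) h2).symm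
      have h3 : groupCohomology.d₁₂ (Rep.trivial ℤ G (Additive ℂˣ)) y g =
          y g.2 - y (g.1 * g.2) + y g.1 := rfl
      rw [h3, map_add, map_sub, Finsupp.liftAddHom_apply_single, Finsupp.liftAddHom_apply_single,
        Finsupp.liftAddHom_apply_single]
      simp [zsmul_add, zsmul_sub]
  have hc' : groupHomology.d₂₁ (Rep.trivial ℤ G ℤ) c = 0 := hc
  exact (key c).trans (by rw [hc']; simp)

theorem exists_cocycle (ζ : UnitsH2 G) :
    ∃ f : groupCohomology.cocycles₂ (Rep.trivial ℤ G (Additive ℂˣ)),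
      groupCohomology.H2π _ f = ζ :=
  groupCohomology.H2_induction_on ζ fun f => ⟨f, rfl⟩

theorem exists_cycle (x : IntegralH2 G) :
    ∃ c : groupHomology.cycles₂ (Rep.trivial ℤ G ℤ), groupHomology.H2π _ c = x :=
  groupHomology.H2_induction_on x fun c => ⟨c, rfl⟩

/-- The evaluation `ζ(x) ∈ ℂ*` of `ζ ∈ H²(G; ℂ*)` on `x ∈ H_2(G; ℤ)`: evaluate a cocycle that
represents `ζ` on a cycle that represents `x` (independent of the representatives, see
`kronecker_mk`). -/
def kronecker (ζ : UnitsH2 G) (x : IntegralH2 G) : ℂˣ :=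
  (evalChain (exists_cocycle ζ).choose.1 (exists_cycle x).choose.1).toMul

theorem kronecker_mk (f : groupCohomology.cocycles₂ (Rep.trivial ℤ G (Additive ℂˣ)))
    (c : groupHomology.cycles₂ (Rep.trivial ℤ G ℤ)) :
    kronecker (groupCohomology.H2π _ f) (groupHomology.H2π _ c) = (evalChain f.1 c.1).toMul := by
  unfold kronecker
  set f' := (exists_cocycle (groupCohomology.H2π _ f)).choose
  have hf' : groupCohomology.H2π _ f' = groupCohomology.H2π _ f :=
    (exists_cocycle (groupCohomology.H2π _ f)).choose_spec
  set c' := (exists_cycle (groupHomology.H2π _ c)).choose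
  have hc' : groupHomology.H2π _ c' = groupHomology.H2π _ c :=
    (exists_cycle (groupHomology.H2π _ c)).choose_spec
  rw [groupCohomology.H2π_eq_iff] at hf'
  rw [groupHomology.H2π_eq_iff] at hc'
  congr 1
  have h1 := evalChain_coboundary _ hf' c'.1 c'.2
  have h2 := evalChain_boundary f.1 f.2 _ hc'
  rw [map_sub, sub_eq_zero] at h2
  rw [← h2, ← sub_eq_zero, ← h1]
  have : ∀ (a b : G × G → Additive ℂˣ) (c : G × G →₀ ℤ),
      evalChain a c - evalChain b c = evalChain (a - b) c := by
    intro a b c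
    induction c using Finsupp.induction_linear with
    | zero => simp
    | add y z hy hz => rw [map_add, map_add, map_add, ← hy, ← hz]; abel
    | single g n => simp [evalChain_single, zsmul_sub]
  exact this _ _ _

end Kronecker

/-- The cohomology class `ζ_ρ ∈ H²(G_ρ; ℂ*)` of the cocycle `ζ_{α,β}`. -/
def zetaClass {G' : Type*} {G : Type} [Group G'] [Group G] (q : G' →* G) {n : ℕ}
    (ρ : q.ker →* GL (Fin n) ℂ) (hρ : IsIrreducibleRep ρ) : UnitsH2 (repStabilizer q ρ) :=
  groupCohomology.H2π (Rep.trivial ℤ (repStabilizer q ρ) (Additive ℂˣ))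
    ⟨fun g => Additive.ofMul (zetaScalar q ρ hρ g.1 g.2),
      (groupCohomology.mem_cocycles₂_iff _).2 fun α β γ =>
        congrArg Additive.ofMul (zetaScalar_cocycle q ρ hρ α β γ)⟩

/-- When `G_ρ = G`: the value `ζ_ρ(x) ∈ ℂ*` on a class `x ∈ H_2(G; ℤ) = H_2(G_ρ; ℤ)`. -/
def zetaEval {G' : Type*} {G : Type} [Group G'] [Group G] (q : G' →* G) {n : ℕ}
    (ρ : q.ker →* GL (Fin n) ℂ) (hρ : IsIrreducibleRep ρ) (hG : repStabilizer q ρ = ⊤)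
    (x : IntegralH2 G) : ℂˣ :=
  kronecker (zetaClass q ρ hρ)
    (IntegralH2.map ((MonoidHom.id G).codRestrict (repStabilizer q ρ)
      (fun g => hG ▸ Subgroup.mem_top g)) x)

/-- The set `S_*(p)` of sections of a group homomorphism `p`. -/
def groupSections {G' G : Type*} [Group G'] [Group G] (p : G' →* G) : Set (G →* G') :=
  {s | p.comp s = MonoidHom.id G}

/-! ### Closed oriented surfaces -/

/-- The link of a vertex `v` in dimension 2: its vertices are the neighbours of `v`, and `a`, `b`
are joined when `v, a, b` span a triangle. -/
def linkGraph {N : ℕ} (K : PreAbstractSimplicialComplex (Fin N)) (v : Fin N) :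
    SimpleGraph {u : Fin N // u ≠ v ∧ ({v, u} : Finset (Fin N)) ∈ K} where
  Adj a b := a ≠ b ∧ ({v, a.1, b.1} : Finset (Fin N)) ∈ K
  symm := ⟨fun a b h => ⟨h.1.symm, by rw [Finset.pair_comm]; exact h.2⟩⟩
  loopless := ⟨fun a h => h.1 rfl⟩

/-- A finite simplicial complex is a closed (triangulated) surface: it is purely 2-dimensional,
every edge lies in exactly two triangles, and the link of every vertex is connected (so that it
is a single cycle). -/
structure IsClosedSurface {N : ℕ} (K : PreAbstractSimplicialComplex (Fin N)) : Prop where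
  pure : ∀ s ∈ K, ∃ t ∈ K, s ⊆ t ∧ t.card = 3
  edge : ∀ e ∈ K, e.card = 2 → {t : Finset (Fin N) | t ∈ K ∧ e ⊆ t ∧ t.card = 3}.ncard = 2
  link : ∀ v : Fin N, ({v} : Finset (Fin N)) ∈ K → (linkGraph K v).Connected

/-- The geometric realisation `|K|`: points of the standard simplex supported on a face of `K`,
with the topology induced from `ℝ^N`. -/
def realization {N : ℕ} (K : PreAbstractSimplicialComplex (Fin N)) : Set (Fin N → ℝ) :=
  {x | x ∈ stdSimplex ℝ (Fin N) ∧ ∃ s ∈ K, ∀ i, i ∉ s → x i = 0}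

/-- An orientation of a closed triangulated surface: a sign `±1` for every ordered triangle,
alternating in the vertices, such that the signed sum of all triangles is a simplicial 2-cycle
(that is, the two triangles at every edge are coherently oriented). -/
structure SurfaceOrientation {N : ℕ} (K : PreAbstractSimplicialComplex (Fin N)) where
  /-- The sign of the ordered triangle `(i, j, k)`; it is `0` if this is not a triangle. -/
  sign : Fin N → Fin N → Fin N → ℤ
  sign_of_mem : ∀ i j k, ({i, j, k} : Finset (Fin N)) ∈ K →
    ({i, j, k} : Finset (Fin N)).card = 3 → sign i j k = 1 ∨ sign i j k = -1
  sign_of_not : ∀ i j k, ¬ (({i, j, k} : Finset (Fin N)) ∈ K ∧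
    ({i, j, k} : Finset (Fin N)).card = 3) → sign i j k = 0
  swap_left : ∀ i j k, sign j i k = -sign i j k
  swap_right : ∀ i j k, sign i k j = -sign i j k
  cycle : ∀ i j, ∑ k, sign i j k = 0

/-- The structure of a closed oriented surface on a topological space `W`, given by a finite
oriented triangulation `|K| ≃ W` (every closed oriented surface has one). Connectedness of `W` is
not part of the structure. -/
structure ClosedOrientedSurface (W : Type*) [TopologicalSpace W] where
  /-- The number of available vertices. -/
  N : ℕ
  /-- The simplicial complex. -/
  K : PreAbstractSimplicialComplex (Fin N)
  closed : IsClosedSurface K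
  /-- The orientation. -/
  orientation : SurfaceOrientation K
  /-- The triangulation. -/
  homeo : realization K ≃ₜ W

/-- The Euler characteristic `χ(W)`: vertices minus edges plus triangles. -/
def ClosedOrientedSurface.eulerChar {W : Type*} [TopologicalSpace W]
    (S : ClosedOrientedSurface W) : ℤ :=
  ({s | s ∈ S.K ∧ s.card = 1}.ncard : ℤ) - {s | s ∈ S.K ∧ s.card = 2}.ncard +
    {s | s ∈ S.K ∧ s.card = 3}.ncard

/-- The genus of a connected closed oriented surface: `χ(W) = 2 - 2 * genus`. -/
def ClosedOrientedSurface.genus {W : Type*} [TopologicalSpace W]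
    (S : ClosedOrientedSurface W) : ℚ :=
  1 - (S.eulerChar : ℚ) / 2

/-! ### The fundamental class in `H_2(π_1(W))` -/

section FundamentalClass

theorem face_subset {N : ℕ} {K : PreAbstractSimplicialComplex (Fin N)} {s t : Finset (Fin N)}
    (hs : s ∈ K) (hts : t ⊆ s) (ht : t.Nonempty) : t ∈ K :=
  (K.isRelLowerSet_faces hs).2 hts ht

/-- The closed simplex of `|K|` (in barycentric coordinates) spanned by a set of vertices. -/
def closedFace {N : ℕ} (s : Finset (Fin N)) : Set (Fin N → ℝ) :=
  {x | x ∈ stdSimplex ℝ (Fin N) ∧ ∀ i, i ∉ s → x i = 0}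

theorem closedFace_convex {N : ℕ} (s : Finset (Fin N)) : Convex ℝ (closedFace s) := by
  intro x hx y hy a b ha hb hab
  refine ⟨convex_stdSimplex ℝ (Fin N) hx.1 hy.1 ha hb hab, fun i hi => ?_⟩
  simp [hx.2 i hi, hy.2 i hi]

theorem single_mem_closedFace {N : ℕ} {s : Finset (Fin N)} {i : Fin N} (hi : i ∈ s) :
    (Pi.single i 1 : Fin N → ℝ) ∈ closedFace s :=
  ⟨single_mem_stdSimplex ℝ i, fun j hj => by
    rw [Pi.single_apply, if_neg]
    rintro rfl
    exact hj hi⟩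

/-- The vertex `i` of a closed simplex. -/
def faceVertex {N : ℕ} {s : Finset (Fin N)} {i : Fin N} (hi : i ∈ s) : closedFace s :=
  ⟨Pi.single i 1, single_mem_closedFace hi⟩

/-- The straight path from vertex `i` to vertex `j` in a closed simplex. -/
def facePath {N : ℕ} {s : Finset (Fin N)} {i j : Fin N} (hi : i ∈ s) (hj : j ∈ s) :
    Path (faceVertex hi) (faceVertex hj) where
  toFun t := ⟨AffineMap.lineMap (Pi.single i 1 : Fin N → ℝ) (Pi.single j 1) (t : ℝ),
    (closedFace_convex s).lineMap_mem (single_mem_closedFace hi) (single_mem_closedFace hj) t.2⟩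
  continuous_toFun := by
    refine Continuous.subtype_mk ?_ _
    exact AffineMap.lineMap_continuous.comp continuous_subtype_val
  source' := by ext1; simp [faceVertex]
  target' := by ext1; simp [faceVertex]

variable {W : Type*} [TopologicalSpace W] (S : ClosedOrientedSurface W)

/-- A closed simplex of the triangulation as a subset of `W`. -/
def faceMap {s : Finset (Fin S.N)} (hs : s ∈ S.K) : C(closedFace s, W) where
  toFun x := S.homeo ⟨x.1, x.2.1, s, hs, x.2.2⟩
  continuous_toFun := S.homeo.continuous.comp (continuous_subtype_val.subtype_mk _)

/-- The vertex `i` of the triangulation as a point of `W`. -/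
def vertexPoint {i : Fin S.N} (hi : ({i} : Finset (Fin S.N)) ∈ S.K) : W :=
  faceMap S hi (faceVertex (Finset.mem_singleton_self i))

theorem vertex_mem {s : Finset (Fin S.N)} (hs : s ∈ S.K) {i : Fin S.N} (hi : i ∈ s) :
    ({i} : Finset (Fin S.N)) ∈ S.K :=
  face_subset hs (Finset.singleton_subset_iff.2 hi) (Finset.singleton_nonempty i)

/-- The straight path from vertex `i` to vertex `j` inside a simplex of the triangulation. -/
def simplexPath {s : Finset (Fin S.N)} (hs : s ∈ S.K) {i j : Fin S.N} (hi : i ∈ s) (hj : j ∈ s) :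
    Path (vertexPoint S (vertex_mem S hs hi)) (vertexPoint S (vertex_mem S hs hj)) :=
  (facePath hi hj).map (faceMap S hs).continuous

theorem simplexPath_trans {s : Finset (Fin S.N)} (hs : s ∈ S.K) {i j k : Fin S.N}
    (hi : i ∈ s) (hj : j ∈ s) (hk : k ∈ s) :
    ((simplexPath S hs hi hj).trans (simplexPath S hs hj hk)).Homotopic
      (simplexPath S hs hi hk) := by
  have : ContractibleSpace (closedFace s) :=
    (closedFace_convex s).contractibleSpace ⟨_, single_mem_closedFace hi⟩
  have h := (SimplyConnectedSpace.paths_homotopic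
    ((facePath hi hj).trans (facePath hj hk)) (facePath hi hk)).map (faceMap S hs)
  rw [Path.map_trans] at h
  exact h

theorem pair_mem_left {N : ℕ} (i j : Fin N) : i ∈ ({i, j} : Finset (Fin N)) := by simp

theorem pair_mem_right {N : ℕ} (i j : Fin N) : j ∈ ({i, j} : Finset (Fin N)) := by simp

variable [PathConnectedSpace W] (w : W)

open Classical in
/-- The element `a_{ij}` of `π_1(W, w)` carried by the edge `ij` of the triangulation, by means of
chosen paths `γ_v` from `w` to the vertices `v`. The product of `FundamentalGroup` is opposite to
concatenation of paths, so the usual element, the class of the loop `γ_i · e_{ij} · γ_j⁻¹`,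
is transported along inversion: `a_{ij}` is the class of `γ_j · e_{ji} · γ_i⁻¹`. In this way
`a_{ij} * a_{jk} = a_{ik}` for every triangle `ijk`. -/
def edgeElement (i j : Fin S.N) : FundamentalGroup W w :=
  if h : ({i, j} : Finset (Fin S.N)) ∈ S.K then
    FundamentalGroup.fromPath (Path.Homotopic.Quotient.mk
      (((PathConnectedSpace.somePath w (vertexPoint S (vertex_mem S h (pair_mem_right i j)))).trans
        (simplexPath S h (pair_mem_right i j) (pair_mem_left i j))).trans
          (PathConnectedSpace.somePath w (vertexPoint S (vertex_mem S h (pair_mem_left i j)))).symm))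
  else 1

theorem edgeElement_eq {s : Finset (Fin S.N)} (hs : s ∈ S.K) {i j : Fin S.N}
    (hi : i ∈ s) (hj : j ∈ s) :
    edgeElement S w i j = FundamentalGroup.fromPath (Path.Homotopic.Quotient.mk
      (((PathConnectedSpace.somePath w (vertexPoint S (vertex_mem S hs hj))).trans
        (simplexPath S hs hj hi)).trans
          (PathConnectedSpace.somePath w (vertexPoint S (vertex_mem S hs hi))).symm)) := by
  have h : ({i, j} : Finset (Fin S.N)) ∈ S.K :=
    face_subset hs (by intro x hx; rcases Finset.mem_insert.1 hx with rfl | hx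
                       · exact hi
                       · rw [Finset.mem_singleton.1 hx]; exact hj) ⟨i, by simp⟩
  rw [edgeElement, dif_pos h]
  rfl

theorem quotient_path_aux {X : Type*} [TopologicalSpace X] {x₀ x₁ x₂ x₃ : X}
    (a : Path.Homotopic.Quotient x₀ x₃) (p : Path.Homotopic.Quotient x₃ x₂)
    (b : Path.Homotopic.Quotient x₀ x₂) (q : Path.Homotopic.Quotient x₂ x₁)
    (c : Path.Homotopic.Quotient x₀ x₁) :
    ((a.trans p).trans b.symm).trans ((b.trans q).trans c.symm) =
      (a.trans (p.trans q)).trans c.symm := by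
  have h : b.symm.trans (b.trans (q.trans c.symm)) = q.trans c.symm := by
    rw [← Path.Homotopic.Quotient.trans_assoc, Path.Homotopic.Quotient.symm_trans,
      Path.Homotopic.Quotient.refl_trans]
  simp only [Path.Homotopic.Quotient.trans_assoc, h]

theorem edgeElement_mul {i j k : Fin S.N} (h : ({i, j, k} : Finset (Fin S.N)) ∈ S.K) :
    edgeElement S w i j * edgeElement S w j k = edgeElement S w i k := by
  have hi : i ∈ ({i, j, k} : Finset (Fin S.N)) := by simp
  have hj : j ∈ ({i, j, k} : Finset (Fin S.N)) := by simp
  have hk : k ∈ ({i, j, k} : Finset (Fin S.N)) := by simp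
  rw [edgeElement_eq S w h hi hj, edgeElement_eq S w h hj hk, edgeElement_eq S w h hi hk,
    FundamentalGroup.mul_def]
  have key := Path.Homotopic.Quotient.eq.2 (simplexPath_trans S h hk hj hi)
  simp only [Path.Homotopic.Quotient.mk_trans, Path.Homotopic.Quotient.mk_symm] at key ⊢
  rw [← key]
  exact quotient_path_aux _ _ _ _ _

/-- The image of the simplicial fundamental cycle (the signed sum of all triangles) in the bar
complex of `π_1(W, w)`: the sum of `± [a_{ij} | a_{jk}]` over all triangles `i < j < k`. -/
def fundamentalChain : FundamentalGroup W w × FundamentalGroup W w →₀ ℤ :=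
  ∑ i, ∑ j, ∑ k, if i < j ∧ j < k then
    Finsupp.single (edgeElement S w i j, edgeElement S w j k) (S.orientation.sign i j k) else 0

theorem signed_sum_eq_zero {N : ℕ} {K : PreAbstractSimplicialComplex (Fin N)}
    (o : SurfaceOrientation K) {M : Type*} [AddCommGroup M] (F : Fin N → Fin N → M) :
    (∑ i, ∑ j, ∑ k, if i < j ∧ j < k then o.sign i j k • (F j k - F i k + F i j) else 0) = 0 := by
  have hz1 : ∀ i j, o.sign i j i = 0 := fun i j => o.sign_of_not _ _ _ (by
    rintro ⟨-, h⟩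
    have : ({i, j, i} : Finset (Fin N)) ⊆ {i, j} := by intro x; simp; tauto
    have := Finset.card_le_card this
    have := Finset.card_le_two (a := i) (b := j)
    omega)
  have hz2 : ∀ i j, o.sign i j j = 0 := fun i j => o.sign_of_not _ _ _ (by
    rintro ⟨-, h⟩
    have : ({i, j, j} : Finset (Fin N)) ⊆ {i, j} := by intro x; simp
    have := Finset.card_le_card this
    have := Finset.card_le_two (a := i) (b := j)
    omega)
  have hrot : ∀ a b c, o.sign c a b = o.sign a b c := fun a b c => by
    rw [o.swap_left a c b, o.swap_right a b c, neg_neg]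
  have e : ∀ i j k : Fin N,
      (if i < j ∧ j < k then o.sign i j k • (F j k - F i k + F i j) else 0) =
      (if i < j ∧ j < k then o.sign j k i • F j k else 0) +
      ((if i < j ∧ j < k then o.sign i k j • F i k else 0) +
      (if i < j ∧ j < k then o.sign i j k • F i j else 0)) := by
    intro i j k
    split_ifs
    · rw [← hrot j k i, o.swap_right i j k, neg_smul, smul_add, smul_sub]; abel
    · simp
  simp_rw [e, Finset.sum_add_distrib]
  have e1 : (∑ i : Fin N, ∑ j, ∑ k, if i < j ∧ j < k then o.sign j k i • F j k else 0) =
      ∑ a : Fin N, ∑ b, ∑ c, if c < a ∧ a < b then o.sign a b c • F a b else 0 := by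
    rw [Finset.sum_comm]
    exact Finset.sum_congr rfl fun a _ => Finset.sum_comm
  have e2 : (∑ i : Fin N, ∑ j, ∑ k, if i < j ∧ j < k then o.sign i k j • F i k else 0) =
      ∑ a : Fin N, ∑ b, ∑ c, if a < c ∧ c < b then o.sign a b c • F a b else 0 :=
    Finset.sum_congr rfl fun a _ => Finset.sum_comm
  rw [e1, e2]
  simp_rw [← Finset.sum_add_distrib]
  refine Finset.sum_eq_zero fun a _ => Finset.sum_eq_zero fun b _ => ?_
  by_cases hab : a < b
  · have : ∀ c, (if c < a ∧ a < b then o.sign a b c • F a b else 0) +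
        ((if a < c ∧ c < b then o.sign a b c • F a b else 0) +
          (if a < b ∧ b < c then o.sign a b c • F a b else 0)) = o.sign a b c • F a b := by
      intro c
      rcases lt_trichotomy c a with h | h | h
      · simp [h, hab, h.not_gt, (h.trans hab).not_gt]
      · subst h; simp [hz1]
      · rcases lt_trichotomy c b with h' | h' | h'
        · simp [h, h', h.not_gt, h'.not_gt]
        · subst h'; simp [hz2]
        · simp [h.not_gt, h', h'.not_gt, hab]
    simp_rw [this, ← Finset.sum_smul, o.cycle, zero_smul]
  · refine Finset.sum_eq_zero fun c _ => ?_
    rw [if_neg (fun h => hab h.2), if_neg (fun h => hab (h.1.trans h.2)), if_neg (fun h => hab h.1)]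
    simp

end FundamentalClass

section FundamentalClassInH2

variable {W : Type} [TopologicalSpace W] (S : ClosedOrientedSurface W) [PathConnectedSpace W]
  (w : W)

theorem fundamentalChain_mem :
    fundamentalChain S w ∈ groupHomology.cycles₂ (Rep.trivial ℤ (FundamentalGroup W w) ℤ) := by
  have hs : ∀ (g : FundamentalGroup W w × FundamentalGroup W w) (n : ℤ),
      groupHomology.d₂₁ (Rep.trivial ℤ (FundamentalGroup W w) ℤ) (Finsupp.single g n) =
        (Finsupp.single g.2 (n : ℤ) - Finsupp.single (g.1 * g.2) (n : ℤ) +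
          Finsupp.single g.1 (n : ℤ) : FundamentalGroup W w →₀ ℤ) := fun g n =>
    groupHomology.d₂₁_single (A := Rep.trivial ℤ (FundamentalGroup W w) ℤ) g n
  change groupHomology.d₂₁ (Rep.trivial ℤ (FundamentalGroup W w) ℤ) (fundamentalChain S w) = 0
  have h0 := signed_sum_eq_zero S.orientation
    (fun i j => (Finsupp.single (edgeElement S w i j) 1 : FundamentalGroup W w →₀ ℤ))
  refine Eq.trans ?_ h0
  unfold fundamentalChain
  erw [map_sum]
  refine Finset.sum_congr rfl fun i _ => ?_
  erw [map_sum]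
  refine Finset.sum_congr rfl fun j _ => ?_
  erw [map_sum]
  refine Finset.sum_congr rfl fun k _ => ?_
  split_ifs with h
  · refine (hs _ _).trans ?_
    by_cases hf : ({i, j, k} : Finset (Fin S.N)) ∈ S.K ∧ ({i, j, k} : Finset (Fin S.N)).card = 3
    · simp only [edgeElement_mul S w hf.1]
      rw [smul_add, smul_sub]
      simp only [Finsupp.smul_single, smul_eq_mul, mul_one]
    · rw [S.orientation.sign_of_not _ _ _ hf]
      simp
  · exact map_zero _

/-- The fundamental class `[W]` as an element of `H_2(π_1(W, w); ℤ)`: the image of the simplicial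
fundamental class of `W` under the canonical homomorphism `H_2(W; ℤ) → H_2(π_1(W, w); ℤ)`. -/
def fundamentalClass : IntegralH2 (FundamentalGroup W w) :=
  groupHomology.H2π (Rep.trivial ℤ (FundamentalGroup W w) ℤ)
    ⟨fundamentalChain S w, fundamentalChain_mem S w⟩

end FundamentalClassInH2

end

/-! Sections are counted as in lattice gauge theory. Write Φ for the kernel, q for its order, and V,
E, F for the numbers of vertices, edges and triangles. A lift to π' of the elements of π carried by
the edges amounts to a Φ-valued function on the edges, and its holonomies round triangles lie in Φ.
If they are all trivial, the flat bundle glued over the open stars of the vertices has a holonomy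
homomorphism π → π', which a change of gauge turns into a section. Since walks along edges exhaust
π, pairs (section, Φ-valued gauge transformation) correspond to pairs (flat connection, element of
Φ) (`sectionConnection_bijective`). Hence |S_*(p)| q^V = q · #flat.

Flatness is detected by Fourier analysis on Φ: the sum of dim ρ · χ_ρ over Irr(Φ) is q times the
delta function at 1 (`sum_dim_mul_repChar`). Multiplied over the triangles, this writes q^F · #flat
as a sum over colourings of the triangles by Irr(Φ). One edge variable enters exactly two triangles,
once as k and once as k⁻¹, so character orthogonality kills a colouring unless the two characters
agree after transport to a common vertex (`sum_prod_repChar_eq_zero`). Because vertex links are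
connected, the transported characters of a surviving colouring depend only on the vertex, and edge
walks force them to be a single π-invariant character (`exists_smul_eq_of_sum_ne_zero`).

For a constant invariant colour ρ of dimension n, the matrices M_α extend ρ to a projective
representation. Then ρ of a triangle holonomy is a product of three edge matrices times a value of ζ
or its inverse, and these scalars multiply to ζ_ρ([W]) (`rep_holonomy`, `prod_faceScalar`).
Expanding the traces puts an index at each corner of each triangle. Orthogonality of matrix
coefficients contributes q/n for each edge and identifies the indices round each vertex, leaving n^V
choices (`sum_prod_trace`). With the factor n^F from the dimensions, ρ contributes n^F (q/n)^E n^V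
ζ_ρ([W]) to q^F · #flat. Combining the two counts leaves q (q/n)^(-χ(W)) ζ_ρ([W]). -/

noncomputable section

/-- The character of a matrix representation. -/
def repChar {Γ : Type*} [Group Γ] {n : ℕ} (ρ : Γ →* GL (Fin n) ℂ) (h : Γ) : ℂ :=
  (ρ h : Matrix (Fin n) (Fin n) ℂ).trace

/-! ### Schur orthogonality for matrix coefficients and characters. -/

section Orthogonality

variable {Γ : Type*} [Group Γ] {n m : ℕ} {ρ : Γ →* GL (Fin n) ℂ} {σ : Γ →* GL (Fin m) ℂ}

/-- Schur's lemma: the kernel and the range of an intertwiner are invariant subspaces, so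
irreducibility leaves only the extreme cases. -/
theorem intertwiner_bijective (hρ : IsIrreducibleRep ρ) (hσ : IsIrreducibleRep σ)
    (Y : Matrix (Fin n) (Fin m) ℂ)
    (hY : ∀ h, (ρ h : Matrix (Fin n) (Fin n) ℂ) * Y = Y * (σ h : Matrix (Fin m) (Fin m) ℂ))
    (hY0 : Y ≠ 0) : Function.Bijective Y.mulVecLin := by
  have hker := hσ.2 (LinearMap.ker Y.mulVecLin) (by
    intro h x hx
    rw [LinearMap.mem_ker, Matrix.mulVecLin_apply] at hx ⊢
    rw [Matrix.mulVec_mulVec, ← hY, ← Matrix.mulVec_mulVec, hx, Matrix.mulVec_zero])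
  have hran := hρ.2 (LinearMap.range Y.mulVecLin) (by
    rintro h _ ⟨x, rfl⟩
    refine ⟨(σ h : Matrix (Fin m) (Fin m) ℂ) *ᵥ x, ?_⟩
    rw [Matrix.mulVecLin_apply, Matrix.mulVecLin_apply, Matrix.mulVec_mulVec, Matrix.mulVec_mulVec,
      hY])
  have h0 : Y.mulVecLin ≠ 0 := fun h => hY0 (by
    rw [← Matrix.toLin'_apply', LinearEquiv.map_eq_zero_iff] at h
    exact h)
  constructor
  · rw [← LinearMap.ker_eq_bot]
    exact hker.resolve_right fun h => h0 (LinearMap.ker_eq_top.1 h)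
  · rw [← LinearMap.range_eq_top]
    exact hran.resolve_left fun h => h0 (LinearMap.range_eq_bot.1 h)

theorem intertwiner_isUnit {σ : Γ →* GL (Fin n) ℂ} (hρ : IsIrreducibleRep ρ)
    (hσ : IsIrreducibleRep σ) (Y : Matrix (Fin n) (Fin n) ℂ)
    (hY : ∀ h, (ρ h : Matrix (Fin n) (Fin n) ℂ) * Y = Y * (σ h : Matrix (Fin n) (Fin n) ℂ))
    (hY0 : Y ≠ 0) : IsUnit Y :=
  Matrix.mulVec_injective_iff_isUnit.1 (intertwiner_bijective hρ hσ Y hY hY0).1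

theorem intertwiner_dim_eq (hρ : IsIrreducibleRep ρ) (hσ : IsIrreducibleRep σ)
    (Y : Matrix (Fin n) (Fin m) ℂ)
    (hY : ∀ h, (ρ h : Matrix (Fin n) (Fin n) ℂ) * Y = Y * (σ h : Matrix (Fin m) (Fin m) ℂ))
    (hY0 : Y ≠ 0) : n = m := by
  have := LinearEquiv.finrank_eq
    (LinearEquiv.ofBijective Y.mulVecLin (intertwiner_bijective hρ hσ Y hY hY0))
  simpa using this.symm

theorem repEquivalent_of_intertwiner {σ : Γ →* GL (Fin n) ℂ} (hρ : IsIrreducibleRep ρ)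
    (hσ : IsIrreducibleRep σ) (Y : Matrix (Fin n) (Fin n) ℂ)
    (hY : ∀ h, (ρ h : Matrix (Fin n) (Fin n) ℂ) * Y = Y * (σ h : Matrix (Fin n) (Fin n) ℂ))
    (hY0 : Y ≠ 0) : RepEquivalent ρ σ := by
  obtain ⟨u, hu⟩ := intertwiner_isUnit hρ hσ Y hY hY0
  refine ⟨u, fun h => ?_⟩
  have : ρ h * u = u * σ h := by
    ext1
    simp only [Units.val_mul, hu, hY]
  rw [mul_assoc, this]
  group

theorem RepEquivalent.repChar_eq {σ : Γ →* GL (Fin n) ℂ} (h : RepEquivalent ρ σ) :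
    repChar σ = repChar ρ := by
  obtain ⟨M, hM⟩ := h
  funext g
  rw [repChar, hM, Units.val_mul, Matrix.trace_mul_comm, ← Units.val_mul,
    mul_inv_cancel_left]
  rfl

theorem repChar_one : repChar ρ 1 = n := by simp [repChar]

theorem repChar_mul_comm (g h : Γ) : repChar ρ (g * h) = repChar ρ (h * g) := by
  simp only [repChar, map_mul, Units.val_mul]
  rw [Matrix.trace_mul_comm]

variable [Fintype Γ]

/-- The substitution h ↦ gh in the average moves ρ(g) from the left to σ(g) on the right. -/
theorem average_intertwines (X : Matrix (Fin n) (Fin m) ℂ) (g : Γ) :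
    (ρ g : Matrix (Fin n) (Fin n) ℂ) * (∑ h, (ρ h : Matrix (Fin n) (Fin n) ℂ) * X *
      (σ h⁻¹ : Matrix (Fin m) (Fin m) ℂ)) =
    (∑ h, (ρ h : Matrix (Fin n) (Fin n) ℂ) * X * (σ h⁻¹ : Matrix (Fin m) (Fin m) ℂ)) *
      (σ g : Matrix (Fin m) (Fin m) ℂ) := by
  rw [Matrix.mul_sum, Matrix.sum_mul]
  refine Fintype.sum_equiv (Equiv.mulLeft g) _ _ fun h => ?_
  have h1 : σ (g * h)⁻¹ * σ g = σ h⁻¹ := by rw [← map_mul]; congr 1; group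
  simp only [Equiv.coe_mulLeft]
  rw [Matrix.mul_assoc _ (σ (g * h)⁻¹ : Matrix (Fin m) (Fin m) ℂ), ← Units.val_mul, h1,
    map_mul, Units.val_mul]
  simp only [Matrix.mul_assoc]

/-- Averaging a matrix unit turns entries into correlation sums of matrix coefficients. The
orthogonality relations are thereby statements about intertwiners. -/
theorem average_apply (a : Fin n) (b : Fin n) (c d : Fin m) :
    (∑ h, (ρ h : Matrix (Fin n) (Fin n) ℂ) * Matrix.single b c (1 : ℂ) *
      (σ h⁻¹ : Matrix (Fin m) (Fin m) ℂ)) a d =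
    ∑ h, (ρ h : Matrix (Fin n) (Fin n) ℂ) a b * (σ h⁻¹ : Matrix (Fin m) (Fin m) ℂ) c d := by
  rw [Matrix.sum_apply]
  refine Finset.sum_congr rfl fun h _ => ?_
  rw [Matrix.mul_assoc, Matrix.mul_apply, Finset.sum_eq_single b]
  · simp
  · intro x _ hx
    rw [Matrix.mul_apply, Finset.sum_eq_zero, mul_zero]
    intro y _
    rw [Matrix.single_apply_of_row_ne hx.symm, zero_mul]
  · simp

/-- Orthogonality of the matrix coefficients of representations with different characters. -/
theorem sum_coeff_eq_zero (hρ : IsIrreducibleRep ρ) (hσ : IsIrreducibleRep σ)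
    (hne : repChar ρ ≠ repChar σ) (a b : Fin n) (c d : Fin m) :
    ∑ h, (ρ h : Matrix (Fin n) (Fin n) ℂ) a b * (σ h⁻¹ : Matrix (Fin m) (Fin m) ℂ) c d = 0 := by
  rw [← average_apply]
  -- A nonzero entry would make the average a nonzero intertwiner, hence the representations
  -- equivalent and their characters equal.
  by_contra h0
  set Y := ∑ h, (ρ h : Matrix (Fin n) (Fin n) ℂ) * Matrix.single b c (1 : ℂ) *
      (σ h⁻¹ : Matrix (Fin m) (Fin m) ℂ) with hYdef
  have hY0 : Y ≠ 0 := fun h => h0 (by rw [h]; rfl)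
  have hY := average_intertwines (ρ := ρ) (σ := σ) (Matrix.single b c (1 : ℂ))
  obtain rfl := intertwiner_dim_eq hρ hσ Y hY hY0
  exact hne (repEquivalent_of_intertwiner hρ hσ Y hY hY0).repChar_eq.symm

/-- Orthogonality of the matrix coefficients of an irreducible representation. -/
theorem sum_coeff_self (hρ : IsIrreducibleRep ρ) (a b c d : Fin n) :
    ∑ h, (ρ h : Matrix (Fin n) (Fin n) ℂ) a b * (ρ h⁻¹ : Matrix (Fin n) (Fin n) ℂ) c d =
      if a = d ∧ b = c then (Fintype.card Γ : ℂ) / n else 0 := by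
  rw [← average_apply]
  set Y := ∑ h, (ρ h : Matrix (Fin n) (Fin n) ℂ) * Matrix.single b c (1 : ℂ) *
      (ρ h⁻¹ : Matrix (Fin n) (Fin n) ℂ) with hYdef
  have hY := average_intertwines (ρ := ρ) (σ := ρ) (Matrix.single b c (1 : ℂ))
  have hz : ∃ z : ℂ, Y = z • 1 := by
    by_cases hY0 : Y = 0
    · exact ⟨0, by simp [hY0]⟩
    · obtain ⟨u, hu⟩ := intertwiner_isUnit hρ hρ Y hY hY0
      obtain ⟨z, hz⟩ := schur_scalar hρ u (fun h => by
        ext1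
        simp only [Units.val_mul, hu, hYdef, hY])
      exact ⟨z, by rw [← hu, hz]⟩
  obtain ⟨z, hz⟩ := hz
  -- The scalar is read off from the trace: every summand is a conjugate of the matrix unit.
  have ht : Y.trace = Fintype.card Γ * (if b = c then 1 else 0) := by
    rw [hYdef, Matrix.trace_sum]
    rw [Finset.sum_congr rfl (g := fun _ => if b = c then (1 : ℂ) else 0)]
    · simp
    · intro h _
      rw [Matrix.trace_mul_comm, ← mul_assoc, ← Units.val_mul, ← map_mul]
      rw [inv_mul_cancel, map_one, Units.val_one, one_mul]
      split_ifs with hbc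
      · subst hbc; simp
      · simp [Matrix.trace_single_eq_of_ne _ _ _ hbc]
  have hn : (n : ℂ) ≠ 0 := by exact_mod_cast hρ.1.ne'
  rw [hz] at ht ⊢
  simp only [Matrix.trace_smul, Matrix.trace_one, Fintype.card_fin, smul_eq_mul] at ht
  have hz' : z = Fintype.card Γ * (if b = c then 1 else 0) / n := by
    rw [← ht]; field_simp
  rw [hz']
  by_cases h1 : b = c <;> by_cases h2 : a = d <;> simp [h1, h2]

/-- Expanding both traces leaves correlation sums of matrix coefficients. The shifts `k` and `l`
will be the holonomies of the two triangles at an edge, the summation variable being the change of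
the edge variable. -/
theorem sum_repChar_mul_eq_zero (hρ : IsIrreducibleRep ρ) (hσ : IsIrreducibleRep σ)
    (hne : repChar ρ ≠ repChar σ) (k l : Γ) :
    ∑ h, repChar ρ (h * k) * repChar σ (h⁻¹ * l) = 0 := by
  simp only [repChar, map_mul, Units.val_mul, Matrix.trace, Matrix.diag_apply, Matrix.mul_apply,
    Finset.sum_mul_sum]
  rw [Finset.sum_comm]
  refine Finset.sum_eq_zero fun a _ => ?_
  rw [Finset.sum_comm]
  refine Finset.sum_eq_zero fun c _ => ?_
  rw [Finset.sum_comm]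
  refine Finset.sum_eq_zero fun b _ => ?_
  rw [Finset.sum_comm]
  refine Finset.sum_eq_zero fun d _ => ?_
  rw [Finset.sum_congr rfl fun h _ => mul_mul_mul_comm _ _ _ _, ← Finset.sum_mul,
    sum_coeff_eq_zero hρ hσ hne, zero_mul]

theorem sum_repChar_self (hρ : IsIrreducibleRep ρ) :
    ∑ h, repChar ρ h * repChar ρ h⁻¹ = Fintype.card Γ := by
  simp only [repChar, Matrix.trace, Matrix.diag_apply, Finset.sum_mul_sum]
  rw [Finset.sum_comm]
  have hn : (n : ℂ) ≠ 0 := by exact_mod_cast hρ.1.ne'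
  rw [Finset.sum_congr rfl (g := fun _ => (Fintype.card Γ : ℂ) / n)]
  · simp; field_simp
  · intro a _
    rw [Finset.sum_comm]
    simp only [sum_coeff_self hρ, and_self]
    simp

end Orthogonality

/-! ### Finiteness of Irr and the decomposition of the regular character. -/

section Completeness

variable {Γ : Type*} [Group Γ]

theorem Irr.dim_pos (ρ : Irr Γ) : 0 < ρ.dim := ρ.rep_irreducible.1

theorem Irr.mk_rep (ρ : Irr Γ) : (⟨ρ.dim, ⟦⟨ρ.rep, ρ.rep_irreducible⟩⟧⟩ : Irr Γ) = ρ :=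
  Sigma.ext rfl (heq_of_eq (Quotient.out_eq ρ.2))

/-- For inequivalent representations every averaged intertwiner vanishes, so the pairing of the
characters is zero; for equal characters this pairing is |Γ|. -/
theorem repEquivalent_of_repChar_eq [Finite Γ] {n : ℕ} {ρ σ : Γ →* GL (Fin n) ℂ} (hρ : IsIrreducibleRep ρ)
    (hσ : IsIrreducibleRep σ) (h : repChar ρ = repChar σ) : RepEquivalent ρ σ := by
  have := Fintype.ofFinite Γ
  by_contra hne
  have key : ∑ h, repChar ρ h * repChar σ h⁻¹ = 0 := by
    simp only [repChar, Matrix.trace, Matrix.diag_apply, Finset.sum_mul_sum]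
    rw [Finset.sum_comm]
    refine Finset.sum_eq_zero fun a _ => ?_
    rw [Finset.sum_comm]
    refine Finset.sum_eq_zero fun b _ => ?_
    rw [← average_apply]
    by_contra h0
    exact hne (repEquivalent_of_intertwiner hρ hσ _ (average_intertwines _)
      fun h => h0 (by rw [h]; rfl))
  rw [← h, sum_repChar_self hρ] at key
  exact Fintype.card_ne_zero (α := Γ) (by exact_mod_cast key)

theorem Irr.ext_repChar [Finite Γ] {ρ σ : Irr Γ} (h : repChar ρ.rep = repChar σ.rep) : ρ = σ := by
  obtain ⟨n, ρ'⟩ := ρ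
  obtain ⟨m, σ'⟩ := σ
  obtain rfl : n = m := by
    have := congrFun h 1
    rw [repChar_one, repChar_one] at this
    exact_mod_cast this
  rw [← Irr.mk_rep ⟨n, ρ'⟩, ← Irr.mk_rep ⟨n, σ'⟩]
  exact Sigma.ext rfl (heq_of_eq (Quotient.sound
    (repEquivalent_of_repChar_eq (Irr.rep_irreducible ⟨n, ρ'⟩) (Irr.rep_irreducible ⟨n, σ'⟩) h)))

/-- Left translation by `h` permutes the group basis, without fixed points unless `h` is trivial. -/
theorem trace_mulLeft_monoidAlgebra [Fintype Γ] [DecidableEq Γ] (h : Γ) :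
    LinearMap.trace ℂ (MonoidAlgebra ℂ Γ)
      (LinearMap.mulLeft ℂ (MonoidAlgebra.of ℂ Γ h)) =
      if h = 1 then (Fintype.card Γ : ℂ) else 0 := by
  rw [LinearMap.trace_eq_matrix_trace ℂ (MonoidAlgebra.basis Γ ℂ), Matrix.trace]
  have : ∀ g : Γ, (LinearMap.toMatrix (MonoidAlgebra.basis Γ ℂ) (MonoidAlgebra.basis Γ ℂ)
      (LinearMap.mulLeft ℂ (MonoidAlgebra.of ℂ Γ h))).diag g = if h = 1 then 1 else 0 := by
    intro g
    rw [Matrix.diag_apply, LinearMap.toMatrix_apply]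
    have h1 : LinearMap.mulLeft ℂ (MonoidAlgebra.of ℂ Γ h) (MonoidAlgebra.basis Γ ℂ g) =
        MonoidAlgebra.single (h * g) 1 := by simp [MonoidAlgebra.single_mul_single]
    rw [h1]
    change (Finsupp.single (h * g) (1 : ℂ)) g = _
    simp [Finsupp.single_apply]
  simp only [this]
  split_ifs <;> simp

/-- The matrix unit at (a, b) in block i contributes the diagonal entry (a, a) of `A i`; summing
over b produces the factor `d i`. -/
theorem trace_mulLeft_pi_matrix {k : ℕ} {d : Fin k → ℕ}
    (A : Π i, Matrix (Fin (d i)) (Fin (d i)) ℂ) :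
    LinearMap.trace ℂ (Π i, Matrix (Fin (d i)) (Fin (d i)) ℂ) (LinearMap.mulLeft ℂ A) =
      ∑ i, (d i : ℂ) * (A i).trace := by
  classical
  rw [LinearMap.trace_eq_matrix_trace ℂ
    (Pi.basis fun i => Matrix.stdBasis ℂ (Fin (d i)) (Fin (d i))), Matrix.trace, Fintype.sum_sigma]
  refine Finset.sum_congr rfl fun i _ => ?_
  rw [Fintype.sum_prod_type, Matrix.trace, Finset.mul_sum]
  refine Finset.sum_congr rfl fun a _ => ?_
  rw [Finset.sum_congr rfl (g := fun _ => A i a a)]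
  · simp
  · intro b _
    rw [Matrix.diag_apply, LinearMap.toMatrix_apply]
    simp [Pi.basis_repr, Matrix.stdBasis_eq_single]
    change (A i * (Matrix.single a b 1 : Matrix (Fin (d i)) (Fin (d i)) ℂ)) a b = _
    simp

/-- By Wedderburn's theorem the group algebra is a product of matrix algebras, whose projections are
the representations sought. The last identity computes the trace of left multiplication by `h` on
both sides of this isomorphism. -/
theorem exists_complete_irreducibles [Fintype Γ] [DecidableEq Γ] :
    ∃ (k : ℕ) (d : Fin k → ℕ) (ρ : ∀ i, Γ →* GL (Fin (d i)) ℂ),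
      (∀ i, IsIrreducibleRep (ρ i)) ∧ (∀ i j, repChar (ρ i) = repChar (ρ j) → i = j) ∧
      ∀ h, ∑ i, (d i : ℂ) * repChar (ρ i) h = if h = 1 then (Fintype.card Γ : ℂ) else 0 := by
  have : NeZero (Nat.card Γ : ℂ) := ⟨by exact_mod_cast Nat.card_pos.ne'⟩
  obtain ⟨k, d, hd, ⟨e⟩⟩ :=
    IsSemisimpleRing.exists_algEquiv_pi_matrix_of_isAlgClosed ℂ (MonoidAlgebra ℂ Γ)
  let ev (i : Fin k) : MonoidAlgebra ℂ Γ →ₐ[ℂ] Matrix (Fin (d i)) (Fin (d i)) ℂ :=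
    (Pi.evalAlgHom ℂ _ i).comp e.toAlgHom
  let ρ (i : Fin k) : Γ →* GL (Fin (d i)) ℂ :=
    MonoidHom.toHomUnits ((ev i : MonoidAlgebra ℂ Γ →* Matrix (Fin (d i)) (Fin (d i)) ℂ).comp
      (MonoidAlgebra.of ℂ Γ))
  have hρ : ∀ i h, (ρ i h : Matrix (Fin (d i)) (Fin (d i)) ℂ) = ev i (MonoidAlgebra.of ℂ Γ h) :=
    fun i h => rfl
  have hsurj : ∀ i, Function.Surjective (ev i) := by
    intro i A
    obtain ⟨x, hx⟩ := e.surjective (Pi.single i A)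
    exact ⟨x, by simp [ev, hx]⟩
  refine ⟨k, d, ρ, fun i => ⟨Nat.pos_of_ne_zero (hd i).out, fun U hU => ?_⟩, fun i j hij => ?_,
    fun h => ?_⟩
  -- The projection to a block is onto, so a subspace invariant under the group is invariant under
  -- all matrices.
  · have hU' : ∀ (A : Matrix (Fin (d i)) (Fin (d i)) ℂ), ∀ x ∈ U, A *ᵥ x ∈ U := by
      intro A x hx
      obtain ⟨y, rfl⟩ := hsurj i A
      induction y using MonoidAlgebra.induction_on with
      | of g => exact hU g x hx
      | add y z hy hz => rw [map_add, Matrix.add_mulVec]; exact U.add_mem hy hz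
      | smul c y hy => rw [map_smul, Matrix.smul_mulVec]; exact U.smul_mem c hy
    rw [or_iff_not_imp_left]
    intro hbot
    obtain ⟨x, hx, hx0⟩ := (Submodule.ne_bot_iff U).1 hbot
    obtain ⟨j, hj⟩ := Function.ne_iff.1 hx0
    rw [Submodule.eq_top_iff']
    intro y
    -- A rank one matrix carries the nonzero vector `x` to an arbitrary `y`.
    have h1 := hU' (Matrix.vecMulVec y (Pi.single j (x j)⁻¹)) x hx
    rw [Matrix.vecMulVec_mulVec] at h1
    simpa [inv_mul_cancel₀ hj] using h1
  · have hlin : ∀ x, (ev i x).trace = (ev j x).trace := by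
      intro x
      induction x using MonoidAlgebra.induction_on with
      | of g => exact congrFun hij g
      | add y z hy hz => rw [map_add, map_add, Matrix.trace_add, Matrix.trace_add, hy, hz]
      | smul c y hy => rw [map_smul, map_smul, Matrix.trace_smul, Matrix.trace_smul, hy]
    by_contra hne
    -- Equal characters have equal linear extensions, but the unit of block i has trace `d i` there
    -- and trace zero in block j.
    have h1 := hlin (e.symm (Pi.single i 1))
    simp only [ev, AlgHom.comp_apply] at h1
    simp [Pi.single_eq_of_ne (Ne.symm hne)] at h1
    exact (hd i).out h1
  · rw [← trace_mulLeft_monoidAlgebra h, ← LinearMap.trace_conj' _ e.toLinearEquiv]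
    have : e.toLinearEquiv.conj (LinearMap.mulLeft ℂ (MonoidAlgebra.of ℂ Γ h)) =
        LinearMap.mulLeft ℂ (e (MonoidAlgebra.of ℂ Γ h)) := by
      refine LinearMap.ext fun x => ?_
      simp [LinearEquiv.conj_apply]
    rw [this, trace_mulLeft_pi_matrix]
    rfl

/-- Every irreducible representation occurs in a complete list. -/
theorem exists_repChar_eq [Fintype Γ] [DecidableEq Γ] {k : ℕ} {d : Fin k → ℕ}
    {ρ : ∀ i, Γ →* GL (Fin (d i)) ℂ} (hρ : ∀ i, IsIrreducibleRep (ρ i))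
    (hreg : ∀ h, ∑ i, (d i : ℂ) * repChar (ρ i) h = if h = 1 then (Fintype.card Γ : ℂ) else 0)
    {n : ℕ} {σ : Γ →* GL (Fin n) ℂ} (hσ : IsIrreducibleRep σ) :
    ∃ i, repChar (ρ i) = repChar σ := by
  by_contra! hne
  -- The regular character is paired with that of σ: orthogonality gives zero, while evaluation at
  -- the identity gives |Γ| dim σ.
  have h1 : ∑ h, (∑ i, (d i : ℂ) * repChar (ρ i) h) * repChar σ h⁻¹ = 0 := by
    simp only [Finset.sum_mul]
    rw [Finset.sum_comm]
    refine Finset.sum_eq_zero fun i _ => ?_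
    have := sum_repChar_mul_eq_zero (hρ i) hσ (hne i) 1 1
    simp only [mul_one] at this
    simp only [mul_assoc, ← Finset.mul_sum, this, mul_zero]
  simp only [hreg, ite_mul, zero_mul, Finset.sum_ite_eq', Finset.mem_univ, if_true, inv_one,
    repChar_one] at h1
  exact mul_ne_zero (by exact_mod_cast Fintype.card_ne_zero) (by exact_mod_cast hσ.1.ne') h1

theorem exists_equiv_irr [Fintype Γ] [DecidableEq Γ] :
    ∃ (k : ℕ) (e : Fin k ≃ Irr Γ),
      ∀ h, ∑ i, ((e i).dim : ℂ) * repChar (e i).rep h = if h = 1 then (Fintype.card Γ : ℂ) else 0 := by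
  obtain ⟨k, d, ρ, hρ, hinj, hreg⟩ := exists_complete_irreducibles (Γ := Γ)
  let f (i : Fin k) : Irr Γ := ⟨d i, ⟦⟨ρ i, hρ i⟩⟧⟩
  have hf : ∀ i, repChar (f i).rep = repChar (ρ i) := by
    intro i
    exact (RepEquivalent.repChar_eq (Quotient.exact (Quotient.out_eq (f i).2))).symm
  have hbij : Function.Bijective f := by
    refine ⟨fun i j hij => hinj i j ?_, fun σ => ?_⟩
    · rw [← hf, ← hf, hij]
    · obtain ⟨i, hi⟩ := exists_repChar_eq hρ hreg σ.rep_irreducible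
      exact ⟨i, Irr.ext_repChar ((hf i).trans hi)⟩
  refine ⟨k, Equiv.ofBijective f hbij, fun h => ?_⟩
  rw [← hreg]
  refine Finset.sum_congr rfl fun i _ => ?_
  rw [Equiv.ofBijective_apply, hf]
  rfl

instance Irr.finite [Finite Γ] : Finite (Irr Γ) := by
  classical
  have := Fintype.ofFinite Γ
  obtain ⟨k, e, -⟩ := exists_equiv_irr (Γ := Γ)
  exact Finite.of_equiv _ e

/-- This is the delta function at the identity in Fourier form; it will test whether the holonomy of
a triangle is trivial. -/
theorem sum_dim_mul_repChar [Finite Γ] [Fintype (Irr Γ)] (h : Γ) [Decidable (h = 1)] :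
    ∑ ρ : Irr Γ, (ρ.dim : ℂ) * repChar ρ.rep h = if h = 1 then (Nat.card Γ : ℂ) else 0 := by
  classical
  have := Fintype.ofFinite Γ
  obtain ⟨k, e, he⟩ := exists_equiv_irr (Γ := Γ)
  rw [← e.sum_comp, he, Nat.card_eq_fintype_card]
  congr

end Completeness

/-! ### The projective extension of ρ and its multiplier ζ. -/

section ProjectiveExtension

variable {G' G : Type*} [Group G'] [Group G] (q : G' →* G) {n : ℕ} (ρ : q.ker →* GL (Fin n) ℂ)

/-- The projective extension `α̃ h ↦ M_α ρ(h)` of `ρ` to the preimage of the stabiliser. -/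
def projExt (α : repStabilizer q ρ) (y : G') (hy : q y = α) : GL (Fin n) ℂ :=
  zetaMatrix q ρ α * ρ ⟨(zetaLift q ρ α)⁻¹ * y, by simp [MonoidHom.mem_ker, zetaLift_spec, hy]⟩

variable {q ρ}

/-- Moving ρ of a kernel element past M_β conjugates the element by the lift of β; what remains is
the relation defining ζ. -/
theorem projExt_mul (hρ : IsIrreducibleRep ρ) {α β : repStabilizer q ρ} {y z : G'} (hy : q y = α)
    (hz : q z = β) :
    (zetaScalar q ρ hρ α β : ℂ) • ((projExt q ρ α y hy * projExt q ρ β z hz : GL (Fin n) ℂ) :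
      Matrix (Fin n) (Fin n) ℂ) =
      (projExt q ρ (α * β) (y * z) (by simp [hy, hz]) : Matrix (Fin n) (Fin n) ℂ) := by
  have e : ∀ h : q.ker, ρ h * zetaMatrix q ρ β =
      zetaMatrix q ρ β * ρ (MulAut.conjNormal (zetaLift q ρ β)⁻¹ h) := by
    intro h
    rw [zetaMatrix_spec]
    group
  unfold projExt
  rw [← mul_assoc, mul_assoc (zetaMatrix q ρ α), e, mul_assoc, mul_assoc, ← map_mul, ← mul_assoc,
    Units.val_mul, ← Matrix.smul_mul, zetaScalar_spec, ← Units.val_mul, mul_assoc, ← map_mul]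
  congr 4
  ext
  simp [zetaKer, mul_assoc]

/-- Kernel elements pass through M_α at the cost of a conjugation that is undone by the lift. This
lets ρ of a holonomy be extracted on the left. -/
theorem projExt_ker_mul {α : repStabilizer q ρ} {y : G'} (hy : q y = α) (h : q.ker)
    (hhy : q (h * y) = α) : projExt q ρ α (h * y) hhy = ρ h * projExt q ρ α y hy := by
  have e : ρ h * zetaMatrix q ρ α =
      zetaMatrix q ρ α * ρ (MulAut.conjNormal (zetaLift q ρ α)⁻¹ h) := by
    rw [zetaMatrix_spec]
    group
  unfold projExt
  rw [← mul_assoc (ρ h), e, mul_assoc, ← map_mul]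
  congr 2
  ext
  simp [mul_assoc]

theorem projExt_mul_ker {α : repStabilizer q ρ} {y : G'} (hy : q y = α) (h : q.ker)
    (hyh : q (y * h) = α) : projExt q ρ α (y * h) hyh = projExt q ρ α y hy * ρ h := by
  unfold projExt
  rw [mul_assoc, ← map_mul]
  congr 2
  ext
  simp [mul_assoc]

/-- The value of `ρ` on the holonomy `y z x⁻¹` of a triangle. -/
theorem projExt_holonomy (hρ : IsIrreducibleRep ρ) {α β γ : repStabilizer q ρ} (hγ : α * β = γ)
    {y z x : G'} (hy : q y = α) (hz : q z = β) (hx : q x = γ) (k : q.ker)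
    (hk : (k : G') = y * z * x⁻¹) :
    (ρ k : Matrix (Fin n) (Fin n) ℂ) = (zetaScalar q ρ hρ α β : ℂ) •
      ((projExt q ρ α y hy * projExt q ρ β z hz * (projExt q ρ γ x hx)⁻¹ : GL (Fin n) ℂ) :
        Matrix (Fin n) (Fin n) ℂ) := by
  subst hγ
  have e : k * x = y * z := by rw [hk]; group
  have h1 := projExt_ker_mul hx k (by simp [e, hy, hz])
  simp only [e] at h1
  have h2 : ρ k = projExt q ρ (α * β) (y * z) (by simp [hy, hz]) *
      (projExt q ρ (α * β) x hx)⁻¹ := by rw [h1]; group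
  rw [h2, Units.val_mul, ← projExt_mul hρ hy hz, Matrix.smul_mul, ← Units.val_mul]

/-- The value of `ρ` on the holonomy `x z⁻¹ y⁻¹` of a triangle. -/
theorem projExt_holonomy_inv (hρ : IsIrreducibleRep ρ) {α β γ : repStabilizer q ρ}
    (hγ : α * β = γ) {y z x : G'} (hy : q y = α) (hz : q z = β) (hx : q x = γ) (k : q.ker)
    (hk : (k : G') = x * z⁻¹ * y⁻¹) :
    (ρ k : Matrix (Fin n) (Fin n) ℂ) = ((zetaScalar q ρ hρ α β)⁻¹ : ℂˣ).1 •
      ((projExt q ρ γ x hx * (projExt q ρ β z hz)⁻¹ * (projExt q ρ α y hy)⁻¹ : GL (Fin n) ℂ) :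
        Matrix (Fin n) (Fin n) ℂ) := by
  -- The inverse of `k` has the shape y z x⁻¹ already treated, so only inversion remains.
  have h1 := projExt_holonomy hρ hγ hy hz hx k⁻¹ (by simp [hk, mul_assoc])
  set A := projExt q ρ γ x hx
  set B := projExt q ρ β z hz
  set C := projExt q ρ α y hy
  have h2 : (ρ k : Matrix (Fin n) (Fin n) ℂ) * (ρ k⁻¹ : Matrix (Fin n) (Fin n) ℂ) *
      ((A * B⁻¹ * C⁻¹ : GL (Fin n) ℂ) : Matrix (Fin n) (Fin n) ℂ) =
      ((A * B⁻¹ * C⁻¹ : GL (Fin n) ℂ) : Matrix (Fin n) (Fin n) ℂ) := by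
    rw [← Units.val_mul, ← map_mul]; simp
  rw [h1, Matrix.mul_smul, Matrix.smul_mul, Matrix.mul_assoc, ← Units.val_mul (C * B * A⁻¹)] at h2
  have h3 : C * B * A⁻¹ * (A * B⁻¹ * C⁻¹) = 1 := by group
  rw [h3, Units.val_one, Matrix.mul_one] at h2
  rw [← h2, smul_smul, ← Units.val_mul, inv_mul_cancel, Units.val_one, one_smul]

/-- The orthogonality relations hold on a translate Mρ(h) as well: they contract the indices of M
with those of M⁻¹ to the identity matrix. The fixed matrix M will come from the chosen lift of an
edge. -/
theorem sum_translate_coeff {Γ : Type*} [Group Γ] [Fintype Γ] {ρ : Γ →* GL (Fin n) ℂ}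
    (hρ : IsIrreducibleRep ρ) (M : GL (Fin n) ℂ) (a b c d : Fin n) :
    ∑ h, ((M * ρ h : GL (Fin n) ℂ) : Matrix (Fin n) (Fin n) ℂ) a b *
      (((M * ρ h)⁻¹ : GL (Fin n) ℂ) : Matrix (Fin n) (Fin n) ℂ) c d =
      if a = d ∧ b = c then (Fintype.card Γ : ℂ) / n else 0 := by
  have h1 : ∀ h, ((M * ρ h : GL (Fin n) ℂ) : Matrix (Fin n) (Fin n) ℂ) a b *
      (((M * ρ h)⁻¹ : GL (Fin n) ℂ) : Matrix (Fin n) (Fin n) ℂ) c d =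
      ∑ i, ∑ j, ((M : Matrix (Fin n) (Fin n) ℂ) a i *
        ((M⁻¹ : GL (Fin n) ℂ) : Matrix (Fin n) (Fin n) ℂ) j d) *
        ((ρ h : Matrix (Fin n) (Fin n) ℂ) i b * (ρ h⁻¹ : Matrix (Fin n) (Fin n) ℂ) c j) := by
    intro h
    rw [mul_inv_rev, ← map_inv, Units.val_mul, Units.val_mul, Matrix.mul_apply, Matrix.mul_apply,
      Finset.sum_mul_sum]
    refine Finset.sum_congr rfl fun i _ => Finset.sum_congr rfl fun j _ => ?_
    ring
  have h2 : ∑ i, (M : Matrix (Fin n) (Fin n) ℂ) a i *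
      ((M⁻¹ : GL (Fin n) ℂ) : Matrix (Fin n) (Fin n) ℂ) i d = if a = d then 1 else 0 := by
    rw [← Matrix.mul_apply, ← Units.val_mul, mul_inv_cancel, Units.val_one, Matrix.one_apply]
  rw [Finset.sum_congr rfl fun h _ => h1 h, Finset.sum_comm]
  have h3 : ∀ i, ∑ h, ∑ j, ((M : Matrix (Fin n) (Fin n) ℂ) a i *
        ((M⁻¹ : GL (Fin n) ℂ) : Matrix (Fin n) (Fin n) ℂ) j d) *
        ((ρ h : Matrix (Fin n) (Fin n) ℂ) i b * (ρ h⁻¹ : Matrix (Fin n) (Fin n) ℂ) c j) =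
      (M : Matrix (Fin n) (Fin n) ℂ) a i *
        ((M⁻¹ : GL (Fin n) ℂ) : Matrix (Fin n) (Fin n) ℂ) i d *
          (if b = c then (Fintype.card Γ : ℂ) / n else 0) := by
    intro i
    rw [Finset.sum_comm, Finset.sum_eq_single i]
    · rw [← Finset.mul_sum, sum_coeff_self hρ]; simp
    · intro j _ hj
      rw [← Finset.mul_sum, sum_coeff_self hρ, if_neg fun h => hj h.1.symm, mul_zero]
    · simp
  rw [Finset.sum_congr rfl fun i _ => h3 i, ← Finset.sum_mul, h2]
  by_cases had : a = d <;> by_cases hbc : b = c <;> simp [had, hbc]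

end ProjectiveExtension

/-! ### Evaluation of ζ on the fundamental class as a product over triangles. -/

section Evaluation

/-- Naturality at the level of chains: a cocycle evaluated on a pushed-forward chain is the
pulled-back cocycle evaluated on the chain. -/
theorem kronecker_H2π_map {G H : Type} [Group G] [Group H] (f : G →* H)
    (z : groupCohomology.cocycles₂ (Rep.trivial ℤ H (Additive ℂˣ)))
    (c : groupHomology.cycles₂ (Rep.trivial ℤ G ℤ)) :
    kronecker (groupCohomology.H2π _ z) (IntegralH2.map f (groupHomology.H2π _ c)) =
      (evalChain (fun g : G × G => z.1 (f g.1, f g.2)) c.1).toMul := by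
  have h1 : IntegralH2.map f (groupHomology.H2π _ c) = groupHomology.H2π _
      (groupHomology.mapCycles₂ (A := Rep.trivial ℤ G ℤ) (B := Rep.trivial ℤ H ℤ) f
        (𝟙 (Rep.trivial ℤ G ℤ)) c) := by
    unfold IntegralH2.map
    exact groupHomology.H2π_comp_map_apply (A := Rep.trivial ℤ G ℤ) (B := Rep.trivial ℤ H ℤ) f
      (𝟙 (Rep.trivial ℤ G ℤ)) c
  rw [h1, kronecker_mk]
  congr 1
  have h2 : ∀ x : G × G →₀ ℤ, evalChain z.1 ((groupHomology.chainsMap₂ (A := Rep.trivial ℤ G ℤ)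
      (B := Rep.trivial ℤ H ℤ) f (𝟙 (Rep.trivial ℤ G ℤ))) x) =
      evalChain (fun g : G × G => z.1 (f g.1, f g.2)) x := by
    intro x
    induction x using Finsupp.induction_linear with
    | zero => exact (congrArg _ (map_zero _)).trans ((map_zero _).trans (map_zero _).symm)
    | add y z hy hz =>
      exact ((congrArg _ (map_add _ y z)).trans (map_add _ _ _)).trans
        ((congrArg₂ _ hy hz).trans (map_add _ y z).symm)
    | single g n =>
      rw [evalChain_single]
      have : (groupHomology.chainsMap₂ (A := Rep.trivial ℤ G ℤ)
        (B := Rep.trivial ℤ H ℤ) f (𝟙 (Rep.trivial ℤ G ℤ))) (Finsupp.single g n) =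
          Finsupp.single (f g.1, f g.2) n :=
        (congrArg (Finsupp.mapRange.linearMap _) Finsupp.mapDomain_single).trans
          (Finsupp.mapRange_single (hf := rfl))
      exact (congrArg _ this).trans (evalChain_single _ _ _)
  exact h2 c.1

variable {G' : Type*} {G : Type} [Group G'] [Group G] (q : G' →* G) {n : ℕ}
    (ρ : q.ker →* GL (Fin n) ℂ)

/-- When the stabiliser is everything: an element of `G` as an element of the stabiliser. -/
def toStabilizer (hG : repStabilizer q ρ = ⊤) : G →* repStabilizer q ρ :=
  (MonoidHom.id G).codRestrict (repStabilizer q ρ) (fun g => hG ▸ Subgroup.mem_top g)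

theorem zetaEval_fundamentalClass {W : Type} [TopologicalSpace W] (S : ClosedOrientedSurface W)
    [PathConnectedSpace W] (w : W) (q : G' →* FundamentalGroup W w)
    (ρ : q.ker →* GL (Fin n) ℂ) (hρ : IsIrreducibleRep ρ) (hG : repStabilizer q ρ = ⊤) :
    zetaEval q ρ hρ hG (fundamentalClass S w) =
      ∏ i, ∏ j, ∏ k, if i < j ∧ j < k then
        zetaScalar q ρ hρ (toStabilizer q ρ hG (edgeElement S w i j))
          (toStabilizer q ρ hG (edgeElement S w j k)) ^ S.orientation.sign i j k else 1 := by
  unfold zetaEval zetaClass fundamentalClass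
  rw [kronecker_H2π_map]
  simp only [fundamentalChain, map_sum, toMul_sum]
  refine Finset.prod_congr rfl fun i _ => Finset.prod_congr rfl fun j _ =>
    Finset.prod_congr rfl fun k _ => ?_
  split_ifs
  · exact congrArg Additive.toMul (evalChain_single _ _ _)
  · exact congrArg Additive.toMul (map_zero _)

end Evaluation

/-! ### Barycentric coordinates and open stars. -/

section OpenStars

variable {W : Type*} [TopologicalSpace W] (S : ClosedOrientedSurface W)

/-- The barycentric coordinates of a point of a triangulated surface. -/
def bary (y : W) : Fin S.N → ℝ := (S.homeo.symm y).1

theorem continuous_bary : Continuous (bary S) :=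
  continuous_subtype_val.comp S.homeo.symm.continuous

theorem bary_homeo (z : realization S.K) : bary S (S.homeo z) = z.1 := by simp [bary]

theorem bary_faceMap {s : Finset (Fin S.N)} (hs : s ∈ S.K) (z : closedFace s) :
    bary S (faceMap S hs z) = z.1 := bary_homeo S _

theorem bary_vertexPoint {i : Fin S.N} (hi : ({i} : Finset (Fin S.N)) ∈ S.K) :
    bary S (vertexPoint S hi) = Pi.single i 1 := bary_homeo S _

/-- The open star of a vertex. -/
def openStar (i : Fin S.N) : Set W := {y | 0 < bary S y i}

theorem isOpen_openStar (i : Fin S.N) : IsOpen (openStar S i) :=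
  isOpen_lt continuous_const ((continuous_apply i).comp (continuous_bary S))

theorem exists_mem_openStar (y : W) : ∃ i, y ∈ openStar S i := by
  by_contra! h
  have h1 : ∑ i, bary S y i = 1 := (S.homeo.symm y).2.1.2
  have h2 : ∀ i, bary S y i = 0 := fun i =>
    le_antisymm (not_lt.1 (h i)) ((S.homeo.symm y).2.1.1 i)
  simp [h2] at h1

/-- The simplices whose closed faces contain a given point. -/
theorem exists_face (y : W) : ∃ s ∈ S.K, bary S y ∈ closedFace s := by
  obtain ⟨h1, s, hs, h2⟩ := (S.homeo.symm y).2
  exact ⟨s, hs, h1, h2⟩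

variable {S}

/-- Vertices whose open stars share a point therefore lie in a common simplex, so conditions on
triples of stars reduce to conditions on simplices. -/
theorem mem_of_mem_openStar {y : W} {s : Finset (Fin S.N)} (hy : bary S y ∈ closedFace s)
    {i : Fin S.N} (hi : y ∈ openStar S i) : i ∈ s := by
  by_contra h
  exact (ne_of_gt hi) (hy.2 i h)

theorem triple_mem {s : Finset (Fin S.N)} (hs : s ∈ S.K) {i j k : Fin S.N} (hi : i ∈ s)
    (hj : j ∈ s) (hk : k ∈ s) : ({i, j, k} : Finset (Fin S.N)) ∈ S.K :=
  face_subset hs (by intro x hx; simp only [Finset.mem_insert, Finset.mem_singleton] at hx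
                     rcases hx with rfl | rfl | rfl <;> assumption) ⟨i, by simp⟩

theorem singleton_mem_of_mem_openStar {y : W} {i : Fin S.N} (hi : y ∈ openStar S i) :
    ({i} : Finset (Fin S.N)) ∈ S.K := by
  obtain ⟨s, hs, hy⟩ := exists_face S y
  exact vertex_mem S hs (mem_of_mem_openStar hy hi)

theorem vertexPoint_mem_openStar_iff {i j : Fin S.N} (hi : ({i} : Finset (Fin S.N)) ∈ S.K) :
    vertexPoint S hi ∈ openStar S j ↔ j = i := by
  rw [openStar, Set.mem_ofPred_eq, bary_vertexPoint, Pi.single_apply]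
  split_ifs with h <;> simp [h]

end OpenStars

/-! ### The flat bundle of a simplicial 1-cocycle and its holonomy. -/

section Holonomy

variable {W : Type*} [TopologicalSpace W] {S : ClosedOrientedSurface W} {G : Type*} [Group G]

/-- A flat `G`-connection: a 1-cocycle on the triangulation. -/
def IsFlat (S : ClosedOrientedSurface W) (x : Fin S.N → Fin S.N → G) : Prop :=
  ∀ i j k, ({i, j, k} : Finset (Fin S.N)) ∈ S.K → x i j * x j k = x i k

/-- Flatness covers degenerate triples, here (i, i, i). -/
theorem IsFlat.self {x : Fin S.N → Fin S.N → G} (hx : IsFlat S x) {i : Fin S.N}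
    (hi : ({i} : Finset (Fin S.N)) ∈ S.K) : x i i = 1 :=
  mul_eq_left.1 (hx i i i (by simpa using hi))

variable [TopologicalSpace G] [DiscreteTopology G]

/-- The flat `G`-bundle of a flat connection, trivialised over the open stars. -/
def IsFlat.core {x : Fin S.N → Fin S.N → G} (hx : IsFlat S x) :
    FiberBundleCore (Fin S.N) W G where
  baseSet := openStar S
  isOpen_baseSet := isOpen_openStar S
  indexAt y := (exists_mem_openStar S y).choose
  mem_baseSet_at y := (exists_mem_openStar S y).choose_spec
  -- Transition functions multiply on the left, so that right multiplication by `G` is globally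
  -- defined.
  coordChange i j _ g := x j i * g
  coordChange_self i y hy g := by
    rw [hx.self (singleton_mem_of_mem_openStar hy), one_mul]
  continuousOn_coordChange i j :=
    (continuous_of_discreteTopology.comp continuous_snd).continuousOn
  coordChange_comp i j k y hy g := by
    obtain ⟨s, hs, hys⟩ := exists_face S y
    rw [← mul_assoc, hx k j i (triple_mem hs (mem_of_mem_openStar hys hy.2)
      (mem_of_mem_openStar hys hy.1.2) (mem_of_mem_openStar hys hy.1.1))]

variable {x : Fin S.N → Fin S.N → G} (hx : IsFlat S x)

theorem IsFlat.isCoveringMap : IsCoveringMap hx.core.proj :=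
  FiberBundle.isCoveringMap (F := G) (E := hx.core.Fiber)

/-- The fibre coordinate of a point of the flat bundle. -/
def IsFlat.coord (q : hx.core.TotalSpace) : G := q.2

/-- A point of the total space stores its fibre coordinate in the chart `indexAt` of its base point;
the factor `x i (indexAt _)` converts it to chart i. -/
theorem IsFlat.isOpen_generator (i : Fin S.N) {s : Set (W × G)} (hs : IsOpen s) :
    IsOpen {q : hx.core.TotalSpace | q.1 ∈ openStar S i ∧
      (q.1, x i (hx.core.indexAt q.1) * hx.coord q) ∈ s} :=
  TopologicalSpace.GenerateOpen.basic _ (by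
    simp only [Set.mem_iUnion]
    exact ⟨i, s, hs, rfl⟩)

theorem IsFlat.continuous_iff {X : Type*} [TopologicalSpace X] {f : X → hx.core.TotalSpace} :
    Continuous f ↔ ∀ (i : Fin S.N) (s : Set (W × G)), IsOpen s →
      IsOpen {a | (f a).1 ∈ openStar S i ∧
        ((f a).1, x i (hx.core.indexAt (f a).1) * hx.coord (f a)) ∈ s} := by
  refine ⟨fun h i s hs => h.isOpen_preimage _ (hx.isOpen_generator i hs), fun h => ?_⟩
  refine continuous_generateFrom_iff.2 fun t ht => ?_
  simp only [Set.mem_iUnion] at ht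
  obtain ⟨i, s, hs, rfl⟩ := ht
  exact h i s hs

/-- In every chart this is right multiplication on a discrete fibre, by associativity. -/
theorem IsFlat.continuous_mul_right (k : G) : Continuous
    (fun q : hx.core.TotalSpace => (⟨q.1, hx.coord q * k⟩ : hx.core.TotalSpace)) := by
  rw [hx.continuous_iff]
  intro i s hs
  have := hx.isOpen_generator i (s := (Prod.map id (· * k)) ⁻¹' s)
    (hs.preimage (continuous_id.prodMap continuous_of_discreteTopology))
  refine (congrArg IsOpen (Set.ext fun q => ?_)).mpr this
  change _ ∧ (q.1, x i (hx.core.indexAt q.1) * (hx.coord q * k)) ∈ s ↔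
    _ ∧ (q.1, x i (hx.core.indexAt q.1) * hx.coord q * k) ∈ s
  rw [mul_assoc]

/-- Parallel transport of a flat connection along a homotopy class of paths. -/
def IsFlat.transport {a b : W} (γ : Path.Homotopic.Quotient a b) (g : G) : G :=
  (hx.isCoveringMap.monodromy γ ⟨⟨a, g⟩, rfl⟩).1.2

theorem IsFlat.monodromy_eq {a b : W} (γ : Path.Homotopic.Quotient a b) (g : G) :
    hx.isCoveringMap.monodromy γ ⟨⟨a, g⟩, rfl⟩ = ⟨⟨b, hx.transport γ g⟩, rfl⟩ := by
  unfold IsFlat.transport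
  generalize hx.isCoveringMap.monodromy γ ⟨⟨a, g⟩, rfl⟩ = e
  obtain ⟨⟨y, k⟩, he⟩ := e
  obtain rfl : y = b := he
  rfl

theorem IsFlat.transport_refl (a : W) (g : G) :
    hx.transport (Path.Homotopic.Quotient.refl a) g = g := by
  unfold IsFlat.transport
  rw [IsCoveringMap.monodromy_refl]
  rfl

theorem IsFlat.transport_trans {a b c : W} (γ : Path.Homotopic.Quotient a b)
    (δ : Path.Homotopic.Quotient b c) (g : G) :
    hx.transport (γ.trans δ) g = hx.transport δ (hx.transport γ g) := by
  conv_lhs => unfold IsFlat.transport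
  rw [IsCoveringMap.monodromy_trans_apply, hx.monodromy_eq]
  rfl

/-- Right translation carries a lift of a path to a lift of the same path, and lifts with given
initial point are unique. -/
theorem IsFlat.transport_mul {a b : W} (γ : Path.Homotopic.Quotient a b) (g k : G) :
    hx.transport γ (g * k) = hx.transport γ g * k := by
  induction γ using Quotient.inductionOn with
  | h γ =>
  have cov := hx.isCoveringMap
  have h0 : γ.toContinuousMap 0 = hx.core.proj ⟨a, g⟩ := γ.source
  have h0' : γ.toContinuousMap 0 = hx.core.proj ⟨a, (g * k : G)⟩ := γ.source
  let Γ := cov.liftPath γ.toContinuousMap ⟨a, g⟩ h0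
  let R : C(hx.core.TotalSpace, hx.core.TotalSpace) := ⟨_, hx.continuous_mul_right k⟩
  have hΓ : R.comp Γ = cov.liftPath γ.toContinuousMap ⟨a, (g * k : G)⟩ h0' := by
    rw [cov.eq_liftPath_iff']
    refine ⟨?_, ?_⟩
    · rw [← cov.liftPath_lifts γ.toContinuousMap ⟨a, g⟩ h0]
      rfl
    · have := cov.liftPath_zero γ.toContinuousMap ⟨a, g⟩ h0
      exact (congrArg R this).trans rfl
  change (cov.liftPath γ.toContinuousMap ⟨a, (g * k : G)⟩ h0' 1).2 = hx.coord (Γ 1) * k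
  rw [← hΓ]
  rfl

/-- The holonomy of a flat connection along a homotopy class of paths. -/
def IsFlat.hol {a b : W} (γ : Path.Homotopic.Quotient a b) : G := hx.transport γ 1

theorem IsFlat.hol_trans {a b c : W} (γ : Path.Homotopic.Quotient a b)
    (δ : Path.Homotopic.Quotient b c) : hx.hol (γ.trans δ) = hx.hol δ * hx.hol γ := by
  rw [IsFlat.hol, hx.transport_trans, ← one_mul (hx.transport γ 1), hx.transport_mul]
  rfl

theorem IsFlat.hol_refl (a : W) : hx.hol (Path.Homotopic.Quotient.refl a) = 1 :=
  hx.transport_refl a 1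

theorem IsFlat.hol_symm {a b : W} (γ : Path.Homotopic.Quotient a b) :
    hx.hol γ.symm = (hx.hol γ)⁻¹ := by
  rw [eq_inv_iff_mul_eq_one, ← hx.hol_trans, Path.Homotopic.Quotient.trans_symm, hx.hol_refl]

/-- A vertex lies in no open star but its own, so the chosen chart there is forced. -/
theorem IsFlat.indexAt_vertexPoint {i : Fin S.N} (hi : ({i} : Finset (Fin S.N)) ∈ S.K) :
    hx.core.indexAt (vertexPoint S hi) = i :=
  (vertexPoint_mem_openStar_iff hi).1 (hx.core.mem_baseSet_at _)

/-- The section of the flat bundle over a closed simplex that is constant in the chart of a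
vertex. -/
theorem IsFlat.continuous_section {s : Finset (Fin S.N)} (hs : s ∈ S.K) {i : Fin S.N}
    (hi : i ∈ s) : Continuous (fun z : closedFace s =>
      (⟨faceMap S hs z, x (hx.core.indexAt (faceMap S hs z)) i⟩ : hx.core.TotalSpace)) := by
  rw [hx.continuous_iff]
  intro k t ht
  have h1 : IsOpen {z : closedFace s | faceMap S hs z ∈ openStar S k ∧
      (faceMap S hs z, x k i) ∈ t} :=
    ((isOpen_openStar S k).preimage (faceMap S hs).continuous).inter
      (ht.preimage ((faceMap S hs).continuous.prodMk continuous_const))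
  refine (congrArg IsOpen (Set.ext fun z => ?_)).mpr h1
  refine and_congr_right fun hz => ?_
  have hf : bary S (faceMap S hs z) ∈ closedFace s := by rw [bary_faceMap]; exact z.2
  change (_, x k (hx.core.indexAt (faceMap S hs z)) * x (hx.core.indexAt (faceMap S hs z)) i) ∈ t ↔ _
  -- Read in chart k, the section has the constant value `x k i`.
  rw [hx k _ i (triple_mem hs (mem_of_mem_openStar hf hz)
    (mem_of_mem_openStar hf (hx.core.mem_baseSet_at _)) hi)]

/-- The section constant in the chart of `i` lifts the segment. At its two ends the charts are those
of `i` and `j`, where it takes the values `x i i = 1` and `x j i`. -/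
theorem IsFlat.hol_simplexPath {s : Finset (Fin S.N)} (hs : s ∈ S.K) {i j : Fin S.N}
    (hi : i ∈ s) (hj : j ∈ s) :
    hx.hol (Path.Homotopic.Quotient.mk (simplexPath S hs hi hj)) = x j i := by
  have cov := hx.isCoveringMap
  have h0 : (simplexPath S hs hi hj).toContinuousMap 0 =
      hx.core.proj ⟨vertexPoint S (vertex_mem S hs hi), (1 : G)⟩ := Path.source _
  let Γ : C(unitInterval, hx.core.TotalSpace) :=
    ⟨_, (hx.continuous_section hs hi).comp (facePath hi hj).continuous⟩
  have hΓ : Γ = cov.liftPath (simplexPath S hs hi hj).toContinuousMap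
      ⟨vertexPoint S (vertex_mem S hs hi), (1 : G)⟩ h0 := by
    rw [cov.eq_liftPath_iff']
    refine ⟨rfl, ?_⟩
    change (⟨faceMap S hs (facePath hi hj 0), x (hx.core.indexAt (faceMap S hs (facePath hi hj 0))) i⟩
      : hx.core.TotalSpace) = _
    rw [(facePath hi hj).source]
    change (⟨vertexPoint S (vertex_mem S hs hi),
      x (hx.core.indexAt (vertexPoint S (vertex_mem S hs hi))) i⟩ : hx.core.TotalSpace) = _
    rw [hx.indexAt_vertexPoint, hx.self (vertex_mem S hs hi)]
  change (cov.liftPath (simplexPath S hs hi hj).toContinuousMap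
      ⟨vertexPoint S (vertex_mem S hs hi), (1 : G)⟩ h0 1).2 = x j i
  rw [← hΓ]
  change x (hx.core.indexAt (faceMap S hs (facePath hi hj 1))) i = x j i
  rw [(facePath hi hj).target]
  change x (hx.core.indexAt (vertexPoint S (vertex_mem S hs hj))) i = x j i
  rw [hx.indexAt_vertexPoint]

/-- The holonomy representation of a flat connection. -/
def IsFlat.holHom (w : W) : FundamentalGroup W w →* G where
  toFun γ := hx.hol γ
  map_one' := hx.hol_refl w
  -- The product `γ * δ` is the concatenation of δ followed by γ, and holonomy reverses
  -- concatenation, so the two reversals cancel.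
  map_mul' γ δ := hx.hol_trans δ γ

end Holonomy

/-! ### From flat connections to homomorphisms of the fundamental group. -/

section HolonomyRepresentation

variable {W : Type*} [TopologicalSpace W] (S : ClosedOrientedSurface W) [PathConnectedSpace W]
  (w : W)

/-- A flat connection is gauge equivalent to a homomorphism of the fundamental group. -/
theorem exists_hom_of_isFlat {G : Type*} [Group G] {x : Fin S.N → Fin S.N → G}
    (hx : IsFlat S x) : ∃ (f : FundamentalGroup W w →* G) (t : Fin S.N → G),
      ∀ i j, ({i, j} : Finset (Fin S.N)) ∈ S.K →
        f (edgeElement S w i j) = t i * x i j * (t j)⁻¹ := by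
  classical
  let _ : TopologicalSpace G := ⊥
  have : DiscreteTopology G := ⟨rfl⟩
  -- The gauge at a vertex is the inverse holonomy of the chosen path from `w` to it, since edge
  -- elements are closed up by these paths.
  refine ⟨hx.holHom w, fun i => if hi : ({i} : Finset (Fin S.N)) ∈ S.K then
    (hx.hol (Path.Homotopic.Quotient.mk
      (PathConnectedSpace.somePath w (vertexPoint S hi))))⁻¹ else 1, fun i j hij => ?_⟩
  simp only []
  rw [dif_pos (vertex_mem S hij (pair_mem_left i j)), dif_pos (vertex_mem S hij (pair_mem_right i j)),
    edgeElement_eq S w hij (pair_mem_left i j) (pair_mem_right i j)]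
  change hx.hol (Path.Homotopic.Quotient.mk _) = _
  rw [Path.Homotopic.Quotient.mk_trans, Path.Homotopic.Quotient.mk_trans,
    Path.Homotopic.Quotient.mk_symm, hx.hol_trans, hx.hol_trans, hx.hol_symm, hx.hol_simplexPath,
    inv_inv, mul_assoc]

end HolonomyRepresentation

/-! ### Cancellation and homotopy of paths. -/

section PathAlgebra

variable {X : Type*} [TopologicalSpace X] {a b c d : X}

namespace Path.Homotopic.Quotient

theorem symm_trans_cancel_left (p : Path.Homotopic.Quotient a b)
    (q : Path.Homotopic.Quotient b c) : p.symm.trans (p.trans q) = q := by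
  rw [← trans_assoc, symm_trans, refl_trans]

theorem trans_symm_cancel_left (p : Path.Homotopic.Quotient b a)
    (q : Path.Homotopic.Quotient b c) : p.trans (p.symm.trans q) = q := by
  rw [← trans_assoc, trans_symm, refl_trans]

end Path.Homotopic.Quotient

/-- Two paths with the same end points in a simply connected subset are homotopic. -/
theorem Path.homotopic_of_forall_mem (U : Set X) [SimplyConnectedSpace U] (γ δ : Path a b)
    (hγ : ∀ t, γ t ∈ U) (hδ : ∀ t, δ t ∈ U) : γ.Homotopic δ := by
  have ha : a ∈ U := by simpa using hγ 0
  have hb : b ∈ U := by simpa using hγ 1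
  let γ' : Path (⟨a, ha⟩ : U) ⟨b, hb⟩ :=
    ⟨⟨fun t => ⟨γ t, hγ t⟩, by fun_prop⟩, by simp, by simp⟩
  let δ' : Path (⟨a, ha⟩ : U) ⟨b, hb⟩ :=
    ⟨⟨fun t => ⟨δ t, hδ t⟩, by fun_prop⟩, by simp, by simp⟩
  exact (SimplyConnectedSpace.paths_homotopic γ' δ').map ⟨_, continuous_subtype_val⟩

end PathAlgebra

/-! ### Straight segments and simple connectedness of stars and faces. -/

section Cells

variable {W : Type*} [TopologicalSpace W] (S : ClosedOrientedSurface W)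

/-- The subset of a triangulated surface given by a subset of the realisation. -/
def cell (C : Set (Fin S.N → ℝ)) : Set W := {y | bary S y ∈ C}

/-- A subset of the realisation is homeomorphic to the corresponding subset of the surface. -/
def cellHomeo {C : Set (Fin S.N → ℝ)} (hC : C ⊆ realization S.K) : C ≃ₜ cell S C where
  toFun z := ⟨S.homeo ⟨z.1, hC z.2⟩, by
    rw [cell, Set.mem_ofPred_eq, bary_homeo]
    exact z.2⟩
  invFun y := ⟨bary S y.1, y.2⟩
  left_inv z := by ext1; exact bary_homeo S _
  right_inv y := by
    ext1
    exact S.homeo.apply_symm_apply y.1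
  continuous_toFun := by
    refine Continuous.subtype_mk (S.homeo.continuous.comp ?_) _
    exact continuous_subtype_val.subtype_mk _
  continuous_invFun := ((continuous_bary S).comp continuous_subtype_val).subtype_mk _

theorem simplyConnectedSpace_cell {C : Set (Fin S.N → ℝ)} (hC : C ⊆ realization S.K)
    {z : Fin S.N → ℝ} (hz : z ∈ C) (hstar : StarConvex ℝ z C) :
    SimplyConnectedSpace (cell S C) := by
  have : ContractibleSpace C := hstar.contractibleSpace ⟨z, hz⟩
  have := (cellHomeo S hC).symm.contractibleSpace
  infer_instance

variable {S}

theorem closedFace_subset {s : Finset (Fin S.N)} (hs : s ∈ S.K) :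
    closedFace s ⊆ realization S.K := fun _ h => ⟨h.1, s, hs, h.2⟩

/-- The segment from a point to a vertex stays in a closed simplex. -/
theorem lineMap_mem_closedFace {s : Finset (Fin S.N)} {i : Fin S.N} (hi : i ∈ s)
    {z : Fin S.N → ℝ} (hz : z ∈ closedFace s) (t : unitInterval) :
    AffineMap.lineMap z (Pi.single i 1 : Fin S.N → ℝ) (t : ℝ) ∈ closedFace s :=
  (closedFace_convex s).lineMap_mem hz (single_mem_closedFace hi) t.2

theorem lineMap_mem_realization {y : W} {i : Fin S.N} (hy : y ∈ openStar S i)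
    (t : unitInterval) :
    AffineMap.lineMap (bary S y) (Pi.single i 1 : Fin S.N → ℝ) (t : ℝ) ∈ realization S.K := by
  obtain ⟨s, hs, hz⟩ := exists_face S y
  exact closedFace_subset hs (lineMap_mem_closedFace (mem_of_mem_openStar hz hy) hz t)

/-- The segment from a point of the open star of a vertex to the vertex. -/
def starSegment {y : W} {i : Fin S.N} (hy : y ∈ openStar S i) :
    Path y (vertexPoint S (singleton_mem_of_mem_openStar hy)) where
  toFun t := S.homeo ⟨_, lineMap_mem_realization hy t⟩
  continuous_toFun := by
    refine S.homeo.continuous.comp (Continuous.subtype_mk ?_ _)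
    exact AffineMap.lineMap_continuous.comp continuous_subtype_val
  source' := by
    refine S.homeo.symm.injective ?_
    rw [S.homeo.symm_apply_apply]
    ext1
    simp [bary]
  target' := by
    refine S.homeo.symm.injective ?_
    rw [S.homeo.symm_apply_apply]
    ext1
    refine Eq.trans ?_ (bary_vertexPoint S (singleton_mem_of_mem_openStar hy)).symm
    simp

theorem bary_segment {y : W} {i : Fin S.N} (hy : y ∈ openStar S i) (t : unitInterval) :
    bary S (starSegment hy t) = AffineMap.lineMap (bary S y) (Pi.single i 1 : Fin S.N → ℝ) (t : ℝ) :=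
  bary_homeo S _

theorem segment_mem_openStar {y : W} {i : Fin S.N} (hy : y ∈ openStar S i) (t : unitInterval) :
    starSegment hy t ∈ openStar S i := by
  rw [openStar, Set.mem_ofPred_eq, bary_segment, AffineMap.lineMap_apply_module]
  have h1 : 0 < bary S y i := hy
  have h2 := t.2.1
  have h3 := t.2.2
  simp only [Pi.add_apply, Pi.smul_apply, smul_eq_mul, Pi.single_eq_same, mul_one]
  by_cases h : (t : ℝ) = 0
  · simp [h, h1]
  · have h4 : 0 < (t : ℝ) := lt_of_le_of_ne h2 (Ne.symm h)
    have h5 : 0 ≤ (1 - (t : ℝ)) * bary S y i := mul_nonneg (by linarith) h1.le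
    linarith

/-- In barycentric coordinates the open star is star-convex about its vertex: any face containing a
point of it contains the vertex. -/
theorem simplyConnectedSpace_openStar {i : Fin S.N} (hi : ({i} : Finset (Fin S.N)) ∈ S.K) :
    SimplyConnectedSpace (openStar S i) := by
  have h1 : openStar S i = cell S {z | z ∈ realization S.K ∧ 0 < z i} := by
    ext y
    exact ⟨fun h => ⟨(S.homeo.symm y).2, h⟩, fun h => h.2⟩
  rw [h1]
  refine simplyConnectedSpace_cell S (fun z hz => hz.1) (z := Pi.single i 1)
    ⟨closedFace_subset hi (single_mem_closedFace (Finset.mem_singleton_self i)), by simp⟩ ?_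
  rintro z ⟨⟨hz1, s, hs, hz2⟩, hz3⟩ a b ha hb hab
  have his : i ∈ s := by
    by_contra h
    exact hz3.ne' (hz2 i h)
  refine ⟨closedFace_subset hs (closedFace_convex s (single_mem_closedFace his) ⟨hz1, hz2⟩
    ha hb hab), ?_⟩
  simp only [Pi.add_apply, Pi.smul_apply, smul_eq_mul, Pi.single_eq_same, mul_one]
  by_cases h : a = 0
  · have : b = 1 := by linarith
    simp [h, this, hz3]
  · have h4 : 0 < a := lt_of_le_of_ne ha (Ne.symm h)
    have h5 : 0 ≤ b * z i := mul_nonneg hb hz3.le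
    linarith

/-- Simple connectedness of the star allows the path to be pushed through the vertex. -/
theorem homotopic_of_mem_openStar {i : Fin S.N} {a b : W} (γ : Path a b)
    (hγ : ∀ t, γ t ∈ openStar S i) (ha : a ∈ openStar S i) (hb : b ∈ openStar S i) :
    γ.Homotopic ((starSegment ha).trans (starSegment hb).symm) := by
  have := simplyConnectedSpace_openStar (singleton_mem_of_mem_openStar ha)
  refine Path.homotopic_of_forall_mem (openStar S i) _ _ hγ fun t => ?_
  have h1 : t ∈ Set.univ := Set.mem_univ t
  have h2 := Set.mem_range_self (f := (starSegment ha).trans (starSegment hb).symm) t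
  rw [Path.trans_range, Path.symm_range] at h2
  rcases h2 with ⟨u, hu⟩ | ⟨u, hu⟩ <;> rw [← hu] <;> exact segment_mem_openStar _ u

/-- Both paths run inside one closed face, which is convex. This is where passing from one star to
another becomes an edge. -/
theorem segment_symm_trans_segment {y : W} {s : Finset (Fin S.N)} (hs : s ∈ S.K) {i j : Fin S.N}
    (hi : y ∈ openStar S i) (hj : y ∈ openStar S j) (hy : bary S y ∈ closedFace s) :
    ((starSegment hi).symm.trans (starSegment hj)).Homotopic (simplexPath S hs
      (mem_of_mem_openStar hy hi) (mem_of_mem_openStar hy hj)) := by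
  have : SimplyConnectedSpace (cell S (closedFace s)) :=
    simplyConnectedSpace_cell S (closedFace_subset hs) hy (fun z hz a b ha hb hab =>
      closedFace_convex s hy hz ha hb hab)
  refine Path.homotopic_of_forall_mem (cell S (closedFace s)) _ _ (fun t => ?_) fun t => ?_
  · have h2 := Set.mem_range_self (f := (starSegment hi).symm.trans (starSegment hj)) t
    rw [Path.trans_range, Path.symm_range] at h2
    rcases h2 with ⟨u, hu⟩ | ⟨u, hu⟩ <;> rw [← hu, cell, Set.mem_ofPred_eq, bary_segment]
    · exact lineMap_mem_closedFace (mem_of_mem_openStar hy hi) hy u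
    · exact lineMap_mem_closedFace (mem_of_mem_openStar hy hj) hy u
  · have : bary S (simplexPath S hs (mem_of_mem_openStar hy hi) (mem_of_mem_openStar hy hj) t) =
        (facePath (mem_of_mem_openStar hy hi) (mem_of_mem_openStar hy hj) t).1 :=
      bary_faceMap S hs _
    rw [cell, Set.mem_ofPred_eq, this]
    exact Subtype.prop _

end Cells

/-! ### Edge walks exhaust the fundamental group. -/

section EdgeWalks

variable {W : Type*} [TopologicalSpace W] (S : ClosedOrientedSurface W) [PathConnectedSpace W]
  (w : W)

/-- `EdgeWalk S w i j g`: the element `g` of the fundamental group is the product of the edge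
elements along a walk from the vertex `i` to the vertex `j`. -/
inductive EdgeWalk : Fin S.N → Fin S.N → FundamentalGroup W w → Prop
  | nil (i : Fin S.N) : EdgeWalk i i 1
  | cons {i j k : Fin S.N} {g : FundamentalGroup W w} (h : ({i, j} : Finset (Fin S.N)) ∈ S.K)
      (hw : EdgeWalk j k g) : EdgeWalk i k (edgeElement S w i j * g)

variable {S w}

theorem EdgeWalk.trans {i j k : Fin S.N} {g g' : FundamentalGroup W w}
    (h : EdgeWalk S w i j g) (h' : EdgeWalk S w j k g') : EdgeWalk S w i k (g * g') := by
  induction h with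
  | nil i => rwa [one_mul]
  | cons e _ ih => rw [mul_assoc]; exact .cons e (ih h')

/-- The loop obtained from a path between points of open stars. -/
def tailLoop (w : W) {a b : W} {i j : Fin S.N} (ha : a ∈ openStar S i) (hb : b ∈ openStar S j)
    (γ : Path.Homotopic.Quotient a b) : FundamentalGroup W w :=
  FundamentalGroup.fromPath
    ((Path.Homotopic.Quotient.mk (PathConnectedSpace.somePath w
      (vertexPoint S (singleton_mem_of_mem_openStar ha)))).trans
    ((Path.Homotopic.Quotient.mk (starSegment ha)).symm.trans (γ.trans
      ((Path.Homotopic.Quotient.mk (starSegment hb)).trans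
        (Path.Homotopic.Quotient.mk (PathConnectedSpace.somePath w
          (vertexPoint S (singleton_mem_of_mem_openStar hb)))).symm))))

/-- The tails inserted at `b` cancel; the order reverses with the product of `FundamentalGroup`. -/
theorem tailLoop_trans {a b c : W} {i j k : Fin S.N} (ha : a ∈ openStar S i)
    (hb : b ∈ openStar S j) (hc : c ∈ openStar S k) (γ : Path.Homotopic.Quotient a b)
    (δ : Path.Homotopic.Quotient b c) :
    tailLoop w ha hc (γ.trans δ) = tailLoop w hb hc δ * tailLoop w ha hb γ := by
  rw [FundamentalGroup.mul_def]
  simp only [tailLoop, Path.Homotopic.Quotient.trans_assoc,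
    Path.Homotopic.Quotient.symm_trans_cancel_left,
    Path.Homotopic.Quotient.trans_symm_cancel_left]

/-- A constant path with different stars at its two ends gives one edge element, possibly the
degenerate one with i = j. -/
theorem tailLoop_refl {a : W} {i j : Fin S.N} (ha : a ∈ openStar S i) (ha' : a ∈ openStar S j) :
    EdgeWalk S w j i (tailLoop w ha ha' (Path.Homotopic.Quotient.refl a)) := by
  obtain ⟨s, hs, hy⟩ := exists_face S a
  have h1 : ({j, i} : Finset (Fin S.N)) ∈ S.K := by
    have := triple_mem hs (mem_of_mem_openStar hy ha') (mem_of_mem_openStar hy ha)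
      (mem_of_mem_openStar hy ha)
    simpa using this
  have h2 : tailLoop w ha ha' (Path.Homotopic.Quotient.refl a) = edgeElement S w j i := by
    rw [edgeElement_eq S w hs (mem_of_mem_openStar hy ha') (mem_of_mem_openStar hy ha)]
    have h3 := Path.Homotopic.Quotient.eq.2 (segment_symm_trans_segment hs ha ha' hy)
    rw [Path.Homotopic.Quotient.mk_trans, Path.Homotopic.Quotient.mk_symm] at h3
    rw [Path.Homotopic.Quotient.mk_trans, Path.Homotopic.Quotient.mk_trans, ← h3]
    simp only [tailLoop, Path.Homotopic.Quotient.trans_assoc, Path.Homotopic.Quotient.refl_trans,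
      Path.Homotopic.Quotient.mk_symm]
  rw [h2, ← mul_one (edgeElement S w j i)]
  exact .cons h1 (.nil i)

variable (w) in
/-- All loops obtained from a homotopy class of paths are products along edge walks. -/
def IsWalkable {a b : W} (γ : Path.Homotopic.Quotient a b) : Prop :=
  ∀ (i j : Fin S.N) (ha : a ∈ openStar S i) (hb : b ∈ openStar S j),
    EdgeWalk S w j i (tailLoop w ha hb γ)

theorem IsWalkable.trans {a b c : W} {γ : Path.Homotopic.Quotient a b}
    {δ : Path.Homotopic.Quotient b c} (hγ : IsWalkable (S := S) w γ)
    (hδ : IsWalkable (S := S) w δ) : IsWalkable (S := S) w (γ.trans δ) := by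
  intro i k ha hc
  obtain ⟨j, hj⟩ := exists_mem_openStar S b
  rw [tailLoop_trans ha hj hc]
  exact (hδ j k hj hc).trans (hγ i j ha hj)

/-- Such a path may be pushed through the vertex of the star, so its loop records only the changes
of star at its two ends. -/
theorem isWalkable_of_mem_openStar {a b : W} (γ : Path a b) {i : Fin S.N}
    (hγ : ∀ t, γ t ∈ openStar S i) :
    IsWalkable (S := S) w (Path.Homotopic.Quotient.mk γ) := by
  have ha : a ∈ openStar S i := by simpa using hγ 0
  have hb : b ∈ openStar S i := by simpa using hγ 1
  intro k l hk hl
  have h1 : tailLoop w ha hl (Path.Homotopic.Quotient.mk γ) =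
      tailLoop w hb hl (Path.Homotopic.Quotient.refl b) := by
    rw [Path.Homotopic.Quotient.eq.2 (homotopic_of_mem_openStar γ hγ ha hb),
      Path.Homotopic.Quotient.mk_trans, Path.Homotopic.Quotient.mk_symm]
    simp only [tailLoop, Path.Homotopic.Quotient.trans_assoc, Path.Homotopic.Quotient.refl_trans,
      Path.Homotopic.Quotient.symm_trans_cancel_left]
  rw [← Path.Homotopic.Quotient.refl_trans (Path.Homotopic.Quotient.mk γ),
    tailLoop_trans hk ha hl, h1]
  exact (tailLoop_refl hb hl).trans (tailLoop_refl hk ha)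

/-- By compactness of the interval the path is a concatenation of pieces, each inside one open star.
-/
theorem isWalkable {a b : W} (γ : Path a b) :
    IsWalkable (S := S) w (Path.Homotopic.Quotient.mk γ) := by
  obtain ⟨t, ht0, hmono, ⟨m, hm⟩, hcov⟩ := exists_monotone_Icc_subset_open_cover_unitInterval
    (c := fun i => γ ⁻¹' openStar S i) (fun i => (isOpen_openStar S i).preimage γ.continuous)
    (fun u _ => Set.mem_iUnion.2 (exists_mem_openStar S (γ u)))
  have hstep : ∀ n, IsWalkable (S := S) w
      (Path.Homotopic.Quotient.mk (γ.subpath (t n) (t (n + 1)))) := by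
    intro n
    obtain ⟨i, hi⟩ := hcov n
    refine isWalkable_of_mem_openStar _ (i := i) fun u => ?_
    have h1 := Set.mem_range_self (f := γ.subpath (t n) (t (n + 1))) u
    rw [Path.range_subpath_of_le _ _ _ (hmono n.le_succ)] at h1
    obtain ⟨v, hv, hv'⟩ := h1
    rw [← hv']
    exact hi hv
  have hall : ∀ n, IsWalkable (S := S) w
      (Path.Homotopic.Quotient.mk (γ.subpath (t 0) (t n))) := by
    intro n
    induction n with
    | zero =>
      rw [Path.subpath_self]
      intro i j hi hj
      exact tailLoop_refl hi hj
    | succ n ih =>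
      rw [← Path.Homotopic.Quotient.eq.2 ⟨Path.Homotopy.subpathTransSubpath γ (t 0) (t n) (t (n + 1))⟩,
        Path.Homotopic.Quotient.mk_trans]
      exact ih.trans (hstep n)
  have h1 := hall m
  rw [ht0, hm m le_rfl, Path.subpath_zero_one] at h1
  -- The subpath over the whole interval is the original path only up to a cast of the end points.
  have h2 : ∀ {a' b' : W} (ha : a' = a) (hb : b' = b),
      IsWalkable (S := S) w (Path.Homotopic.Quotient.mk (γ.cast ha hb)) →
      IsWalkable (S := S) w (Path.Homotopic.Quotient.mk γ) := by
    rintro _ _ rfl rfl h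
    exact h
  exact h2 _ _ h1

/-- Every element of the fundamental group is a product of edge elements along a walk between
any two given vertices. -/
theorem edgeWalk {i j : Fin S.N} (hi : ({i} : Finset (Fin S.N)) ∈ S.K)
    (hj : ({j} : Finset (Fin S.N)) ∈ S.K) (g : FundamentalGroup W w) : EdgeWalk S w i j g := by
  have hi' := (vertexPoint_mem_openStar_iff (S := S) hi).2 rfl
  have hj' := (vertexPoint_mem_openStar_iff (S := S) hj).2 rfl
  have h1 : ∀ γ : Path.Homotopic.Quotient (vertexPoint S hj) (vertexPoint S hi),
      EdgeWalk S w i j (tailLoop w hj' hi' γ) := by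
    intro γ
    induction γ using Quotient.inductionOn with
    | h γ => exact isWalkable γ j i hj' hi'
  let cj := Path.Homotopic.Quotient.mk (PathConnectedSpace.somePath w (vertexPoint S hj))
  let ci := Path.Homotopic.Quotient.mk (PathConnectedSpace.somePath w (vertexPoint S hi))
  let sj := Path.Homotopic.Quotient.mk (starSegment hj')
  let si := Path.Homotopic.Quotient.mk (starSegment hi')
  -- The path is chosen so that all the tails of its loop cancel, leaving `g`.
  have h2 := h1 (sj.trans (cj.symm.trans ((FundamentalGroup.toPath g).trans (ci.trans si.symm))))
  have h3 : tailLoop w hj' hi'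
      (sj.trans (cj.symm.trans ((FundamentalGroup.toPath g).trans (ci.trans si.symm)))) = g := by
    simp only [tailLoop, Path.Homotopic.Quotient.trans_assoc]
    change cj.trans (sj.symm.trans (sj.trans (cj.symm.trans ((FundamentalGroup.toPath g).trans
      (ci.trans (si.symm.trans (si.trans ci.symm))))))) = g
    rw [Path.Homotopic.Quotient.symm_trans_cancel_left,
      Path.Homotopic.Quotient.trans_symm_cancel_left,
      Path.Homotopic.Quotient.symm_trans_cancel_left, Path.Homotopic.Quotient.trans_symm,
      Path.Homotopic.Quotient.trans_refl]
  rwa [h3] at h2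

/-- A relation that propagates along edges propagates along edge walks. -/
theorem EdgeWalk.eq_smul {X : Type*} [MulAction (FundamentalGroup W w) X] {c : Fin S.N → X}
    (hc : ∀ i j, ({i, j} : Finset (Fin S.N)) ∈ S.K → c i = edgeElement S w i j • c j)
    {i j : Fin S.N} {g : FundamentalGroup W w} (h : EdgeWalk S w i j g) : c i = g • c j := by
  induction h with
  | nil i => rw [one_smul]
  | cons e _ ih => rw [mul_smul, hc _ _ e, ih]

end EdgeWalks

/-! ### Combinatorics of oriented triangulated surfaces: darts, faces, rotation. -/

section Combinatorics

variable {N : ℕ} {K : PreAbstractSimplicialComplex (Fin N)}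

/-- The vertices of a simplicial complex. -/
abbrev VertexOf (K : PreAbstractSimplicialComplex (Fin N)) : Type :=
  {i : Fin N // ({i} : Finset (Fin N)) ∈ K}

/-- The oriented edges of a simplicial complex. -/
abbrev Dart (K : PreAbstractSimplicialComplex (Fin N)) : Type :=
  {d : Fin N × Fin N // d.1 ≠ d.2 ∧ ({d.1, d.2} : Finset (Fin N)) ∈ K}

/-- The edges of a simplicial complex, oriented from the smaller to the larger end point. -/
abbrev EdgeOf (K : PreAbstractSimplicialComplex (Fin N)) : Type :=
  {e : Fin N × Fin N // e.1 < e.2 ∧ ({e.1, e.2} : Finset (Fin N)) ∈ K}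

/-- The opposite oriented edge. -/
def Dart.rev (d : Dart K) : Dart K :=
  ⟨(d.1.2, d.1.1), d.2.1.symm, by rw [Finset.pair_comm]; exact d.2.2⟩

@[simp] theorem Dart.rev_rev (d : Dart K) : d.rev.rev = d := rfl

/-- The source of an oriented edge. -/
def Dart.src (d : Dart K) : VertexOf K :=
  ⟨d.1.1, face_subset d.2.2 (by simp) (by simp)⟩

/-- An oriented edge is an edge with a choice of direction. -/
def edgeBoolEquiv (K : PreAbstractSimplicialComplex (Fin N)) : EdgeOf K × Bool ≃ Dart K where
  toFun p := if p.2 then ⟨p.1.1, p.1.2.1.ne, p.1.2.2⟩ else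
    Dart.rev ⟨p.1.1, p.1.2.1.ne, p.1.2.2⟩
  invFun d := if h : d.1.1 < d.1.2 then (⟨d.1, h, d.2.2⟩, true) else
    (⟨d.rev.1, lt_of_le_of_ne (not_lt.1 h) d.2.1.symm, d.rev.2.2⟩, false)
  left_inv := by
    rintro ⟨⟨⟨i, j⟩, hij, hK⟩, _ | _⟩
    · simp [Dart.rev, not_lt_of_gt hij]
    · simp [hij]
  right_inv := by
    rintro ⟨⟨i, j⟩, hij, hK⟩
    by_cases h : i < j <;> simp [h, Dart.rev]

namespace SurfaceOrientation

variable (o : SurfaceOrientation K)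

theorem sign_rotate (a b c : Fin N) : o.sign b c a = o.sign a b c := by
  rw [o.swap_right b a c, o.swap_left a b c, neg_neg]

theorem mem_of_sign_ne_zero {i j k : Fin N} (h : o.sign i j k ≠ 0) :
    ({i, j, k} : Finset (Fin N)) ∈ K ∧ ({i, j, k} : Finset (Fin N)).card = 3 := by
  by_contra h'
  exact h (o.sign_of_not i j k h')

theorem sign_eq_one_or {i j k : Fin N} (h : o.sign i j k ≠ 0) :
    o.sign i j k = 1 ∨ o.sign i j k = -1 :=
  o.sign_of_mem i j k (o.mem_of_sign_ne_zero h).1 (o.mem_of_sign_ne_zero h).2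

theorem ne_of_sign_ne_zero {i j k : Fin N} (h : o.sign i j k ≠ 0) : i ≠ j ∧ i ≠ k ∧ j ≠ k := by
  refine ⟨?_, ?_, ?_⟩ <;> rintro rfl
  · have := o.swap_left i i k
    omega
  · have h1 := o.sign_rotate i j i
    have h2 := o.swap_right j i i
    omega
  · have := o.swap_right i j j
    omega

theorem sign_ne_zero {i j k : Fin N} (h : ({i, j, k} : Finset (Fin N)) ∈ K) (hij : i ≠ j)
    (hik : i ≠ k) (hjk : j ≠ k) : o.sign i j k = 1 ∨ o.sign i j k = -1 :=
  o.sign_of_mem i j k h (Finset.card_eq_three.2 ⟨i, j, k, hij, hik, hjk, rfl⟩)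

/-- Exactly two triangles contain the edge, and the cycle condition gives them opposite signs, so
one of them is positive. -/
theorem existsUnique_third (hK : IsClosedSurface K) (d : Dart K) :
    ∃! k, o.sign d.1.1 d.1.2 k = 1 := by
  obtain ⟨⟨u, v⟩, huv, he⟩ := d
  change ∃! k, o.sign u v k = 1
  have hcard := hK.edge {u, v} he (Finset.card_pair huv)
  -- Triangles at the edge are counted by their third vertices, which are the indices with nonzero
  -- sign.
  have himg : {t : Finset (Fin N) | t ∈ K ∧ ({u, v} : Finset (Fin N)) ⊆ t ∧ t.card = 3} =
      (fun k => ({u, v, k} : Finset (Fin N))) '' {k | o.sign u v k ≠ 0} := by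
    ext t
    constructor
    · rintro ⟨htK, hsub, ht⟩
      have h1 : (t \ {u, v}).card = 1 := by
        rw [Finset.card_sdiff_of_subset hsub, ht, Finset.card_pair huv]
      obtain ⟨k, hk⟩ := Finset.card_eq_one.1 h1
      have h2 : ({u, v, k} : Finset (Fin N)) = t := by
        rw [← Finset.union_sdiff_of_subset hsub, hk]
        ext x; simp
      refine ⟨k, ?_, h2⟩
      have := o.sign_of_mem u v k (h2 ▸ htK) (h2 ▸ ht)
      rcases this with h | h <;> simp [h]
    · rintro ⟨k, hk, rfl⟩
      have := o.mem_of_sign_ne_zero hk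
      exact ⟨this.1, by intro x; simp; tauto, this.2⟩
  have hinj : Set.InjOn (fun k => ({u, v, k} : Finset (Fin N))) {k | o.sign u v k ≠ 0} := by
    intro k hk k' _ h
    have h1 := o.ne_of_sign_ne_zero hk
    have h2 : k ∈ ({u, v, k'} : Finset (Fin N)) := by
      rw [← show ({u, v, k} : Finset (Fin N)) = {u, v, k'} from h]; simp
    simp only [Finset.mem_insert, Finset.mem_singleton] at h2
    rcases h2 with h2 | h2 | h2
    · exact absurd h2.symm h1.2.1
    · exact absurd h2.symm h1.2.2
    · exact h2
  rw [himg, hinj.ncard_image] at hcard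
  obtain ⟨a, b, hab, hS⟩ := Set.ncard_eq_two.1 hcard
  have hmem : ∀ k, o.sign u v k ≠ 0 ↔ k = a ∨ k = b := fun k => by
    have := Set.ext_iff.1 hS k
    simpa using this
  have hsum : o.sign u v a + o.sign u v b = 0 := by
    rw [← o.cycle u v, ← Finset.sum_pair hab]
    refine Finset.sum_subset (Finset.subset_univ _) fun k _ hk => ?_
    by_contra h
    exact hk (by simpa using (hmem k).1 h)
  have h0 : ∀ k, o.sign u v k = 1 → k = a ∨ k = b := fun k h => (hmem k).1 (by simp [h])
  rcases o.sign_eq_one_or ((hmem a).2 (Or.inl rfl)) with h | h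
  · refine ⟨a, h, fun k hk => (h0 k hk).resolve_right ?_⟩
    rintro rfl
    change o.sign u v k = 1 at hk
    omega
  · refine ⟨b, by change o.sign u v b = 1; omega, fun k hk => (h0 k hk).resolve_left ?_⟩
    rintro rfl
    change o.sign u v k = 1 at hk
    omega

/-- The positively oriented triangles, with the smallest vertex first. -/
abbrev Face (o : SurfaceOrientation K) : Type :=
  {f : Fin N × Fin N × Fin N // o.sign f.1 f.2.1 f.2.2 = 1 ∧ f.1 < f.2.1 ∧ f.1 < f.2.2}

/-- The oriented edge of a positively oriented triple of vertices. -/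
def dartOf {u v w : Fin N} (h : o.sign u v w = 1) : Dart K :=
  ⟨(u, v), (o.ne_of_sign_ne_zero (k := w) (by simp [h])).1,
    face_subset (o.mem_of_sign_ne_zero (i := u) (j := v) (k := w) (by simp [h])).1
      (by intro x; simp; tauto) (by simp)⟩

/-- The sides of a positively oriented triangle. -/
def side (p : o.Face × Fin 3) : Dart K :=
  ![o.dartOf p.1.2.1, o.dartOf ((o.sign_rotate _ _ _).trans p.1.2.1),
    o.dartOf ((o.sign_rotate _ _ _).trans ((o.sign_rotate _ _ _).trans p.1.2.1))] p.2

variable (hK : IsClosedSurface K)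

/-- The third vertex of the positively oriented triangle at an oriented edge. -/
def third (d : Dart K) : Fin N := (o.existsUnique_third hK d).choose

theorem sign_third (d : Dart K) : o.sign d.1.1 d.1.2 (o.third hK d) = 1 :=
  (o.existsUnique_third hK d).choose_spec.1

theorem third_eq {d : Dart K} {k : Fin N} (h : o.sign d.1.1 d.1.2 k = 1) : o.third hK d = k :=
  ((o.existsUnique_third hK d).choose_spec.2 k h).symm

/-- The next oriented edge in the positively oriented triangle at an oriented edge. -/
def next (d : Dart K) : Dart K := o.dartOf ((o.sign_rotate _ _ _).trans (o.sign_third hK d))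

theorem next_dartOf {u v w : Fin N} (h : o.sign u v w = 1) :
    o.next hK (o.dartOf h) = o.dartOf ((o.sign_rotate _ _ _).trans h) := by
  ext1
  exact Prod.ext rfl (o.third_eq hK (d := o.dartOf h) h)

theorem next_side (f : o.Face) (m : Fin 3) : o.next hK (o.side (f, m)) = o.side (f, m + 1) := by
  fin_cases m
  · exact o.next_dartOf hK f.2.1
  · exact o.next_dartOf hK ((o.sign_rotate _ _ _).trans f.2.1)
  · exact o.next_dartOf hK ((o.sign_rotate _ _ _).trans ((o.sign_rotate _ _ _).trans f.2.1))

theorem next_next_next (d : Dart K) : o.next hK (o.next hK (o.next hK d)) = d := by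
  have h : o.dartOf (o.sign_third hK d) = d := Subtype.ext (Prod.ext rfl rfl)
  rw [← h, next_dartOf, next_dartOf, next_dartOf]

/-- A dart determines its positive triangle through the third vertex. Its position among the sides
is determined because the smallest vertex of the triangle comes first. -/
theorem side_bijective (hK : IsClosedSurface K) : Function.Bijective o.side := by
  constructor
  · rintro ⟨⟨⟨u, v, w⟩, hs, h1, h2⟩, m⟩ ⟨⟨⟨u', v', w'⟩, hs', h1', h2'⟩, m'⟩ h
    have hn := congrArg (o.next hK) h
    rw [next_side, next_side] at hn
    have h := congrArg (fun d : Dart K => d.1.1) h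
    have hn' := congrArg (fun d : Dart K => d.1.1) hn
    have hn'' := congrArg (fun d : Dart K => d.1.2) hn
    dsimp only at hs h1 h2 hs' h1' h2'
    -- Equal positions give equal triangles; distinct positions contradict minimality of the first
    -- vertex.
    fin_cases m <;> fin_cases m' <;> simp [side, dartOf] at h hn' hn'' <;>
      first
      | (subst h; subst hn'; subst hn''; rfl)
      | (exfalso; subst h; subst hn'; subst hn''; exact lt_asymm h1 (by assumption))
      | (exfalso; subst h; subst hn'; subst hn''; exact lt_asymm h2 (by assumption))
  · intro d
    have hs := o.sign_third hK d
    have hd : d = o.dartOf hs := rfl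
    have hne := o.ne_of_sign_ne_zero (i := d.1.1) (j := d.1.2) (k := o.third hK d) (by simp [hs])
    rw [hd]
    generalize o.third hK d = w at *
    obtain ⟨⟨u, v⟩, hd'⟩ := d
    dsimp only at hs hne
    rcases lt_or_gt_of_ne hne.1 with h1 | h1
    · rcases lt_or_gt_of_ne hne.2.1 with h2 | h2
      · exact ⟨(⟨(u, v, w), hs, h1, h2⟩, 0), rfl⟩
      · exact ⟨(⟨(w, u, v), by rw [← hs, o.sign_rotate w u v], h2, h2.trans h1⟩, 1), rfl⟩
    · rcases lt_or_gt_of_ne hne.2.2 with h2 | h2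
      · exact ⟨(⟨(v, w, u), by rw [o.sign_rotate u v w, hs], h2, h1⟩, 2), rfl⟩
      · exact ⟨(⟨(w, u, v), by rw [← hs, o.sign_rotate w u v], h2.trans h1, h2⟩, 1), rfl⟩

/-- Every oriented edge is a side of exactly one positively oriented triangle. -/
def sideEquiv : o.Face × Fin 3 ≃ Dart K := Equiv.ofBijective o.side (o.side_bijective hK)

/-- A function on oriented edges that is invariant under rotation about the source depends only on
the source. -/
theorem eq_of_src_eq {X : Type*} (l : Dart K → X)
    (hl : ∀ d, l d = l (o.next hK d.rev)) {d d' : Dart K} (h : d.src = d'.src) : l d = l d' := by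
  obtain ⟨⟨v, a⟩, hva, ha⟩ := d
  obtain ⟨⟨v', b⟩, hvb, hb⟩ := d'
  obtain rfl : v = v' := congrArg Subtype.val h
  have hconn := hK.link v (face_subset ha (by simp) (by simp))
  let m (x : {u : Fin N // u ≠ v ∧ ({v, u} : Finset (Fin N)) ∈ K}) : X :=
    l ⟨(v, x.1), x.2.1.symm, x.2.2⟩
  -- When (x, v, y) is positive, rotation about v carries the dart towards x to the dart towards y.
  have hstep : ∀ x y, o.sign x.1 v y.1 = 1 → m x = m y := by
    intro x y hxy
    change l _ = l _
    rw [hl]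
    congr 1
    exact Subtype.ext (Prod.ext rfl (o.third_eq hK (d := Dart.rev ⟨(v, x.1), _⟩) hxy))
  -- Neighbours joined in the link are related by a rotation in one of the two directions, according
  -- to the sign; connectedness of the link does the rest.
  have hadj : ∀ x y, (linkGraph K v).Adj x y → m x = m y := by
    rintro x y ⟨hxy, hf⟩
    have h1 : o.sign x.1 v y.1 = 1 ∨ o.sign x.1 v y.1 = -1 :=
      o.sign_ne_zero (by rw [Finset.insert_comm]; exact hf) x.2.1
        (fun h => hxy (Subtype.ext h)) y.2.1.symm
    rcases h1 with h1 | h1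
    · exact hstep x y h1
    · refine (hstep y x ?_).symm
      rw [o.swap_left v y.1 x.1, o.sign_rotate x.1 v y.1, h1, neg_neg]
  have hreach : ∀ x y, (linkGraph K v).Reachable x y → m x = m y := by
    rintro x y ⟨p⟩
    induction p with
    | nil => rfl
    | cons hxy _ ih => exact (hadj _ _ hxy).trans ih
  exact hreach ⟨a, Ne.symm hva, ha⟩ ⟨b, Ne.symm hvb, hb⟩ (hconn.preconnected _ _)

theorem exists_dart (hK : IsClosedSurface K) (v : VertexOf K) : ∃ d : Dart K, d.src = v := by
  obtain ⟨t, ht, hvt, hcard⟩ := hK.pure _ v.2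
  have hv : v.1 ∈ t := hvt (Finset.mem_singleton_self _)
  obtain ⟨a, ha, hav⟩ := Finset.exists_mem_ne (by omega : 1 < t.card) v.1
  refine ⟨⟨(v.1, a), hav.symm, face_subset ht ?_ (by simp)⟩, rfl⟩
  intro x hx
  rcases Finset.mem_insert.1 hx with rfl | hx
  · exact hv
  · rwa [Finset.mem_singleton.1 hx]

/-- Functions on oriented edges that are invariant under rotation about the source are functions
of the source. -/
theorem card_rotation_invariant (X : Type*) :
    Nat.card {l : Dart K → X // ∀ d, l d = l (o.next hK d.rev)} =
      Nat.card (VertexOf K → X) := by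
  refine (Nat.card_congr (Equiv.ofBijective (fun g => ⟨fun d => g d.src, fun d => rfl⟩) ⟨?_, ?_⟩)).symm
  · intro g g' h
    funext v
    obtain ⟨d, rfl⟩ := exists_dart hK v
    exact congrFun (congrArg Subtype.val h) d
  · rintro ⟨l, hl⟩
    refine ⟨fun v => l (exists_dart hK v).choose, Subtype.ext (funext fun d => ?_)⟩
    exact o.eq_of_src_eq hK l hl (exists_dart hK d.src).choose_spec

/-- Of the two orderings of a triangle with smallest vertex first, exactly one is positive. -/
theorem face_bijective : Function.Bijective (fun f : o.Face =>
    (⟨{f.1.1, f.1.2.1, f.1.2.2}, o.mem_of_sign_ne_zero (by rw [f.2.1]; exact one_ne_zero)⟩ :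
      {s : Finset (Fin N) // s ∈ K ∧ s.card = 3})) := by
  constructor
  · rintro ⟨⟨u, v, w⟩, hs, h1, h2⟩ ⟨⟨u', v', w'⟩, hs', h1', h2'⟩ h
    have hset : ({u, v, w} : Finset (Fin N)) = {u', v', w'} := congrArg Subtype.val h
    dsimp only at hs h1 h2 hs' h1' h2'
    have hu : u ∈ ({u', v', w'} : Finset (Fin N)) := hset ▸ by simp
    have hv : v ∈ ({u', v', w'} : Finset (Fin N)) := hset ▸ by simp
    have hw : w ∈ ({u', v', w'} : Finset (Fin N)) := hset ▸ by simp
    have hu' : u' ∈ ({u, v, w} : Finset (Fin N)) := hset.symm ▸ by simp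
    simp only [Finset.mem_insert, Finset.mem_singleton] at hu hv hw hu'
    have hvw := (o.ne_of_sign_ne_zero (i := u) (j := v) (k := w) (by simp [hs])).2.2
    obtain rfl : u = u' := by omega
    have hcase : v = v' ∧ w = w' ∨ v = w' ∧ w = v' := by omega
    rcases hcase with ⟨rfl, rfl⟩ | ⟨rfl, rfl⟩
    · rfl
    · have := o.swap_right u v w
      omega
  · rintro ⟨s, hs, hcard⟩
    have hne : s.Nonempty := Finset.card_pos.1 (by omega)
    have hi := s.min'_mem hne
    set i := s.min' hne with hidef
    have h2 : (s.erase i).card = 2 := by rw [Finset.card_erase_of_mem hi, hcard]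
    obtain ⟨j, k, hjk, hjk'⟩ := Finset.card_eq_two.1 h2
    have hlt : ∀ x ∈ s.erase i, i < x := fun x hx =>
      lt_of_le_of_ne (s.min'_le x (Finset.mem_of_mem_erase hx)) (Finset.ne_of_mem_erase hx).symm
    have hij : i < j := hlt j (by simp [hjk'])
    have hik : i < k := hlt k (by simp [hjk'])
    have hset : ({i, j, k} : Finset (Fin N)) = s := by rw [← hjk', Finset.insert_erase hi]
    rcases o.sign_ne_zero (hset ▸ hs) hij.ne hik.ne hjk with h | h
    · exact ⟨⟨(i, j, k), h, hij, hik⟩, Subtype.ext hset⟩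
    · refine ⟨⟨(i, k, j), by rw [o.swap_right, h, neg_neg], hik, hij⟩, Subtype.ext ?_⟩
      exact (congrArg (insert i) (Finset.pair_comm k j)).trans hset

end SurfaceOrientation

theorem vertexOf_bijective : Function.Bijective (fun v : VertexOf K =>
    (⟨{v.1}, v.2, Finset.card_singleton v.1⟩ : {s : Finset (Fin N) // s ∈ K ∧ s.card = 1})) := by
  constructor
  · intro v v' h
    exact Subtype.ext (Finset.singleton_injective (congrArg Subtype.val h))
  · rintro ⟨s, hs, hcard⟩
    obtain ⟨a, rfl⟩ := Finset.card_eq_one.1 hcard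
    exact ⟨⟨a, hs⟩, rfl⟩

theorem edgeOf_bijective : Function.Bijective (fun e : EdgeOf K =>
    (⟨{e.1.1, e.1.2}, e.2.2, Finset.card_pair e.2.1.ne⟩ :
      {s : Finset (Fin N) // s ∈ K ∧ s.card = 2})) := by
  constructor
  · rintro ⟨⟨u, v⟩, huv, h1⟩ ⟨⟨u', v'⟩, huv', h1'⟩ h
    have hset : ({u, v} : Finset (Fin N)) = {u', v'} := congrArg Subtype.val h
    dsimp only at huv huv'
    have hu : u ∈ ({u', v'} : Finset (Fin N)) := hset ▸ by simp
    have hv : v ∈ ({u', v'} : Finset (Fin N)) := hset ▸ by simp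
    simp only [Finset.mem_insert, Finset.mem_singleton] at hu hv
    obtain rfl : u = u' := by omega
    obtain rfl : v = v' := by omega
    rfl
  · rintro ⟨s, hs, hcard⟩
    obtain ⟨a, b, hab, rfl⟩ := Finset.card_eq_two.1 hcard
    rcases lt_or_gt_of_ne hab with h | h
    · exact ⟨⟨(a, b), h, hs⟩, rfl⟩
    · exact ⟨⟨(b, a), h, by rw [Finset.pair_comm]; exact hs⟩, Subtype.ext (Finset.pair_comm b a)⟩

theorem ClosedOrientedSurface.eulerChar_eq {W : Type*} [TopologicalSpace W]
    (S : ClosedOrientedSurface W) : S.eulerChar =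
      (Nat.card (VertexOf S.K) : ℤ) - Nat.card (EdgeOf S.K) + Nat.card S.orientation.Face := by
  rw [ClosedOrientedSurface.eulerChar,
    Nat.card_congr (Equiv.ofBijective _ (vertexOf_bijective (K := S.K))),
    Nat.card_congr (Equiv.ofBijective _ (edgeOf_bijective (K := S.K))),
    Nat.card_congr (Equiv.ofBijective _ S.orientation.face_bijective)]
  rfl

end Combinatorics

/-! ### Lifts of the edge elements, their holonomy and flatness. -/

section Connections

variable {W : Type*} [TopologicalSpace W] {S : ClosedOrientedSurface W} [PathConnectedSpace W]
  {w : W}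

theorem edgeElement_self {i : Fin S.N} (hi : ({i} : Finset (Fin S.N)) ∈ S.K) :
    edgeElement S w i i = 1 :=
  mul_eq_left.1 (edgeElement_mul S w (i := i) (j := i) (k := i) (by simpa using hi))

theorem edgeElement_symm {i j : Fin S.N} (h : ({i, j} : Finset (Fin S.N)) ∈ S.K) :
    edgeElement S w j i = (edgeElement S w i j)⁻¹ := by
  rw [eq_comm, inv_eq_iff_mul_eq_one, ← edgeElement_self (w := w) (vertex_mem S h (pair_mem_left i j))]
  exact edgeElement_mul S w (i := i) (j := j) (k := i) (by
    rw [show ({i, j, i} : Finset (Fin S.N)) = {i, j} by ext x; simp; tauto]; exact h)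

/-- Two homomorphisms that are gauge equivalent on the edges are conjugate. -/
theorem eq_conj_of_edgeElement {H : Type*} [Group H] {f f' : FundamentalGroup W w →* H}
    {c : VertexOf S.K → H} (hc : ∀ d : Dart S.K, f' (edgeElement S w d.1.1 d.1.2) =
      c d.src * f (edgeElement S w d.1.1 d.1.2) * (c d.rev.src)⁻¹)
    (i j : VertexOf S.K) (g : FundamentalGroup W w) : f' g = c i * f g * (c j)⁻¹ := by
  -- Along an edge walk the gauge factors at the intermediate vertices telescope.
  have key : ∀ {i j : Fin S.N} {g : FundamentalGroup W w}, EdgeWalk S w i j g →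
      ∀ (hi : ({i} : Finset (Fin S.N)) ∈ S.K) (hj : ({j} : Finset (Fin S.N)) ∈ S.K),
        f' g = c ⟨i, hi⟩ * f g * (c ⟨j, hj⟩)⁻¹ := by
    intro i j g h
    induction h with
    | nil i => intro hi hj; rw [map_one, map_one, mul_one, mul_inv_cancel]
    | @cons i j k g e _ ih =>
      intro hi hk
      have hj := vertex_mem S e (pair_mem_right i j)
      have h1 : f' (edgeElement S w i j) =
          c ⟨i, hi⟩ * f (edgeElement S w i j) * (c ⟨j, hj⟩)⁻¹ := by
        by_cases hij : i = j
        · subst hij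
          rw [edgeElement_self hi, map_one, map_one, mul_one, mul_inv_cancel]
        · exact hc ⟨(i, j), hij, e⟩
      rw [map_mul, map_mul, h1, ih hj hk]
      group
  exact key (edgeWalk i.2 j.2 g) i.2 j.2

/-- The edge element of an oriented edge. -/
def dartElement (w : W) (d : Dart S.K) : FundamentalGroup W w := edgeElement S w d.1.1 d.1.2

theorem dartElement_rev (d : Dart S.K) : dartElement w d.rev = (dartElement w d)⁻¹ :=
  edgeElement_symm d.2.2

theorem edgeElement_mul_of_sign {i j k : Fin S.N} (h : S.orientation.sign i j k ≠ 0) :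
    edgeElement S w i j * edgeElement S w j k = edgeElement S w i k :=
  edgeElement_mul S w (S.orientation.mem_of_sign_ne_zero h).1

theorem dartElement_triangle (d : Dart S.K) :
    dartElement w d * dartElement w (S.orientation.next S.closed d) *
      dartElement w (S.orientation.next S.closed (S.orientation.next S.closed d)) = 1 := by
  have hs := S.orientation.sign_third S.closed d
  have hd : d = S.orientation.dartOf hs := Subtype.ext (Prod.ext rfl rfl)
  rw [hd, S.orientation.next_dartOf, S.orientation.next_dartOf]
  change edgeElement S w d.1.1 d.1.2 * edgeElement S w d.1.2 (S.orientation.third S.closed d) *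
    edgeElement S w (S.orientation.third S.closed d) d.1.1 = 1
  rw [edgeElement_mul_of_sign (by rw [hs]; exact one_ne_zero), ← edgeElement_self (w := w) d.src.2]
  refine edgeElement_mul S w ?_
  rw [show ({d.1.1, S.orientation.third S.closed d, d.1.1} : Finset (Fin S.N)) =
    {S.orientation.third S.closed d, d.1.1} by ext x; simp]
  refine face_subset (S.orientation.mem_of_sign_ne_zero
    (i := d.1.1) (j := d.1.2) (k := S.orientation.third S.closed d) (by rw [hs]; exact one_ne_zero)).1
    ?_ (by simp)
  intro x hx
  simp only [Finset.mem_insert, Finset.mem_singleton] at hx ⊢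
  tauto

variable {G' : Type*} [Group G'] {p : G' →* FundamentalGroup W w} (hp : Function.Surjective p)

/-- A chosen lift of the edge element of an edge. -/
def edgeLift (e : EdgeOf S.K) : G' := Function.surjInv hp (edgeElement S w e.1.1 e.1.2)

theorem map_edgeLift (e : EdgeOf S.K) : p (edgeLift hp e) = edgeElement S w e.1.1 e.1.2 :=
  Function.surjInv_eq hp _

/-- The lift of the edge elements determined by a function on the edges with values in the
kernel. -/
def connection (h : EdgeOf S.K → p.ker) (d : Dart S.K) : G' :=
  if ((edgeBoolEquiv S.K).symm d).2 then
    edgeLift hp ((edgeBoolEquiv S.K).symm d).1 * h ((edgeBoolEquiv S.K).symm d).1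
  else (edgeLift hp ((edgeBoolEquiv S.K).symm d).1 * h ((edgeBoolEquiv S.K).symm d).1)⁻¹

theorem connection_true (h : EdgeOf S.K → p.ker) (e : EdgeOf S.K) :
    connection hp h (edgeBoolEquiv S.K (e, true)) = edgeLift hp e * h e := by
  simp [connection]

theorem connection_false (h : EdgeOf S.K → p.ker) (e : EdgeOf S.K) :
    connection hp h (edgeBoolEquiv S.K (e, false)) = (edgeLift hp e * h e)⁻¹ := by
  rw [connection, Equiv.symm_apply_apply]
  rfl

theorem edgeBoolEquiv_rev (e : EdgeOf S.K) (b : Bool) :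
    (edgeBoolEquiv S.K (e, b)).rev = edgeBoolEquiv S.K (e, !b) := by
  cases b <;> rfl

theorem connection_rev (h : EdgeOf S.K → p.ker) (d : Dart S.K) :
    connection hp h d.rev = (connection hp h d)⁻¹ := by
  obtain ⟨⟨e, _ | _⟩, rfl⟩ := (edgeBoolEquiv S.K).surjective d
  · rw [edgeBoolEquiv_rev, connection_false, inv_inv]
    exact connection_true hp h e
  · rw [edgeBoolEquiv_rev, connection_true]
    exact connection_false hp h e

theorem map_connection (h : EdgeOf S.K → p.ker) (d : Dart S.K) :
    p (connection hp h d) = dartElement w d := by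
  have h1 : ∀ e, p (edgeLift hp e * h e) = edgeElement S w e.1.1 e.1.2 := fun e => by
    rw [map_mul, map_edgeLift, (h e).2, mul_one]
  obtain ⟨⟨e, _ | _⟩, rfl⟩ := (edgeBoolEquiv S.K).surjective d
  · rw [connection_false, map_inv, h1, ← edgeElement_symm e.2.2]
    rfl
  · rw [connection_true, h1]
    rfl

theorem connection_injective : Function.Injective (connection (S := S) hp) := by
  intro h h' hh
  funext e
  have := congrFun hh (edgeBoolEquiv S.K (e, true))
  rw [connection_true, connection_true] at this
  exact Subtype.ext (mul_left_cancel this)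

/-- Two lifts of an edge element differ by a kernel element, and reversal fixes the value on the
opposite dart; so functions on edges parametrise all such lifts. -/
theorem exists_connection_eq {x : Dart S.K → G'} (hx : ∀ d, p (x d) = dartElement w d)
    (hr : ∀ d, x d.rev = (x d)⁻¹) : ∃ h, connection hp h = x := by
  refine ⟨fun e => ⟨(edgeLift hp e)⁻¹ * x (edgeBoolEquiv S.K (e, true)), ?_⟩, funext fun d => ?_⟩
  · rw [MonoidHom.mem_ker, map_mul, map_inv, map_edgeLift, hx]
    exact inv_mul_cancel _
  · obtain ⟨⟨e, _ | _⟩, rfl⟩ := (edgeBoolEquiv S.K).surjective d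
    · rw [connection_false]
      have := hr (edgeBoolEquiv S.K (e, true))
      rw [edgeBoolEquiv_rev] at this
      exact ((congrArg (·⁻¹) (mul_inv_cancel_left _ _)).trans this.symm)
    · rw [connection_true]
      exact mul_inv_cancel_left _ _

/-- The holonomy of a connection around the positively oriented triangle at an oriented edge. -/
def holonomy (h : EdgeOf S.K → p.ker) (d : Dart S.K) : p.ker :=
  ⟨connection hp h d * connection hp h (S.orientation.next S.closed d) *
      connection hp h (S.orientation.next S.closed (S.orientation.next S.closed d)), by
    rw [MonoidHom.mem_ker, map_mul, map_mul, map_connection, map_connection, map_connection,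
      dartElement_triangle]⟩

/-- Starting from the next side permutes the three factors cyclically, which is a conjugation. -/
theorem coe_holonomy_next (h : EdgeOf S.K → p.ker) (d : Dart S.K) :
    (holonomy hp h (S.orientation.next S.closed d) : G') =
      (connection hp h d)⁻¹ * holonomy hp h d * connection hp h d := by
  simp only [holonomy, S.orientation.next_next_next]
  group

/-- A connection is flat if its holonomy around all triangles is trivial. -/
def IsFlatConnection (h : EdgeOf S.K → p.ker) : Prop :=
  ∀ f : S.orientation.Face, holonomy hp h (S.orientation.side (f, 0)) = 1

theorem holonomy_next_eq_one {h : EdgeOf S.K → p.ker} {d : Dart S.K}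
    (hd : holonomy hp h d = 1) : holonomy hp h (S.orientation.next S.closed d) = 1 := by
  ext1
  rw [coe_holonomy_next, hd]
  simp

theorem IsFlatConnection.holonomy_eq_one {h : EdgeOf S.K → p.ker} (hh : IsFlatConnection hp h)
    (d : Dart S.K) : holonomy hp h d = 1 := by
  obtain ⟨⟨f, m⟩, rfl⟩ := (S.orientation.side_bijective S.closed).2 d
  have h0 := hh f
  have h1 := holonomy_next_eq_one hp h0
  have h2 := holonomy_next_eq_one hp h1
  rw [S.orientation.next_side] at h1
  rw [S.orientation.next_side, S.orientation.next_side] at h2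
  fin_cases m
  · exact h0
  · exact h1
  · exact h2

open Classical in
/-- A connection as a function of pairs of vertices. -/
def connectionMatrix (h : EdgeOf S.K → p.ker) (i j : Fin S.N) : G' :=
  if hd : i ≠ j ∧ ({i, j} : Finset (Fin S.N)) ∈ S.K then connection hp h ⟨(i, j), hd⟩ else 1

theorem connectionMatrix_dart (h : EdgeOf S.K → p.ker) (d : Dart S.K) :
    connectionMatrix hp h d.1.1 d.1.2 = connection hp h d := dif_pos d.2

theorem connectionMatrix_self (h : EdgeOf S.K → p.ker) (i : Fin S.N) :
    connectionMatrix hp h i i = 1 := dif_neg fun h => h.1 rfl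

theorem connectionMatrix_symm (h : EdgeOf S.K → p.ker) (i j : Fin S.N) :
    connectionMatrix hp h j i = (connectionMatrix hp h i j)⁻¹ := by
  by_cases hd : i ≠ j ∧ ({i, j} : Finset (Fin S.N)) ∈ S.K
  · have h1 := connectionMatrix_dart hp h ⟨(i, j), hd⟩
    have h2 := connectionMatrix_dart hp h (Dart.rev ⟨(i, j), hd⟩)
    rw [connection_rev, ← h1] at h2
    exact h2
  · have hd' : ¬ (j ≠ i ∧ ({j, i} : Finset (Fin S.N)) ∈ S.K) := by
      rw [Finset.pair_comm, ne_comm]; exact hd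
    rw [connectionMatrix, connectionMatrix, dif_neg hd, dif_neg hd', inv_one]

theorem IsFlatConnection.isFlat {h : EdgeOf S.K → p.ker} (hh : IsFlatConnection hp h) :
    IsFlat S (connectionMatrix hp h) := by
  -- Positive triples suffice: degenerate ones follow from the values on the diagonal and under
  -- reversal, and negative ones become positive after a transposition.
  have key : ∀ i j k, S.orientation.sign i j k = 1 →
      connectionMatrix hp h i j * connectionMatrix hp h j k * connectionMatrix hp h k i = 1 := by
    intro i j k hs
    have h1 := congrArg Subtype.val (hh.holonomy_eq_one hp (S.orientation.dartOf hs))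
    simp only [holonomy, S.orientation.next_dartOf] at h1
    simp only [← connectionMatrix_dart] at h1
    exact h1
  intro i j k hK
  by_cases hij : i = j
  · subst hij; rw [connectionMatrix_self, one_mul]
  by_cases hjk : j = k
  · subst hjk; rw [connectionMatrix_self, mul_one]
  by_cases hik : i = k
  · subst hik; rw [connectionMatrix_self, connectionMatrix_symm hp h i j, mul_inv_cancel]
  rcases S.orientation.sign_ne_zero hK hij hik hjk with h1 | h1
  · have := key i j k h1
    rwa [connectionMatrix_symm hp h i k, mul_inv_eq_one] at this
  · have := key i k j (by rw [S.orientation.swap_right, h1, neg_neg])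
    rw [connectionMatrix_symm hp h i j, mul_inv_eq_one, connectionMatrix_symm hp h j k,
      mul_inv_eq_iff_eq_mul] at this
    exact this.symm

end Connections

/-! ### Sections with gauge transformations and flat connections. -/

section CountSections

variable {W : Type*} [TopologicalSpace W] {S : ClosedOrientedSurface W} [PathConnectedSpace W]
  {w : W} {G' : Type*} [Group G'] {p : G' →* FundamentalGroup W w} (hp : Function.Surjective p)

theorem map_groupSections (s : groupSections p) (g : FundamentalGroup W w) : p (s.1 g) = g :=
  DFunLike.congr_fun s.2 g

theorem exists_connection_of_section (s : groupSections p) (g : VertexOf S.K → p.ker) :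
    ∃ h : EdgeOf S.K → p.ker, connection hp h =
      fun d => (g d.src : G') * s.1 (dartElement w d) * (g d.rev.src : G')⁻¹ := by
  refine exists_connection_eq hp (fun d => ?_) fun d => ?_
  · rw [map_mul, map_mul, map_inv, (g d.src).2, (g d.rev.src).2, map_groupSections, one_mul,
      inv_one, mul_one]
  · rw [dartElement_rev, map_inv, Dart.rev_rev]
    group

/-- The connection obtained from a section by a gauge transformation. -/
def sectionConnection (s : groupSections p) (g : VertexOf S.K → p.ker) : EdgeOf S.K → p.ker :=
  (exists_connection_of_section hp s g).choose

theorem connection_sectionConnection (s : groupSections p) (g : VertexOf S.K → p.ker)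
    (d : Dart S.K) : connection hp (sectionConnection hp s g) d =
      (g d.src : G') * s.1 (dartElement w d) * (g d.rev.src : G')⁻¹ :=
  congrFun (exists_connection_of_section hp s g).choose_spec d

theorem src_next (d : Dart S.K) : (S.orientation.next S.closed d).src = d.rev.src := rfl

/-- Gauge factors telescope round a triangle, and a homomorphism respects the triangle relation. -/
theorem isFlatConnection_sectionConnection (s : groupSections p) (g : VertexOf S.K → p.ker) :
    IsFlatConnection hp (sectionConnection hp s g) := by
  intro f
  generalize S.orientation.side (f, 0) = d
  ext1
  simp only [holonomy, connection_sectionConnection, src_next]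
  have h1 : (S.orientation.next S.closed (S.orientation.next S.closed d)).rev.src = d.src := by
    rw [← src_next, S.orientation.next_next_next]
  have h2 := congrArg s.1 (dartElement_triangle (w := w) d)
  rw [map_mul, map_mul, map_one, mul_assoc] at h2
  rw [h1]
  have h3 := eq_inv_of_mul_eq_one_left h2
  rw [h3, OneMemClass.coe_one]
  group

/-- A section together with a gauge transformation amounts to a flat connection together with an
element of the kernel. -/
theorem sectionConnection_bijective (v : VertexOf S.K) : Function.Bijective
    (fun q : groupSections p × (VertexOf S.K → p.ker) =>
      ((⟨sectionConnection hp q.1 q.2, isFlatConnection_sectionConnection hp q.1 q.2⟩, q.2 v) :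
        {h : EdgeOf S.K → p.ker // IsFlatConnection hp h} × p.ker)) := by
  constructor
  · rintro ⟨s, g⟩ ⟨s', g'⟩ h
    have h1 : sectionConnection hp s g = sectionConnection hp s' g' :=
      congrArg Subtype.val (Prod.ext_iff.1 h).1
    have hv : g v = g' v := (Prod.ext_iff.1 h).2
    have h2 : ∀ d : Dart S.K, s'.1 (dartElement w d) =
        (((g' d.src)⁻¹ * g d.src : p.ker) : G') * s.1 (dartElement w d) *
          (((g' d.rev.src)⁻¹ * g d.rev.src : p.ker) : G')⁻¹ := by
      intro d
      have h3 := connection_sectionConnection hp s g d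
      rw [h1, connection_sectionConnection] at h3
      have h4 : s'.1 (dartElement w d) = (g' d.src : G')⁻¹ *
          ((g' d.src : G') * s'.1 (dartElement w d) * (g' d.rev.src : G')⁻¹) *
            (g' d.rev.src : G') := by group
      rw [h4, h3, Subgroup.coe_mul, Subgroup.coe_mul, Subgroup.coe_inv, Subgroup.coe_inv]
      group
    have h5 := eq_conj_of_edgeElement (c := fun i => (((g' i)⁻¹ * g i : p.ker) : G')) h2
    -- At the identity element the conjugation formula says that the relative gauge is constant, and
    -- it is trivial at `v`.
    have hg : g = g' := by
      funext i
      have := h5 i v 1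
      rw [map_one, map_one, hv, inv_mul_cancel, OneMemClass.coe_one, inv_one, mul_one, mul_one] at this
      exact (inv_mul_eq_one.1 (Subtype.ext this.symm)).symm
    subst hg
    refine Prod.ext (Subtype.ext (MonoidHom.ext fun x => ?_)) rfl
    have := h5 v v x
    rw [inv_mul_cancel, OneMemClass.coe_one, inv_one, mul_one, one_mul] at this
    exact this.symm
  · rintro ⟨⟨h, hh⟩, k⟩
    obtain ⟨f, t, hft⟩ := exists_hom_of_isFlat S w (hh.isFlat hp)
    have hft' : ∀ d : Dart S.K, f (dartElement w d) =
        t d.src.1 * connection hp h d * (t d.rev.src.1)⁻¹ := by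
      intro d
      rw [← connectionMatrix_dart]
      exact hft _ _ d.2.2
    -- On edges `p ∘ f` is gauge equivalent to the identity through `p ∘ t`, so it is conjugate to
    -- the identity; evaluation at 1 shows that `p (t i)` does not depend on the vertex.
    have hpf := eq_conj_of_edgeElement (S := S) (f := MonoidHom.id _) (f' := p.comp f)
      (c := fun i => p (t i.1)) (fun d => by
        have := congrArg p (hft' d)
        rw [map_mul, map_mul, map_inv, map_connection] at this
        exact this)
    have hpt : ∀ i : VertexOf S.K, p (t i.1) = p (t v.1) := by
      intro i
      have := hpf i v 1
      rw [map_one, map_one, mul_one] at this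
      exact (mul_inv_eq_one.1 this.symm)
    have hkp : p k = 1 := k.2
    -- Conjugation by u⁻¹ turns `f` into a section, the factor `t v` correcting the conjugation just
    -- found. The factor `k` makes the gauge at `v` equal to `k`.
    let u : G' := t v.1 * k
    have hu : p u = p (t v.1) := by rw [map_mul, hkp, mul_one]
    let s : groupSections p := ⟨(MulAut.conj u⁻¹).toMonoidHom.comp f, MonoidHom.ext fun x => by
      have h1 : p (f x) = p (t v.1) * x * (p (t v.1))⁻¹ := hpf v v x
      change p (u⁻¹ * f x * u⁻¹⁻¹) = x
      rw [map_mul, map_mul, map_inv, map_inv, map_inv, h1, hu]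
      group⟩
    let g : VertexOf S.K → p.ker := fun i => ⟨(t i.1)⁻¹ * u, by
      rw [MonoidHom.mem_ker, map_mul, map_inv, hu, hpt, inv_mul_cancel]⟩
    have hs : ∀ x, s.1 x = u⁻¹ * f x * u := fun x => by simp [s]
    refine ⟨(s, g), Prod.ext (Subtype.ext (connection_injective hp (funext fun d => ?_))) ?_⟩
    · change connection hp (sectionConnection hp s g) d = connection hp h d
      rw [connection_sectionConnection, hs, hft']
      simp only [g]
      group
    · ext1
      simp [g, u]

theorem exists_vertex (S : ClosedOrientedSurface W) (w : W) : Nonempty (VertexOf S.K) :=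
  let ⟨i, hi⟩ := exists_mem_openStar S w
  ⟨⟨i, singleton_mem_of_mem_openStar hi⟩⟩

theorem finite_groupSections (S : ClosedOrientedSurface W) {p : G' →* FundamentalGroup W w}
    (hp : Function.Surjective p) [Finite p.ker] : (groupSections p).Finite := by
  obtain ⟨v⟩ := exists_vertex S w
  have h1 : Finite (groupSections p × (VertexOf S.K → p.ker)) :=
    Finite.of_injective _ (sectionConnection_bijective (S := S) hp v).1
  have h2 : Finite (groupSections p) :=
    Finite.of_injective (fun s => (s, fun _ => 1) :
      groupSections p → groupSections p × (VertexOf S.K → p.ker))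
      fun s s' h => (Prod.ext_iff.1 h).1
  exact Set.toFinite _

theorem card_groupSections [Finite p.ker] :
    (groupSections p).ncard * Nat.card p.ker ^ Nat.card (VertexOf S.K) =
      Nat.card {h : EdgeOf S.K → p.ker // IsFlatConnection hp h} * Nat.card p.ker := by
  obtain ⟨v⟩ := exists_vertex S w
  have h := Nat.card_congr (Equiv.ofBijective _ (sectionConnection_bijective (S := S) hp v))
  rw [Nat.card_prod, Nat.card_prod, Nat.card_fun] at h
  exact h

end CountSections

/-! ### The action of the quotient group on class functions of the kernel. -/

section ClassFunctions

variable {G' G : Type*} [Group G'] [Group G] {p : G' →* G}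

/-- The class functions on the kernel of an epimorphism. -/
@[ext]
structure KerClassFunction (_hp : Function.Surjective p) where
  /-- The underlying function. -/
  val : p.ker → ℂ
  map_conj : ∀ k l, val (k * l * k⁻¹) = val l

variable {hp : Function.Surjective p}

/-- Two lifts differ by an element of the kernel, whose conjugation class functions do not see. This
makes the action of `G` independent of lifts. -/
theorem KerClassFunction.conj_eq (φ : KerClassFunction hp) {x y : G'} (hxy : p x = p y)
    (k : p.ker) : φ.1 (MulAut.conjNormal x⁻¹ k) = φ.1 (MulAut.conjNormal y⁻¹ k) := by
  have hm : y⁻¹ * x ∈ p.ker := by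
    rw [MonoidHom.mem_ker, map_mul, map_inv, hxy, inv_mul_cancel]
  rw [← φ.map_conj ⟨y⁻¹ * x, hm⟩ (MulAut.conjNormal x⁻¹ k)]
  refine congrArg φ.1 (Subtype.ext ?_)
  simp only [Subgroup.coe_mul, Subgroup.coe_inv, MulAut.conjNormal_apply]
  group

/-- The image of an epimorphism acts on the class functions on the kernel by conjugation. -/
instance : MulAction G (KerClassFunction hp) where
  smul α φ := ⟨fun k => φ.1 (MulAut.conjNormal (Function.surjInv hp α)⁻¹ k), fun k l => by
    simp only [map_mul, map_inv, φ.map_conj]⟩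
  one_smul φ := KerClassFunction.ext (funext fun k =>
    (φ.conj_eq ((Function.surjInv_eq hp 1).trans (map_one p).symm) k).trans (by simp))
  mul_smul α β φ := KerClassFunction.ext (funext fun k => by
    refine (φ.conj_eq (y := Function.surjInv hp α * Function.surjInv hp β)
      (by rw [map_mul, Function.surjInv_eq hp, Function.surjInv_eq hp, Function.surjInv_eq hp]) k).trans ?_
    change φ.1 _ = φ.1 (MulAut.conjNormal (Function.surjInv hp β)⁻¹
      (MulAut.conjNormal (Function.surjInv hp α)⁻¹ k))
    refine congrArg φ.1 (Subtype.ext ?_)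
    simp [mul_assoc])

theorem KerClassFunction.smul_apply (φ : KerClassFunction hp) {α : G} {x : G'} (hx : p x = α)
    (k : p.ker) : (α • φ).1 k = φ.1 (MulAut.conjNormal x⁻¹ k) :=
  φ.conj_eq ((Function.surjInv_eq hp α).trans hx.symm) k

variable (hp) in
/-- The character of a representation of the kernel as a class function. -/
def repClassFunction {n : ℕ} (ρ : p.ker →* GL (Fin n) ℂ) : KerClassFunction hp :=
  ⟨repChar ρ, fun k l => by rw [repChar_mul_comm, inv_mul_cancel_left]⟩

theorem smul_repClassFunction {n : ℕ} (ρ : p.ker →* GL (Fin n) ℂ) {α : G} {x : G'}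
    (hx : p x = α) : α • repClassFunction hp ρ = repClassFunction hp (conjRep p ρ x) :=
  KerClassFunction.ext (funext fun k => KerClassFunction.smul_apply _ hx k)

theorem IsIrreducibleRep.conjRep {n : ℕ} {ρ : p.ker →* GL (Fin n) ℂ} (hρ : IsIrreducibleRep ρ)
    (x : G') : IsIrreducibleRep (conjRep p ρ x) := by
  refine ⟨hρ.1, fun U hU => hρ.2 U fun h y hy => ?_⟩
  have := hU ((MulAut.conjNormal x⁻¹ : MulAut p.ker).symm h) y hy
  simpa [_root_.conjRep] using this

/-- Irreducible representations are determined by their characters, so fixing the character means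
fixing the class. -/
theorem mem_repStabilizer_of_smul_eq [Finite p.ker] {n : ℕ} {ρ : p.ker →* GL (Fin n) ℂ}
    (hρ : IsIrreducibleRep ρ) {α : G}
    (h : α • repClassFunction hp ρ = repClassFunction hp ρ) : α ∈ repStabilizer p ρ := by
  obtain ⟨x, hx⟩ := hp α
  rw [smul_repClassFunction ρ hx] at h
  exact ⟨x, hx, repEquivalent_of_repChar_eq hρ (hρ.conjRep x) (congrArg KerClassFunction.val h).symm⟩

end ClassFunctions

/-! ### The two triangles at an edge. -/

namespace SurfaceOrientation

variable {N : ℕ} {K : PreAbstractSimplicialComplex (Fin N)} (o : SurfaceOrientation K)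
  (hK : IsClosedSurface K) (d : Dart K)

theorem third_ne : d.1.1 ≠ o.third hK d ∧ d.1.2 ≠ o.third hK d := by
  have h := o.ne_of_sign_ne_zero (i := d.1.1) (j := d.1.2) (k := o.third hK d)
    (by rw [o.sign_third hK]; exact one_ne_zero)
  exact h.2

theorem next_ne : o.next hK d ≠ d := fun h =>
  d.2.1 (congrArg (fun d : Dart K => d.1.1) h).symm

theorem next_ne_rev : o.next hK d ≠ d.rev := fun h =>
  (o.third_ne hK d).1 (congrArg (fun d : Dart K => d.1.2) h).symm

theorem next_next_ne : o.next hK (o.next hK d) ≠ d := fun h => by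
  have := o.next_next_next hK d
  rw [h] at this
  exact o.next_ne hK d this

theorem next_next_ne_rev : o.next hK (o.next hK d) ≠ d.rev := fun h =>
  (o.third_ne hK d).2 (congrArg (fun d : Dart K => d.1.1) h).symm

/-- The triangle on the positive side of an oriented edge. -/
def faceOf : o.Face := ((o.sideEquiv hK).symm d).1

theorem faceOf_side (q : o.Face × Fin 3) : o.faceOf hK (o.side q) = q.1 :=
  congrArg Prod.fst ((o.sideEquiv hK).symm_apply_apply q)

theorem exists_side : ∃ m, o.side (o.faceOf hK d, m) = d :=
  ⟨((o.sideEquiv hK).symm d).2, (o.sideEquiv hK).apply_symm_apply d⟩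

/-- No side of a positive triangle is the reverse of another, its vertices being distinct. Hence an
edge variable enters two different factors of the product over triangles. -/
theorem faceOf_rev_ne : o.faceOf hK d ≠ o.faceOf hK d.rev := by
  intro h
  obtain ⟨m, hm⟩ := o.exists_side hK d
  obtain ⟨m', hm'⟩ := o.exists_side hK d.rev
  rw [← h] at hm'
  have h0 : m' = m ∨ m' = m + 1 ∨ m' = m + 1 + 1 :=
    (by decide : ∀ m m' : Fin 3, m' = m ∨ m' = m + 1 ∨ m' = m + 1 + 1) m m'
  rcases h0 with rfl | rfl | rfl
  · rw [hm] at hm'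
    exact d.2.1 (congrArg (fun d : Dart K => d.1.1) hm')
  · rw [← o.next_side hK, hm] at hm'
    exact o.next_ne_rev hK d hm'
  · rw [← o.next_side hK, ← o.next_side hK, hm] at hm'
    exact o.next_next_ne_rev hK d hm'

end SurfaceOrientation

/-! ### Vanishing of all but the constant invariant colourings. -/

section Vanishing

variable {W : Type*} [TopologicalSpace W] {S : ClosedOrientedSurface W} [PathConnectedSpace W]
  {w : W} {G' : Type*} [Group G'] {p : G' →* FundamentalGroup W w} (hp : Function.Surjective p)

section Change

variable [DecidableEq (EdgeOf S.K)] (h : EdgeOf S.K → p.ker) (e : EdgeOf S.K) (k : p.ker)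

theorem connection_mul_mulSingle :
    connection hp (h * Pi.mulSingle e k) (edgeBoolEquiv S.K (e, true)) =
      connection hp h (edgeBoolEquiv S.K (e, true)) * k := by
  rw [connection_true, connection_true, Pi.mul_apply, Pi.mulSingle_eq_same, Subgroup.coe_mul,
    mul_assoc]

theorem connection_mul_mulSingle_of_ne {d : Dart S.K} (h1 : d ≠ edgeBoolEquiv S.K (e, true))
    (h2 : d ≠ (edgeBoolEquiv S.K (e, true)).rev) :
    connection hp (h * Pi.mulSingle e k) d = connection hp h d := by
  obtain ⟨⟨e', b⟩, rfl⟩ := (edgeBoolEquiv S.K).surjective d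
  have hne : e' ≠ e := by
    rintro rfl
    rw [edgeBoolEquiv_rev] at h2
    cases b
    · exact h2 rfl
    · exact h1 rfl
  cases b
  · rw [connection_false, connection_false, Pi.mul_apply, Pi.mulSingle_eq_of_ne hne, mul_one]
  · rw [connection_true, connection_true, Pi.mul_apply, Pi.mulSingle_eq_of_ne hne, mul_one]

theorem holonomy_mul_mulSingle_of_ne {f : S.orientation.Face}
    (h1 : f ≠ S.orientation.faceOf S.closed (edgeBoolEquiv S.K (e, true)))
    (h2 : f ≠ S.orientation.faceOf S.closed (edgeBoolEquiv S.K (e, true)).rev) :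
    holonomy hp (h * Pi.mulSingle e k) (S.orientation.side (f, 0)) =
      holonomy hp h (S.orientation.side (f, 0)) := by
  have key : ∀ m, connection hp (h * Pi.mulSingle e k) (S.orientation.side (f, m)) =
      connection hp h (S.orientation.side (f, m)) := fun m => by
    refine connection_mul_mulSingle_of_ne hp h e k ?_ ?_
    · intro hd
      rw [← hd, S.orientation.faceOf_side] at h1
      exact h1 rfl
    · intro hd
      rw [← hd, S.orientation.faceOf_side] at h2
      exact h2 rfl
  ext1
  simp only [holonomy, S.orientation.next_side, key]

/-- Based after the edge, the holonomy has the edge variable as its last factor. Based at the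
reversed edge, the other holonomy has the inverse variable first; both base points lie at the same
vertex. -/
theorem holonomy_next_mul_mulSingle :
    holonomy hp (h * Pi.mulSingle e k) (S.orientation.next S.closed (edgeBoolEquiv S.K (e, true))) =
      holonomy hp h (S.orientation.next S.closed (edgeBoolEquiv S.K (e, true))) * k := by
  ext1
  simp only [holonomy, S.orientation.next_next_next, Subgroup.coe_mul]
  rw [connection_mul_mulSingle, connection_mul_mulSingle_of_ne hp h e k
    (S.orientation.next_ne S.closed _) (S.orientation.next_ne_rev S.closed _),
    connection_mul_mulSingle_of_ne hp h e k (S.orientation.next_next_ne S.closed _)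
      (S.orientation.next_next_ne_rev S.closed _), mul_assoc, mul_assoc, mul_assoc]

theorem holonomy_rev_mul_mulSingle :
    holonomy hp (h * Pi.mulSingle e k) (edgeBoolEquiv S.K (e, true)).rev =
      k⁻¹ * holonomy hp h (edgeBoolEquiv S.K (e, true)).rev := by
  ext1
  simp only [holonomy, Subgroup.coe_mul, Subgroup.coe_inv]
  rw [connection_rev, connection_mul_mulSingle, connection_mul_mulSingle_of_ne hp h e k
    (S.orientation.next_ne_rev S.closed _) (S.orientation.next_ne S.closed _),
    connection_mul_mulSingle_of_ne hp h e k (S.orientation.next_next_ne_rev S.closed _)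
      (S.orientation.next_next_ne S.closed _), connection_rev, mul_inv_rev]
  simp only [mul_assoc]

end Change

variable (c : S.orientation.Face → Irr p.ker)

/-- The group element that moves the first corner of a triangle to another one. -/
def cornerElement (w : W) (f : S.orientation.Face) : Fin 3 → FundamentalGroup W w :=
  ![1, dartElement w (S.orientation.side (f, 0)),
    dartElement w (S.orientation.side (f, 0)) * dartElement w (S.orientation.side (f, 1))]

/-- For m = 2 the index wraps round to corner 0, and the identity is the triangle relation. -/
theorem cornerElement_add_one (f : S.orientation.Face) (m : Fin 3) :
    cornerElement w f (m + 1) =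
      cornerElement w f m * dartElement w (S.orientation.side (f, m)) := by
  have h := dartElement_triangle (w := w) (S.orientation.side (f, 0))
  rw [S.orientation.next_side, S.orientation.next_side] at h
  fin_cases m
  · exact (one_mul _).symm
  · rfl
  · exact h.symm

/-- The character colouring a triangle, transported to the corner at the source of an oriented
edge. -/
def cornerCharacter (d : Dart S.K) : KerClassFunction hp :=
  (cornerElement w ((S.orientation.sideEquiv S.closed).symm d).1
    ((S.orientation.sideEquiv S.closed).symm d).2)⁻¹ •
      repClassFunction hp (c ((S.orientation.sideEquiv S.closed).symm d).1).rep

theorem cornerCharacter_side (f : S.orientation.Face) (m : Fin 3) :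
    cornerCharacter hp c (S.orientation.side (f, m)) =
      (cornerElement w f m)⁻¹ • repClassFunction hp (c f).rep := by
  have h : (S.orientation.sideEquiv S.closed).symm (S.orientation.side (f, m)) = (f, m) :=
    (S.orientation.sideEquiv S.closed).symm_apply_apply (f, m)
  rw [cornerCharacter, h]

theorem cornerCharacter_next (d : Dart S.K) :
    cornerCharacter hp c (S.orientation.next S.closed d) =
      (dartElement w d)⁻¹ • cornerCharacter hp c d := by
  obtain ⟨⟨f, m⟩, rfl⟩ := (S.orientation.side_bijective S.closed).2 d
  rw [S.orientation.next_side, cornerCharacter_side, cornerCharacter_side, cornerElement_add_one,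
    mul_inv_rev, mul_smul]

theorem exists_cornerCharacter_eq (d : Dart S.K) : ∃ (n : ℕ) (σ : p.ker →* GL (Fin n) ℂ),
    IsIrreducibleRep σ ∧ (cornerCharacter hp c d).1 = repChar σ := by
  obtain ⟨⟨f, m⟩, rfl⟩ := (S.orientation.side_bijective S.closed).2 d
  obtain ⟨x, hx⟩ := hp (cornerElement w f m)⁻¹
  rw [cornerCharacter_side, smul_repClassFunction _ hx]
  exact ⟨_, _, (c f).rep_irreducible.conjRep x, rfl⟩

/-- Passing to the next corner conjugates the holonomy and the character by the same lift, so the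
value does not change. Any side may therefore serve as base point. -/
theorem cornerCharacter_holonomy_next (h : EdgeOf S.K → p.ker) (d : Dart S.K) :
    (cornerCharacter hp c (S.orientation.next S.closed d)).1
      (holonomy hp h (S.orientation.next S.closed d)) =
        (cornerCharacter hp c d).1 (holonomy hp h d) := by
  rw [cornerCharacter_next, KerClassFunction.smul_apply _ (x := (connection hp h d)⁻¹)
    (by rw [map_inv, map_connection])]
  refine congrArg (cornerCharacter hp c d).1 (Subtype.ext ?_)
  rw [MulAut.conjNormal_apply, coe_holonomy_next]
  group

theorem repChar_holonomy_faceOf (h : EdgeOf S.K → p.ker) (d : Dart S.K) :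
    repChar (c (S.orientation.faceOf S.closed d)).rep
      (holonomy hp h (S.orientation.side (S.orientation.faceOf S.closed d, 0))) =
        (cornerCharacter hp c d).1 (holonomy hp h d) := by
  obtain ⟨⟨f, m⟩, rfl⟩ := (S.orientation.side_bijective S.closed).2 d
  rw [S.orientation.faceOf_side]
  have h0 : (cornerCharacter hp c (S.orientation.side (f, 0))).1
      (holonomy hp h (S.orientation.side (f, 0))) =
      repChar (c f).rep (holonomy hp h (S.orientation.side (f, 0))) := by
    rw [cornerCharacter_side, show cornerElement w f 0 = 1 from rfl, inv_one, one_smul]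
    rfl
  have h1 := cornerCharacter_holonomy_next hp c h (S.orientation.side (f, 0))
  have h2 := cornerCharacter_holonomy_next hp c h (S.orientation.side (f, 1))
  rw [S.orientation.next_side] at h1 h2
  rw [← h0]
  fin_cases m
  · rfl
  · exact h1.symm
  · exact (h2.trans h1).symm

variable [Fintype p.ker] [Fintype (EdgeOf S.K)]

/-- Translation invariance: averaging the total sum over the translations `g b` leaves it unchanged,
while the order of summation can be exchanged. -/
theorem sum_eq_zero_of_sum_mul_right {A B : Type*} [Group A] [Fintype A] [Fintype B] [Nonempty B]
    (F : A → ℂ) (g : B → A) (h : ∀ a, ∑ b, F (a * g b) = 0) : ∑ a, F a = 0 := by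
  have h1 : ∑ b : B, ∑ a, F (a * g b) = 0 := by
    rw [Finset.sum_comm]
    exact Finset.sum_eq_zero fun a _ => h a
  have h2 : ∀ b, ∑ a, F (a * g b) = ∑ a, F a := fun b => Equiv.sum_comp (Equiv.mulRight (g b)) F
  simp_rw [h2, Finset.sum_const, nsmul_eq_mul] at h1
  exact (mul_eq_zero.1 h1).resolve_left (Nat.cast_ne_zero.2 Fintype.card_ne_zero)

open Classical in
-- With all edge variables but one fixed, only the factors of the two adjacent triangles vary, and
-- their sum is an orthogonality sum of two different irreducible characters.
theorem sum_prod_repChar_eq_zero {e : EdgeOf S.K}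
    (hne : cornerCharacter hp c (S.orientation.next S.closed (edgeBoolEquiv S.K (e, true))) ≠
      cornerCharacter hp c (edgeBoolEquiv S.K (e, true)).rev) :
    ∑ h : EdgeOf S.K → p.ker, ∏ f,
      repChar (c f).rep (holonomy hp h (S.orientation.side (f, 0))) = 0 := by
  set d := edgeBoolEquiv S.K (e, true) with hd
  have key : ∀ h : EdgeOf S.K → p.ker, ∑ k : p.ker, ∏ f,
      repChar (c f).rep (holonomy hp (h * Pi.mulSingle e k) (S.orientation.side (f, 0))) = 0 := by
    intro h
    obtain ⟨n, σ, hσ, hσc⟩ := exists_cornerCharacter_eq hp c (S.orientation.next S.closed d)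
    obtain ⟨m, τ, hτ, hτc⟩ := exists_cornerCharacter_eq hp c d.rev
    have hf := S.orientation.faceOf_rev_ne S.closed d
    have hk : ∀ k : p.ker, ∏ f,
        repChar (c f).rep (holonomy hp (h * Pi.mulSingle e k) (S.orientation.side (f, 0))) =
        (repChar σ (k * holonomy hp h (S.orientation.next S.closed d)) *
          repChar τ (k⁻¹ * holonomy hp h d.rev)) *
        ∏ f ∈ (Finset.univ.erase (S.orientation.faceOf S.closed d)).erase
          (S.orientation.faceOf S.closed d.rev),
            repChar (c f).rep (holonomy hp h (S.orientation.side (f, 0))) := by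
      intro k
      rw [← Finset.mul_prod_erase _ _ (Finset.mem_univ (S.orientation.faceOf S.closed d)),
        ← Finset.mul_prod_erase _ _ (Finset.mem_erase.2 ⟨hf.symm,
          Finset.mem_univ (S.orientation.faceOf S.closed d.rev)⟩), ← mul_assoc]
      congr 1
      · rw [repChar_holonomy_faceOf, repChar_holonomy_faceOf, ← cornerCharacter_holonomy_next,
          hσc, hτc, hd, holonomy_next_mul_mulSingle, holonomy_rev_mul_mulSingle,
          repChar_mul_comm (ρ := σ)]
      · refine Finset.prod_congr rfl fun f hf' => ?_
        rw [holonomy_mul_mulSingle_of_ne hp h e k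
          (Finset.ne_of_mem_erase (Finset.mem_of_mem_erase hf')) (Finset.ne_of_mem_erase hf')]
    simp_rw [hk]
    rw [← Finset.sum_mul, sum_repChar_mul_eq_zero hσ hτ, zero_mul]
    rw [← hσc, ← hτc]
    exact fun h => hne (KerClassFunction.ext h)
  exact sum_eq_zero_of_sum_mul_right _ (Pi.mulSingle e) key

/-- A colouring of the triangles by irreducible representations contributes only if it is constant
with an invariant colour. -/
theorem exists_smul_eq_of_sum_ne_zero (hc : ∑ h : EdgeOf S.K → p.ker, ∏ f,
      repChar (c f).rep (holonomy hp h (S.orientation.side (f, 0))) ≠ 0) :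
    ∃ φ : KerClassFunction hp, (∀ g : FundamentalGroup W w, g • φ = φ) ∧
      ∀ f, repClassFunction hp (c f).rep = φ := by
  have hsmul : ∀ d : Dart S.K, cornerCharacter hp c d =
      dartElement w d • cornerCharacter hp c (S.orientation.next S.closed d) := fun d => by
    rw [cornerCharacter_next, smul_inv_smul]
  have htrue : ∀ e : EdgeOf S.K,
      cornerCharacter hp c (S.orientation.next S.closed (edgeBoolEquiv S.K (e, true))) =
        cornerCharacter hp c (edgeBoolEquiv S.K (e, true)).rev := fun e => by
    by_contra hne
    exact hc (sum_prod_repChar_eq_zero hp c hne)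
  -- The matching condition at an edge, transported to its other end when necessary, is invariance
  -- under rotation about the source of a dart.
  have hrot : ∀ d : Dart S.K, cornerCharacter hp c d =
      cornerCharacter hp c (S.orientation.next S.closed d.rev) := by
    intro d
    obtain ⟨⟨e, _ | _⟩, rfl⟩ := (edgeBoolEquiv S.K).surjective d
    · rw [edgeBoolEquiv_rev]
      have := htrue e
      rw [edgeBoolEquiv_rev] at this
      exact this.symm
    · rw [cornerCharacter_next, dartElement_rev, inv_inv, ← htrue e]
      exact hsmul _
  have hsrc : ∀ {d d' : Dart S.K}, d.src = d'.src →
      cornerCharacter hp c d = cornerCharacter hp c d' := fun h =>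
    S.orientation.eq_of_src_eq S.closed _ hrot h
  obtain ⟨v⟩ := exists_vertex S w
  choose D hD using SurfaceOrientation.exists_dart S.closed
  classical
  -- Corner characters descend to vertices; the value at other indices is irrelevant.
  let t : Fin S.N → KerClassFunction hp := fun i =>
    if hi : ({i} : Finset (Fin S.N)) ∈ S.K then cornerCharacter hp c (D ⟨i, hi⟩)
    else cornerCharacter hp c (D v)
  have ht : ∀ d : Dart S.K, cornerCharacter hp c d = t d.src.1 := fun d => by
    rw [show t d.src.1 = cornerCharacter hp c (D d.src) from dif_pos d.src.2]
    exact hsrc (hD _).symm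
  have hedge : ∀ i j, ({i, j} : Finset (Fin S.N)) ∈ S.K → t i = edgeElement S w i j • t j := by
    intro i j hij
    by_cases hne : i = j
    · subst hne
      rw [edgeElement_self (by simpa using hij), one_smul]
    · have h1 := hsmul ⟨(i, j), hne, hij⟩
      rw [ht, ht] at h1
      exact h1
  -- Every group element is represented by a walk between any two vertices, so all values coincide
  -- and are fixed by the whole group.
  have hwalk : ∀ i : VertexOf S.K, ∀ g : FundamentalGroup W w, t i.1 = g • t v.1 :=
    fun i g => (edgeWalk i.2 v.2 g).eq_smul hedge
  refine ⟨t v.1, fun g => (hwalk v g).symm, fun f => ?_⟩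
  have h1 := cornerCharacter_side hp c f 0
  rw [show cornerElement w f 0 = 1 from rfl, inv_one, one_smul, ht, hwalk _ 1, one_smul] at h1
  exact h1.symm

theorem colour_eq_of_sum_ne_zero (hc : ∑ h : EdgeOf S.K → p.ker, ∏ f,
      repChar (c f).rep (holonomy hp h (S.orientation.side (f, 0))) ≠ 0)
    (f f' : S.orientation.Face) : c f = c f' ∧ repStabilizer p (c f).rep = ⊤ := by
  obtain ⟨φ, hφ, hcφ⟩ := exists_smul_eq_of_sum_ne_zero hp c hc
  refine ⟨Irr.ext_repChar (congrArg KerClassFunction.val ((hcφ f).trans (hcφ f').symm)),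
    (Subgroup.eq_top_iff' _).2 fun g => ?_⟩
  refine mem_repStabilizer_of_smul_eq (hp := hp) (c f).rep_irreducible ?_
  rw [hcφ, hφ]

end Vanishing

/-! ### The state sum of an irreducible representation. -/

section StateSum

variable {N : ℕ} {K : PreAbstractSimplicialComplex (Fin N)} {n : ℕ}

/-- A triangle i < j < k occurs once among the faces: as (i, j, k) if its sign is 1, and as (i, k,
j), with inverse factor, if its sign is -1. -/
theorem SurfaceOrientation.prod_face (o : SurfaceOrientation K) {M : Type*} [CommGroup M]
    (z : Fin N → Fin N → Fin N → M) :
    (∏ f : o.Face, if f.1.2.1 < f.1.2.2 then z f.1.1 f.1.2.1 f.1.2.2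
      else (z f.1.1 f.1.2.2 f.1.2.1)⁻¹) =
      ∏ i, ∏ j, ∏ k, if i < j ∧ j < k then z i j k ^ o.sign i j k else 1 := by
  have hF : ∀ F : Fin N × Fin N × Fin N → M, ∏ f : o.Face, F f.1 =
      ∏ t : Fin N × Fin N × Fin N,
        if o.sign t.1 t.2.1 t.2.2 = 1 ∧ t.1 < t.2.1 ∧ t.1 < t.2.2 then F t else 1 := fun F => by
    rw [← Finset.prod_filter]
    exact (Finset.prod_subtype (Finset.univ.filter fun t : Fin N × Fin N × Fin N =>
      o.sign t.1 t.2.1 t.2.2 = 1 ∧ t.1 < t.2.1 ∧ t.1 < t.2.2) (fun t => by simp) F).symm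
  have hsplit : ∀ i j k, (if o.sign i j k = 1 ∧ i < j ∧ i < k then
      (if j < k then z i j k else (z i k j)⁻¹) else 1) =
      (if o.sign i j k = 1 ∧ i < j ∧ j < k then z i j k else 1) *
        (if o.sign i j k = 1 ∧ i < k ∧ k < j then (z i k j)⁻¹ else 1) := by
    intro i j k
    by_cases hs : o.sign i j k = 1
    · have hjk : j ≠ k := (o.ne_of_sign_ne_zero (i := i) (j := j) (k := k)
        (by rw [hs]; exact one_ne_zero)).2.2
      simp only [hs, true_and]
      rcases lt_or_gt_of_ne hjk with h | h
      · by_cases hij : i < j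
        · simp [h, h.not_gt, hij, hij.trans h]
        · simp [h.not_gt, hij]
      · by_cases hik : i < k
        · simp [h, h.not_gt, hik, hik.trans h]
        · simp [h.not_gt, hik]
    · simp [hs]
  rw [hF fun t => if t.2.1 < t.2.2 then z t.1 t.2.1 t.2.2 else (z t.1 t.2.2 t.2.1)⁻¹]
  simp_rw [Fintype.prod_prod_type, hsplit, Finset.prod_mul_distrib]
  rw [← Finset.prod_mul_distrib]
  refine Finset.prod_congr rfl fun i _ => ?_
  -- Exchanging j and k in the second product brings both orders of a triangle to the same index.
  rw [Finset.prod_comm (f := fun j k => if o.sign i j k = 1 ∧ i < k ∧ k < j then (z i k j)⁻¹ else 1),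
    ← Finset.prod_mul_distrib]
  refine Finset.prod_congr rfl fun j _ => ?_
  rw [← Finset.prod_mul_distrib]
  refine Finset.prod_congr rfl fun k _ => ?_
  rw [o.swap_right i j k]
  by_cases hijk : i < j ∧ j < k
  · simp only [hijk, and_true, and_self, if_true]
    by_cases h0 : o.sign i j k = 0
    · simp [h0]
    · rcases o.sign_eq_one_or h0 with h | h <;> simp [h]
  · simp [hijk]

/-- The matrices of oriented edges: a matrix for each edge, inverted for the opposite
direction. -/
def dartMatrix (A : EdgeOf K → GL (Fin n) ℂ) (d : Dart K) : GL (Fin n) ℂ :=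
  if ((edgeBoolEquiv K).symm d).2 then A ((edgeBoolEquiv K).symm d).1
  else (A ((edgeBoolEquiv K).symm d).1)⁻¹

theorem dartMatrix_true (A : EdgeOf K → GL (Fin n) ℂ) (e : EdgeOf K) :
    dartMatrix A (edgeBoolEquiv K (e, true)) = A e := by
  simp [dartMatrix]

theorem dartMatrix_false (A : EdgeOf K → GL (Fin n) ℂ) (e : EdgeOf K) :
    dartMatrix A (edgeBoolEquiv K (e, false)) = (A e)⁻¹ := by
  rw [dartMatrix, Equiv.symm_apply_apply]
  rfl

theorem trace_mul_mul_eq_sum (Q : Fin 3 → Matrix (Fin n) (Fin n) ℂ) :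
    (Q 0 * Q 1 * Q 2).trace = ∑ l : Fin 3 → Fin n, ∏ m, Q m (l m) (l (m + 1)) := by
  have h : ∀ l : Fin 3 → Fin n, ∏ m, Q m (l m) (l (m + 1)) =
      Q 0 (l 0) (l 1) * Q 1 (l 1) (l 2) * Q 2 (l 2) (l 0) := fun l => Fin.prod_univ_three _
  simp_rw [h]
  let E : Fin n × Fin n × Fin n ≃ (Fin 3 → Fin n) :=
    { toFun := fun t => ![t.1, t.2.1, t.2.2]
      invFun := fun l => (l 0, l 1, l 2)
      left_inv := fun t => rfl
      right_inv := fun l => by ext m; fin_cases m <;> rfl }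
  rw [← E.sum_comp, Fintype.sum_prod_type]
  simp_rw [Fintype.sum_prod_type]
  simp only [Matrix.trace, Matrix.diag_apply, Matrix.mul_apply, Finset.sum_mul]
  refine Finset.sum_congr rfl fun i _ => ?_
  rw [Finset.sum_comm]
  rfl

variable (o : SurfaceOrientation K)

open Classical in
-- The summation indices of the traces sit at the corners of triangles, and corners correspond to
-- darts.
theorem prod_trace_eq_sum (hK : IsClosedSurface K) [Fintype (Dart K)] (Q : Dart K → Matrix (Fin n) (Fin n) ℂ) :
    ∏ f : o.Face, (Q (o.side (f, 0)) * Q (o.side (f, 1)) * Q (o.side (f, 2))).trace =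
      ∑ l : Dart K → Fin n, ∏ d, Q d (l d) (l (o.next hK d)) := by
  have h1 : ∀ f : o.Face, (Q (o.side (f, 0)) * Q (o.side (f, 1)) * Q (o.side (f, 2))).trace =
      ∑ l : Fin 3 → Fin n, ∏ m, Q (o.side (f, m)) (l m) (l (m + 1)) := fun f =>
    trace_mul_mul_eq_sum fun m => Q (o.side (f, m))
  simp_rw [h1]
  rw [Finset.prod_univ_sum, Fintype.piFinset_univ]
  let E : (Dart K → Fin n) ≃ (o.Face → Fin 3 → Fin n) :=
    ((o.sideEquiv hK).symm.arrowCongr (Equiv.refl _)).trans (Equiv.curry _ _ _)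
  rw [← E.sum_comp]
  refine Finset.sum_congr rfl fun l _ => ?_
  rw [← (o.sideEquiv hK).prod_comp, Fintype.prod_prod_type]
  refine Finset.prod_congr rfl fun f _ => Finset.prod_congr rfl fun m _ => ?_
  change _ = Q (o.side (f, m)) (l (o.side (f, m))) (l (o.next hK (o.side (f, m))))
  rw [o.next_side]
  rfl

open Classical in
/-- The state sum of a closed surface with the matrices of an irreducible representation on the
edges. -/
theorem sum_prod_trace (hK : IsClosedSurface K) [Fintype (EdgeOf K)] {Γ : Type*} [Group Γ] [Fintype Γ] {ρ : Γ →* GL (Fin n) ℂ}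
    (hρ : IsIrreducibleRep ρ) (B : EdgeOf K → GL (Fin n) ℂ) :
    ∑ h : EdgeOf K → Γ, ∏ f : o.Face,
      ((dartMatrix (fun e => B e * ρ (h e)) (o.side (f, 0)) : Matrix (Fin n) (Fin n) ℂ) *
        (dartMatrix (fun e => B e * ρ (h e)) (o.side (f, 1)) : Matrix (Fin n) (Fin n) ℂ) *
        (dartMatrix (fun e => B e * ρ (h e)) (o.side (f, 2)) : Matrix (Fin n) (Fin n) ℂ)).trace =
      ((Fintype.card Γ : ℂ) / n) ^ Nat.card (EdgeOf K) * (n : ℂ) ^ Nat.card (VertexOf K) := by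
  have := Fintype.ofFinite (Dart K)
  have h0 : ∀ h : EdgeOf K → Γ, _ := fun h => prod_trace_eq_sum o hK (fun d =>
    ((dartMatrix (fun e => B e * ρ (h e)) d : GL (Fin n) ℂ) : Matrix (Fin n) (Fin n) ℂ))
  simp_rw [h0]
  rw [Finset.sum_comm]
  have h1 : ∀ l : Dart K → Fin n, ∑ h : EdgeOf K → Γ, ∏ d : Dart K,
      (dartMatrix (fun e => B e * ρ (h e)) d : Matrix (Fin n) (Fin n) ℂ) (l d) (l (o.next hK d)) =
      if ∀ d, l d = l (o.next hK d.rev) then ((Fintype.card Γ : ℂ) / n) ^ Nat.card (EdgeOf K)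
        else 0 := by
    intro l
    have h2 : ∀ h : EdgeOf K → Γ, ∏ d : Dart K,
        (dartMatrix (fun e => B e * ρ (h e)) d : Matrix (Fin n) (Fin n) ℂ) (l d)
          (l (o.next hK d)) = ∏ e : EdgeOf K,
        (((B e * ρ (h e) : GL (Fin n) ℂ) : Matrix (Fin n) (Fin n) ℂ)
          (l (edgeBoolEquiv K (e, true))) (l (o.next hK (edgeBoolEquiv K (e, true)))) *
        (((B e * ρ (h e))⁻¹ : GL (Fin n) ℂ) : Matrix (Fin n) (Fin n) ℂ)
          (l (edgeBoolEquiv K (e, false))) (l (o.next hK (edgeBoolEquiv K (e, false))))) := by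
      intro h
      rw [← (edgeBoolEquiv K).prod_comp, Fintype.prod_prod_type]
      refine Finset.prod_congr rfl fun e _ => ?_
      rw [Fintype.prod_bool, dartMatrix_true, dartMatrix_false]
    simp_rw [h2]
    have h3 := Finset.prod_univ_sum (fun _ : EdgeOf K => (Finset.univ : Finset Γ)) (fun e k =>
        (((B e * ρ k : GL (Fin n) ℂ) : Matrix (Fin n) (Fin n) ℂ)
          (l (edgeBoolEquiv K (e, true))) (l (o.next hK (edgeBoolEquiv K (e, true)))) *
        (((B e * ρ k)⁻¹ : GL (Fin n) ℂ) : Matrix (Fin n) (Fin n) ℂ)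
          (l (edgeBoolEquiv K (e, false))) (l (o.next hK (edgeBoolEquiv K (e, false))))))
    rw [Fintype.piFinset_univ] at h3
    rw [← h3]
    -- The factor of an edge is nonzero only if the labels agree at both of its ends; these are the
    -- rotation conditions at its two darts.
    simp_rw [sum_translate_coeff hρ]
    split_ifs with hl
    · rw [Finset.prod_congr rfl fun e _ => if_pos ⟨hl (edgeBoolEquiv K (e, true)),
        (hl (edgeBoolEquiv K (e, false))).symm⟩, Finset.prod_const, Finset.card_univ,
        Nat.card_eq_fintype_card]
    · rw [not_forall] at hl
      obtain ⟨d, hd⟩ := hl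
      obtain ⟨⟨e, _ | _⟩, rfl⟩ := (edgeBoolEquiv K).surjective d
      · exact Finset.prod_eq_zero (Finset.mem_univ e) (if_neg fun h => hd h.2.symm)
      · exact Finset.prod_eq_zero (Finset.mem_univ e) (if_neg fun h => hd h.1)
  simp_rw [h1]
  rw [← Finset.sum_filter, Finset.sum_const, nsmul_eq_mul, mul_comm]
  congr 1
  -- Labels invariant under rotation are labels of the vertices, which explains the power of n.
  have h4 := o.card_rotation_invariant hK (Fin n)
  rw [Nat.card_fun, Nat.card_eq_fintype_card, Nat.card_fin, Fintype.card_subtype] at h4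
  exact_mod_cast h4

end StateSum

/-! ### The contribution of a constant invariant colour. -/

section ConstantColour

variable {W : Type} [TopologicalSpace W] {S : ClosedOrientedSurface W} [PathConnectedSpace W]
  {w : W} {G' : Type*} [Group G'] {p : G' →* FundamentalGroup W w} (hp : Function.Surjective p)
  {n : ℕ} {ρ : p.ker →* GL (Fin n) ℂ} (hρ : IsIrreducibleRep ρ) (hG : repStabilizer p ρ = ⊤)

/-- The projective matrix of the chosen lift of an edge. -/
def edgeMatrix (e : EdgeOf S.K) : GL (Fin n) ℂ :=
  projExt p ρ (toStabilizer p ρ hG (edgeElement S w e.1.1 e.1.2)) (edgeLift hp e)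
    (map_edgeLift hp e)

theorem edgeMatrix_mul (h : EdgeOf S.K → p.ker) (e : EdgeOf S.K) :
    projExt p ρ (toStabilizer p ρ hG (edgeElement S w e.1.1 e.1.2)) (edgeLift hp e * h e)
      (by rw [map_mul, map_edgeLift, (h e).2, mul_one]; rfl) = edgeMatrix hp hG e * ρ (h e) :=
  projExt_mul_ker _ _ _

/-- The contribution of a triangle to the value of the obstruction class. -/
def faceScalar (f : S.orientation.Face) : ℂˣ :=
  if f.1.2.1 < f.1.2.2 then
    zetaScalar p ρ hρ (toStabilizer p ρ hG (edgeElement S w f.1.1 f.1.2.1))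
      (toStabilizer p ρ hG (edgeElement S w f.1.2.1 f.1.2.2))
  else (zetaScalar p ρ hρ (toStabilizer p ρ hG (edgeElement S w f.1.1 f.1.2.2))
      (toStabilizer p ρ hG (edgeElement S w f.1.2.2 f.1.2.1)))⁻¹

/-- The holonomy is y z x⁻¹ or x z⁻¹ y⁻¹ for lifts y, z, x of two edge elements and their product,
according to the sign of the ordered triangle. The projective extension evaluates it with a factor ζ
or ζ⁻¹. -/
theorem rep_holonomy (h : EdgeOf S.K → p.ker) (f : S.orientation.Face) :
    (ρ (holonomy hp h (S.orientation.side (f, 0))) : Matrix (Fin n) (Fin n) ℂ) =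
      (faceScalar hρ hG f : ℂ) •
      ((dartMatrix (fun e => edgeMatrix hp hG e * ρ (h e)) (S.orientation.side (f, 0)) :
          Matrix (Fin n) (Fin n) ℂ) *
        (dartMatrix (fun e => edgeMatrix hp hG e * ρ (h e)) (S.orientation.side (f, 1)) :
          Matrix (Fin n) (Fin n) ℂ) *
        (dartMatrix (fun e => edgeMatrix hp hG e * ρ (h e)) (S.orientation.side (f, 2)) :
          Matrix (Fin n) (Fin n) ℂ)) := by
  obtain ⟨⟨u, v, x⟩, hs, huv, hux⟩ := f
  set f : S.orientation.Face := ⟨⟨u, v, x⟩, hs, huv, hux⟩ with hf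
  dsimp only at hs huv hux
  have hne := S.orientation.ne_of_sign_ne_zero (i := u) (j := v) (k := x)
    (by rw [hs]; exact one_ne_zero)
  -- As `u` is the smallest vertex, side 0 runs along its edge forwards and side 2 backwards; only
  -- the direction of the middle side varies.
  let a : EdgeOf S.K := ⟨(u, v), huv, (S.orientation.side (f, 0)).2.2⟩
  let b : EdgeOf S.K := ⟨(u, x), hux, (S.orientation.side (f, 2)).rev.2.2⟩
  have h0 : S.orientation.side (f, 0) = edgeBoolEquiv S.K (a, true) := rfl
  have h2 : S.orientation.side (f, 2) = edgeBoolEquiv S.K (b, false) := rfl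
  have hmap : ∀ e, p (edgeLift hp e * h e) = edgeElement S w e.1.1 e.1.2 := fun e => by
    rw [map_mul, map_edgeLift, (h e).2, mul_one]
  by_cases hvx : v < x
  · let c : EdgeOf S.K := ⟨(v, x), hvx, (S.orientation.side (f, 1)).2.2⟩
    have h1 : S.orientation.side (f, 1) = edgeBoolEquiv S.K (c, true) := rfl
    have key := projExt_holonomy (q := p) hρ
      (α := toStabilizer p ρ hG (edgeElement S w u v))
      (β := toStabilizer p ρ hG (edgeElement S w v x))
      (γ := toStabilizer p ρ hG (edgeElement S w u x))
      (by rw [← map_mul, edgeElement_mul_of_sign (by rw [hs]; exact one_ne_zero)])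
      (hmap a) (hmap c) (hmap b) (holonomy hp h (S.orientation.side (f, 0))) (by
        simp only [holonomy, S.orientation.next_side]
        change connection hp h (S.orientation.side (f, 0)) *
          connection hp h (S.orientation.side (f, 1)) *
          connection hp h (S.orientation.side (f, 2)) = _
        rw [h0, h1, h2, connection_true, connection_true, connection_false])
    rw [key, faceScalar, if_pos hvx, h0, h1, h2, dartMatrix_true, dartMatrix_true,
      dartMatrix_false, ← edgeMatrix_mul, ← edgeMatrix_mul, ← edgeMatrix_mul]
    rfl
  · have hxv : x < v := lt_of_le_of_ne (not_lt.1 hvx) hne.2.2.symm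
    let c : EdgeOf S.K := ⟨(x, v), hxv, (S.orientation.side (f, 1)).rev.2.2⟩
    have h1 : S.orientation.side (f, 1) = edgeBoolEquiv S.K (c, false) := rfl
    have key := projExt_holonomy_inv (q := p) hρ
      (α := toStabilizer p ρ hG (edgeElement S w u x))
      (β := toStabilizer p ρ hG (edgeElement S w x v))
      (γ := toStabilizer p ρ hG (edgeElement S w u v))
      (by rw [← map_mul, edgeElement_mul_of_sign
            (by rw [S.orientation.swap_right, hs]; norm_num)])
      (hmap b) (hmap c) (hmap a) (holonomy hp h (S.orientation.side (f, 0))) (by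
        simp only [holonomy, S.orientation.next_side]
        change connection hp h (S.orientation.side (f, 0)) *
          connection hp h (S.orientation.side (f, 1)) *
          connection hp h (S.orientation.side (f, 2)) = _
        rw [h0, h1, h2, connection_true, connection_false, connection_false])
    rw [key, faceScalar, if_neg hvx, h0, h1, h2, dartMatrix_true, dartMatrix_false,
      dartMatrix_false, ← edgeMatrix_mul, ← edgeMatrix_mul, ← edgeMatrix_mul]
    rfl

theorem prod_faceScalar : ∏ f : S.orientation.Face, faceScalar hρ hG f =
    zetaEval p ρ hρ hG (fundamentalClass S w) := by
  rw [zetaEval_fundamentalClass]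
  exact S.orientation.prod_face fun i j k =>
    zetaScalar p ρ hρ (toStabilizer p ρ hG (edgeElement S w i j))
      (toStabilizer p ρ hG (edgeElement S w j k))

open Classical in
-- The scalars leave the traces, do not depend on `h`, and multiply to the value of ζ on the
-- fundamental class. What remains is the state sum.
theorem sum_prod_repChar_const [Fintype p.ker] [Fintype (EdgeOf S.K)] :
    ∑ h : EdgeOf S.K → p.ker, ∏ f,
      repChar ρ (holonomy hp h (S.orientation.side (f, 0))) =
      (zetaEval p ρ hρ hG (fundamentalClass S w) : ℂ) *
        (((Nat.card p.ker : ℂ) / n) ^ Nat.card (EdgeOf S.K) *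
          (n : ℂ) ^ Nat.card (VertexOf S.K)) := by
  rw [Nat.card_eq_fintype_card (α := p.ker),
    ← sum_prod_trace S.orientation S.closed hρ (edgeMatrix hp hG), Finset.mul_sum]
  refine Finset.sum_congr rfl fun h _ => ?_
  rw [← prod_faceScalar, Units.coe_prod, ← Finset.prod_mul_distrib]
  refine Finset.prod_congr rfl fun f _ => ?_
  rw [repChar, rep_holonomy hp hρ hG, Matrix.trace_smul, smul_eq_mul]

end ConstantColour

/-! ### Fourier expansion of the number of flat connections. -/

section Count

variable {W : Type} [TopologicalSpace W] {S : ClosedOrientedSurface W} [PathConnectedSpace W]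
  {w : W} {G' : Type*} [Group G'] {p : G' →* FundamentalGroup W w} (hp : Function.Surjective p)

theorem SurfaceOrientation.nonempty_face {N : ℕ} {K : PreAbstractSimplicialComplex (Fin N)}
    (o : SurfaceOrientation K) (hK : IsClosedSurface K) (v : VertexOf K) : Nonempty o.Face :=
  let ⟨d, _⟩ := exists_dart hK v
  ⟨o.faceOf hK d⟩

open Classical in
-- Flatness is a product of delta functions over the triangles; expanding each in characters and
-- multiplying out gives a sum over colourings.
theorem card_flat_mul_pow [Fintype p.ker] [Fintype (EdgeOf S.K)] [Fintype (Irr p.ker)] :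
    (Nat.card {h : EdgeOf S.K → p.ker // IsFlatConnection hp h} : ℂ) *
      (Nat.card p.ker : ℂ) ^ Nat.card S.orientation.Face =
      ∑ c : S.orientation.Face → Irr p.ker, (∏ f, ((c f).dim : ℂ)) *
        ∑ h : EdgeOf S.K → p.ker, ∏ f,
          repChar (c f).rep (holonomy hp h (S.orientation.side (f, 0))) := by
  simp_rw [Finset.mul_sum, ← Finset.prod_mul_distrib]
  rw [Finset.sum_comm]
  have h1 : ∀ h : EdgeOf S.K → p.ker, ∑ c : S.orientation.Face → Irr p.ker,
      ∏ f, (((c f).dim : ℂ) *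
        repChar (c f).rep (holonomy hp h (S.orientation.side (f, 0)))) =
      if IsFlatConnection hp h then (Nat.card p.ker : ℂ) ^ Nat.card S.orientation.Face else 0 := by
    intro h
    have h2 := Finset.prod_univ_sum (fun _ : S.orientation.Face => (Finset.univ : Finset (Irr p.ker)))
      (fun f ρ => (ρ.dim : ℂ) * repChar ρ.rep (holonomy hp h (S.orientation.side (f, 0))))
    rw [Fintype.piFinset_univ] at h2
    rw [← h2]
    simp_rw [sum_dim_mul_repChar]
    split_ifs with hh
    · rw [Finset.prod_congr rfl fun f _ => if_pos (hh f), Finset.prod_const, Finset.card_univ,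
        Nat.card_eq_fintype_card (α := S.orientation.Face)]
    · obtain ⟨f, hf⟩ := not_forall.1 hh
      exact Finset.prod_eq_zero (Finset.mem_univ f) (if_neg hf)
  simp_rw [h1]
  rw [← Finset.sum_filter, Finset.sum_const, nsmul_eq_mul, Nat.card_eq_fintype_card,
    Fintype.card_subtype]

open Classical in
theorem card_flat_eq_sum [Fintype p.ker] [Fintype (EdgeOf S.K)] [Fintype (Irr p.ker)] :
    (Nat.card {h : EdgeOf S.K → p.ker // IsFlatConnection hp h} : ℂ) *
      (Nat.card p.ker : ℂ) ^ Nat.card S.orientation.Face =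
      ∑ ρ : {ρ : Irr p.ker // repStabilizer p ρ.rep = ⊤},
        (ρ.1.dim : ℂ) ^ Nat.card S.orientation.Face *
          ((zetaEval p ρ.1.rep ρ.1.rep_irreducible ρ.2 (fundamentalClass S w) : ℂ) *
            (((Nat.card p.ker : ℂ) / ρ.1.dim) ^ Nat.card (EdgeOf S.K) *
              (ρ.1.dim : ℂ) ^ Nat.card (VertexOf S.K))) := by
  rw [card_flat_mul_pow]
  obtain ⟨v⟩ := exists_vertex S w
  obtain ⟨f₀⟩ := S.orientation.nonempty_face S.closed v
  -- Invariant classes embed as constant colourings, injectively because a triangle exists; all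
  -- other colourings contribute zero.
  refine (Fintype.sum_of_injective (fun ρ (_ : S.orientation.Face) => ρ.1) (fun ρ σ h => ?_)
    _ _ (fun c hc => ?_) fun ρ => ?_).symm
  · exact Subtype.ext (congrFun h f₀)
  · by_contra hne
    have h1 := colour_eq_of_sum_ne_zero hp c (right_ne_zero_of_mul hne)
    exact hc ⟨⟨c f₀, (h1 f₀ f₀).2⟩, funext fun f => (h1 f₀ f).1⟩
  · rw [sum_prod_repChar_const hp ρ.1.rep_irreducible ρ.2, Finset.prod_const, Finset.card_univ,
      Nat.card_eq_fintype_card (α := S.orientation.Face)]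

end Count

/-- Both sides have the same exponents: V - E + F for n, and E for q. With V, E and F the cell
counts, the negative Euler characteristic appears. -/
theorem pow_mul_pow_mul_div_pow {K : Type*} [Field K] {q n : K} (hq : q ≠ 0) (hn : n ≠ 0)
    (V E F : ℕ) : n ^ F * ((q / n) ^ E * n ^ V) =
      q ^ V * q ^ F * (q / n) ^ (-((V : ℤ) - E + F)) := by
  have hqn : q / n ≠ 0 := div_ne_zero hq hn
  have h : (q / n) ^ (-((V : ℤ) - E + F)) * ((q / n) ^ V * (q / n) ^ F) = (q / n) ^ E := by
    rw [← zpow_natCast, ← zpow_natCast, ← zpow_natCast, ← zpow_add₀ hqn, ← zpow_add₀ hqn]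
    congr 1
    ring
  rw [← h, div_pow, div_pow]
  field_simp

end

theorem corollary1p3p4 {W : Type} [TopologicalSpace W] [PathConnectedSpace W]
    (S : ClosedOrientedSurface W) (hS : 0 < S.genus) (w : W)
    {π' : Type*} [Group π'] (p : π' →* FundamentalGroup W w) (hp : Function.Surjective p)
    [Finite p.ker] :
    Finite (Irr p.ker) ∧ (groupSections p).Finite ∧
      ((groupSections p).ncard : ℂ) =
        (Nat.card p.ker : ℂ) *
          ∑ᶠ ρ : {ρ : Irr p.ker // repStabilizer p ρ.rep = ⊤},
            ((Nat.card p.ker : ℂ) / (ρ.1.dim : ℂ)) ^ (-S.eulerChar) *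
              (zetaEval p ρ.1.rep ρ.1.rep_irreducible ρ.2 (fundamentalClass S w) : ℂ) := by
  classical
  refine ⟨inferInstance, finite_groupSections S hp, ?_⟩
  have := Fintype.ofFinite p.ker
  have := Fintype.ofFinite (EdgeOf S.K)
  have := Fintype.ofFinite (Irr p.ker)
  rw [finsum_eq_sum_of_fintype]
  have hq : (Nat.card p.ker : ℂ) ≠ 0 := Nat.cast_ne_zero.2 Nat.card_pos.ne'
  have h1 := congrArg (Nat.cast (R := ℂ)) (card_groupSections (S := S) hp)
  push_cast at h1
  have h2 := card_flat_eq_sum (S := S) hp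
  -- The factor |Φ|^V comes from the gauge transformations and |Φ|^F from the delta functions.
  refine mul_right_cancel₀ (mul_ne_zero (pow_ne_zero (Nat.card (VertexOf S.K)) hq)
    (pow_ne_zero (Nat.card S.orientation.Face) hq)) ?_
  rw [← mul_assoc, h1, mul_right_comm, h2, mul_comm, mul_assoc, Finset.sum_mul]
  congr 1
  refine Finset.sum_congr rfl fun ρ _ => ?_
  have hn : (ρ.1.dim : ℂ) ≠ 0 := Nat.cast_ne_zero.2 ρ.1.dim_pos.ne'
  rw [mul_left_comm, pow_mul_pow_mul_div_pow hq hn, S.eulerChar_eq]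
  ring
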